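/- **Proposition 3.3.** Let $(M,J)$ be an almost complex manifold, let $T_{\mathbb C}M=T^{1,0}\oplus T^{0,1}$ be the decomposition into the $\pm i$-eigenbundles of $J$, let $A(M)$ be the algebra of smooth complex-valued differential forms on $M$, with $A^m(M)=\bigoplus_{a+b=m}A^{a,b}(M)$, and let $A^{a,b}(M,T^{1,0})$, $A^{a,b}(M,T^{0,1})$ be the spaces of smooth forms of type $(a,b)$ with values in $T^{1,0}$, $T^{0,1}$. Here $a,b\in\mathbb Z$, and these spaces are $0$ if $a<0$ or $b<0$. Let $\Pi^{a,b}:A(M)\to A^{a,b}(M)$ be the projections and put $$\partial=\sum_{a,b}\Pi^{a+1,b}\,d\,\Pi^{a,b},\qquad \bar\partial=\sum_{a,b}\Pi^{a,b+1}\,d\,\Pi^{a,b}.$$ For a form $K$ of degree $k$ with values in $T_{\mathbb C}M$ let $i_K$ be the interior derivative, given by $i_{\xi\otimes X}\varphi=\xi\wedge i_X\varphi$, and let $$\mathcal L^{1,0}_K=[i_K,\partial]=i_K\partial-(-1)^{k-1}\partial i_K,\qquad \mathcal L^{0,1}_K=[i_K,\bar\partial]=i_K\bar\partial-(-1)^{k-1}\bar\partial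 i_K .$$ Let $p,q\in\mathbb Z$ and let $D$ be a bigraded derivation of bidegree $(p,q)$ on $A(M)$, that is, a $\mathbb C$-linear map $D:A(M)\to A(M)$ with $D(A^{a,b}(M))\subseteq A^{a+p,b+q}(M)$ for all $a,b$ and $$D(\xi\wedge\eta)=(D\xi)\wedge\eta+(-1)^{(p+q)m}\,\xi\wedge(D\eta)\qquad\text{for all } m,\ \xi\in A^m(M),\ \eta\in A(M).$$ Then there exist $K'\in A^{p,q}(M,T^{1,0})$, $K''\in A^{p,q}(M,T^{0,1})$, $L'\in A^{p+1,q}(M,T^{1,0})$ and $L''\in A^{p,q+1}(M,T^{0,1})$ such that $$D=\mathcal L^{1,0}_{K'}+\mathcal L^{0,1}_{K''}+i_{L'}+i_{L''}.$$ -/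

import Mathlib

open scoped TensorProduct Manifold ContDiff

noncomputable section

namespace AlmostComplex

/-! ### Linear algebra of one tangent space -/

section Pointwise

variable (V : Type*) [AddCommGroup V] [Module ℝ V]

/-- The complexification `V ⊗ ℂ` of a real vector space. -/
abbrev Complexification := ℂ ⊗[ℝ] V

/-- The complexified cotangent space: the complex dual of `V ⊗ ℂ`. -/
abbrev Covector := Module.Dual ℂ (Complexification V)

/-- The exterior algebra of complex valued forms on `V`; its product is the wedge product. -/
abbrev ExtForm := ExteriorAlgebra ℂ (Covector V)

/-- Exterior forms on `V` with values in `V ⊗ ℂ`. -/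
abbrev VecForm := ExtForm V ⊗[ℂ] Complexification V

variable {V}
variable {W : Type*} [AddCommGroup W] [Module ℝ W]

/-- The pullback of exterior forms by a real linear map. -/
def pullback (f : V →ₗ[ℝ] W) : ExtForm W →ₐ[ℂ] ExtForm V :=
  ExteriorAlgebra.map (f.baseChange ℂ).dualMap

/-- The interior product: `i_{ξ ⊗ X} φ = ξ ∧ i_X φ`, extended linearly in `ξ ⊗ X`. -/
def interiorMap : VecForm V →ₗ[ℂ] ExtForm V →ₗ[ℂ] ExtForm V :=
  TensorProduct.lift
    { toFun := fun ξ =>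
        (LinearMap.llcomp ℂ (ExtForm V) (ExtForm V) (ExtForm V) (LinearMap.mulLeft ℂ ξ)) ∘ₗ
          (CliffordAlgebra.contractLeft (R := ℂ) (M := Covector V) (Q := 0)) ∘ₗ
            Module.Dual.eval ℂ (Complexification V)
      map_add' := fun ξ η => by
        ext X φ
        simp [add_mul]
      map_smul' := fun c ξ => by
        ext X φ
        simp }

theorem interiorMap_tmul (ξ : ExtForm V) (X : Complexification V) (φ : ExtForm V) :
    interiorMap (ξ ⊗ₜ[ℂ] X) φ =
      ξ * CliffordAlgebra.contractLeft (Module.Dual.eval ℂ (Complexification V) X) φ := by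
  simp [interiorMap]

variable (J : V →ₗ[ℝ] V)

/-- The subspace `T^{1,0}` of `V ⊗ ℂ` on which the complexified `J` is `i`. -/
def vec10 : Submodule ℂ (Complexification V) :=
  Module.End.eigenspace (J.baseChange ℂ) Complex.I

/-- The subspace `T^{0,1}` of `V ⊗ ℂ` on which the complexified `J` is `-i`. -/
def vec01 : Submodule ℂ (Complexification V) :=
  Module.End.eigenspace (J.baseChange ℂ) (-Complex.I)

/-- The covectors of type `(1,0)`: those that annihilate `T^{0,1}`. -/
def covec10 : Submodule ℂ (Covector V) := (vec01 J).dualAnnihilator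

/-- The covectors of type `(0,1)`: those that annihilate `T^{1,0}`. -/
def covec01 : Submodule ℂ (Covector V) := (vec10 J).dualAnnihilator

/-- The space of exterior forms of type `(p,q)`: it is spanned by the products of `p` covectors
of type `(1,0)` and `q` covectors of type `(0,1)`, and it is zero if `p` or `q` is negative. -/
def bidegPart : ℤ → ℤ → Submodule ℂ (ExtForm V)
  | Int.ofNat p, Int.ofNat q =>
      (covec10 J).map (ExteriorAlgebra.ι ℂ) ^ p * (covec01 J).map (ExteriorAlgebra.ι ℂ) ^ q
  | _, _ => ⊥

/-- The space `Λ^{p,q} ⊗ U` of forms of type `(p,q)` with values in a subspace `U` of `V ⊗ ℂ`. -/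
def vecBidegPart (U : Submodule ℂ (Complexification V)) (p q : ℤ) : Submodule ℂ (VecForm V) :=
  Submodule.map₂ (TensorProduct.mk ℂ (ExtForm V) (Complexification V)) (bidegPart J p q) U

/-- The projection of covectors onto type `(1,0)`: `α ↦ (α - i α ∘ J) / 2`. -/
def covecProj10 : Covector V →ₗ[ℂ] Covector V :=
  (1 / 2 : ℂ) • (LinearMap.id - Complex.I • (J.baseChange ℂ).dualMap)

/-- The projection of covectors onto type `(0,1)`: `α ↦ (α + i α ∘ J) / 2`. -/
def covecProj01 : Covector V →ₗ[ℂ] Covector V :=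
  (1 / 2 : ℂ) • (LinearMap.id + Complex.I • (J.baseChange ℂ).dualMap)

/-- The algebra homomorphism that replaces every covector `α` by `s α^{1,0} + t α^{0,1}`, where
`s` and `t` are two commuting formal variables. The monomial `s ^ p t ^ q` is the basis element
`(p, q)` of the algebra of Laurent polynomials in `s` and `t`. -/
def bigrading : ExtForm V →ₐ[ℂ] AddMonoidAlgebra (ExtForm V) (ℤ × ℤ) :=
  ExteriorAlgebra.lift ℂ
    ⟨{ toFun := fun α =>
        AddMonoidAlgebra.single ((1, 0) : ℤ × ℤ) (ExteriorAlgebra.ι ℂ (covecProj10 J α)) +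
          AddMonoidAlgebra.single ((0, 1) : ℤ × ℤ) (ExteriorAlgebra.ι ℂ (covecProj01 J α))
       map_add' := fun α β => by
        simp only [map_add, AddMonoidAlgebra.single_add]
        abel
       map_smul' := fun c α => by
        simp [AddMonoidAlgebra.smul_single] }, fun α => by
      have h := ExteriorAlgebra.ι_add_mul_swap (R := ℂ) (covecProj10 J α) (covecProj01 J α)
      simp only [LinearMap.coe_mk, AddHom.coe_mk, add_mul, mul_add,
        AddMonoidAlgebra.single_mul_single, ExteriorAlgebra.ι_sq_zero]
      simp only [Prod.mk_add_mk, add_zero, zero_add, AddMonoidAlgebra.single_zero,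
        ← AddMonoidAlgebra.single_add]
      rw [add_comm, h, AddMonoidAlgebra.single_zero]⟩

/-- The projection `Π^{p,q}` of exterior forms onto their component of type `(p,q)`: the
coefficient of `s ^ p t ^ q` in `bigrading J φ`. -/
def bidegProj (p q : ℤ) : ExtForm V →ₗ[ℂ] ExtForm V where
  toFun φ := (bigrading J φ).coeff (p, q)
  map_add' φ ψ := by simp
  map_smul' c φ := by simp

end Pointwise

/-! ### Differential forms on a vector space -/

section Model

variable (E : Type*) [NormedAddCommGroup E] [NormedSpace ℝ E] [FiniteDimensional ℝ E]

/-- The coordinate covectors `dx^i` on `E`. -/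
def dx : Module.Basis (Fin (Module.finrank ℝ E)) ℂ (Covector E) :=
  ((Module.finBasis ℝ E).baseChange ℂ).dualBasis

/-- The basis of the exterior forms on `E` made of the products `dx^S`. -/
def dxBasis : Module.Basis (Finset (Fin (Module.finrank ℝ E))) ℂ (ExtForm E) :=
  (dx E).ExteriorAlgebra

instance : FiniteDimensional ℂ (ExtForm E) := Module.Finite.of_basis (dxBasis E)

variable {E}

/-- A map from a subset of `E` to a (finite dimensional) complex vector space is smooth if all its
coordinates are. -/
def SmoothVecOn {X : Type*} [AddCommGroup X] [Module ℂ X] (F : E → X) (s : Set E) : Prop :=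
  ∀ l : Module.Dual ℂ X, ContDiffOn ℝ ∞ (fun y => l (F y)) s

theorem SmoothVecOn.mul {F G : E → ExtForm E} {s : Set E} (hF : SmoothVecOn F s)
    (hG : SmoothVecOn G s) : SmoothVecOn (fun y => F y * G y) s := by
  intro l
  have h : (fun y => l (F y * G y)) = fun y => ∑ S, ∑ T,
      (dxBasis E).coord S (F y) * (dxBasis E).coord T (G y) *
        l (dxBasis E S * dxBasis E T) := by
    funext y
    conv_lhs => rw [← (dxBasis E).sum_repr (F y), ← (dxBasis E).sum_repr (G y)]
    simp only [Finset.sum_mul_sum, map_sum, smul_mul_smul_comm, map_smul,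
      smul_eq_mul, Module.Basis.coord_apply]
  rw [h]
  exact ContDiffOn.sum fun S _ => ContDiffOn.sum fun T _ =>
    ((hF _).mul (hG _)).mul contDiffOn_const

/-- The exterior derivative `∑_{i,S} (∂F_S / ∂x^i) dx^i ∧ dx^S` of `F = ∑_S F_S dx^S`. -/
def extDerivModel (F : E → ExtForm E) (y : E) : ExtForm E :=
  ∑ i, ∑ S, (fderiv ℝ (fun z => (dxBasis E).repr (F z) S) y (Module.finBasis ℝ E i)) •
    (ExteriorAlgebra.ι ℂ (dx E i) * dxBasis E S)

end Model

/-! ### Differential forms on a manifold -/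

section Manifold

variable (E : Type*) [NormedAddCommGroup E] [NormedSpace ℝ E] [FiniteDimensional ℝ E]
variable (M : Type*) [TopologicalSpace M] [ChartedSpace E M]

/-- Families, without any smoothness, of complex valued exterior forms on the tangent spaces
of `M`. Sums, products and complex multiples are pointwise. -/
abbrev RawForm := ∀ x : M, ExtForm (TangentSpace 𝓘(ℝ, E) x)

/-- Families, without any smoothness, of exterior forms on the tangent spaces of `M` with values
in the complexified tangent spaces. -/
abbrev RawVecForm := ∀ x : M, VecForm (TangentSpace 𝓘(ℝ, E) x)

variable {M}

/-- The derivative at `x` of the preferred chart at `x₀`. -/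
def chartDeriv (x₀ x : M) : TangentSpace 𝓘(ℝ, E) x →ₗ[ℝ] E :=
  (NormedSpace.fromTangentSpace (𝕜 := ℝ) (extChartAt 𝓘(ℝ, E) x₀ x)).toLinearEquiv.toLinearMap ∘ₗ
    (mfderiv 𝓘(ℝ, E) 𝓘(ℝ, E) (extChartAt 𝓘(ℝ, E) x₀) x).toLinearMap

/-- The derivative at `y` of the inverse of the preferred chart at `x₀`. -/
def chartSymmDeriv (x₀ : M) (y : E) :
    E →ₗ[ℝ] TangentSpace 𝓘(ℝ, E) ((extChartAt 𝓘(ℝ, E) x₀).symm y) :=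
  (mfderiv 𝓘(ℝ, E) 𝓘(ℝ, E) (extChartAt 𝓘(ℝ, E) x₀).symm y).toLinearMap ∘ₗ
    (NormedSpace.fromTangentSpace (𝕜 := ℝ) y).symm.toLinearEquiv.toLinearMap

variable {E}

/-- The expression of a form in the preferred chart at `x₀`: its pullback by the inverse chart. -/
def RawForm.inChart (φ : RawForm E M) (x₀ : M) (y : E) : ExtForm E :=
  pullback (chartSymmDeriv E x₀ y) (φ ((extChartAt 𝓘(ℝ, E) x₀).symm y))

/-- The expression of a vector valued form in the preferred chart at `x₀`. -/
def RawVecForm.inChart (K : RawVecForm E M) (x₀ : M) (y : E) : VecForm E :=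
  TensorProduct.map (pullback (chartSymmDeriv E x₀ y)).toLinearMap
    ((chartDeriv E x₀ ((extChartAt 𝓘(ℝ, E) x₀).symm y)).baseChange ℂ)
    (K ((extChartAt 𝓘(ℝ, E) x₀).symm y))

/-- A form is smooth if its expressions in the charts are. -/
def RawForm.Smooth (φ : RawForm E M) : Prop :=
  ∀ x₀ : M, SmoothVecOn (φ.inChart x₀) (extChartAt 𝓘(ℝ, E) x₀).target

/-- A vector valued form is smooth if its expressions in the charts are. -/
def RawVecForm.Smooth (K : RawVecForm E M) : Prop :=
  ∀ x₀ : M, SmoothVecOn (K.inChart x₀) (extChartAt 𝓘(ℝ, E) x₀).target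

variable (E M) in
/-- The algebra `A(M)` of smooth complex valued differential forms on `M`. -/
def Form : Subalgebra ℂ (RawForm E M) where
  carrier := {φ | φ.Smooth}
  mul_mem' := by
    intro φ ψ hφ hψ x₀
    have h : (φ * ψ).inChart x₀ = fun y => φ.inChart x₀ y * ψ.inChart x₀ y :=
      funext fun y => map_mul (pullback (chartSymmDeriv E x₀ y)) _ _
    rw [h]
    exact (hφ x₀).mul (hψ x₀)
  add_mem' := by
    intro φ ψ hφ hψ x₀ l
    have h : (fun y => l ((φ + ψ).inChart x₀ y)) =
        fun y => l (φ.inChart x₀ y) + l (ψ.inChart x₀ y) :=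
      funext fun y => (congrArg l (map_add (pullback (chartSymmDeriv E x₀ y)) _ _)).trans
        (map_add l _ _)
    rw [h]
    exact (hφ x₀ l).add (hψ x₀ l)
  algebraMap_mem' := by
    intro c x₀ l
    have h : (fun y => l ((algebraMap ℂ (RawForm E M) c).inChart x₀ y)) =
        fun _ => l (algebraMap ℂ (ExtForm E) c) :=
      funext fun y => congrArg l (AlgHom.commutes (pullback (chartSymmDeriv E x₀ y)) c)
    rw [h]
    exact contDiffOn_const

/-- The exterior derivative. Its value at `x` is computed in the preferred chart at `x`. -/
def exteriorDer (φ : RawForm E M) : RawForm E M := fun x =>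
  pullback (chartDeriv E x x) (extDerivModel (φ.inChart x) (extChartAt 𝓘(ℝ, E) x x))

/-- The interior derivative `i_K`. -/
def interiorDer (K : RawVecForm E M) (φ : RawForm E M) : RawForm E M := fun x =>
  interiorMap (K x) (φ x)

variable (E M) in
/-- An almost complex structure on `M`: a smooth field of endomorphisms `J` of the tangent spaces
with `J ^ 2 = -1`. -/
structure AlmostComplexStructure where
  /-- The endomorphism of the tangent space at each point. -/
  toEnd : ∀ x : M, TangentSpace 𝓘(ℝ, E) x →ₗ[ℝ] TangentSpace 𝓘(ℝ, E) x
  sq_eq : ∀ x v, toEnd x (toEnd x v) = -v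
  smooth : ∀ (x₀ : M) (v : E), ContDiffOn ℝ ∞
    (fun y => chartDeriv E x₀ ((extChartAt 𝓘(ℝ, E) x₀).symm y)
      (toEnd ((extChartAt 𝓘(ℝ, E) x₀).symm y) (chartSymmDeriv E x₀ y v)))
    (extChartAt 𝓘(ℝ, E) x₀).target

variable (E M) in
/-- The space `A^k(M)` of smooth `k`-forms. -/
def degForm (k : ℕ) : Submodule ℂ (Form E M) where
  carrier := {φ | ∀ x, φ.1 x ∈ ⋀[ℂ]^k (Covector (TangentSpace 𝓘(ℝ, E) x))}
  zero_mem' := fun _ => Submodule.zero_mem _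
  add_mem' := fun hφ hψ x => Submodule.add_mem _ (hφ x) (hψ x)
  smul_mem' := fun c _ hφ x => Submodule.smul_mem _ c (hφ x)

namespace AlmostComplexStructure

variable (J : AlmostComplexStructure E M)

/-- The space `A^{p,q}(M)` of smooth forms of type `(p,q)`. -/
def bidegForm (p q : ℤ) : Submodule ℂ (Form E M) where
  carrier := {φ | ∀ x, φ.1 x ∈ bidegPart (J.toEnd x) p q}
  zero_mem' := fun _ => Submodule.zero_mem _
  add_mem' := fun hφ hψ x => Submodule.add_mem _ (hφ x) (hψ x)
  smul_mem' := fun c _ hφ x => Submodule.smul_mem _ c (hφ x)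

/-- The space `A^{p,q}(M, T^{1,0})` of smooth forms of type `(p,q)` with values in `T^{1,0}`. -/
def vecForm10 (p q : ℤ) : Set (RawVecForm E M) :=
  {K | K.Smooth ∧ ∀ x, K x ∈ vecBidegPart (J.toEnd x) (vec10 (J.toEnd x)) p q}

/-- The space `A^{p,q}(M, T^{0,1})` of smooth forms of type `(p,q)` with values in `T^{0,1}`. -/
def vecForm01 (p q : ℤ) : Set (RawVecForm E M) :=
  {K | K.Smooth ∧ ∀ x, K x ∈ vecBidegPart (J.toEnd x) (vec01 (J.toEnd x)) p q}

/-- The projection `Π^{p,q}` of forms onto their component of type `(p,q)`. -/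
def proj (p q : ℤ) (φ : RawForm E M) : RawForm E M := fun x => bidegProj (J.toEnd x) p q (φ x)

/-- The operator `∂ = ∑_{p,q} Π^{p+1,q} d Π^{p,q}`. There are no forms of type `(p,q)` with `p` or
`q` larger than the dimension. -/
def del (φ : RawForm E M) : RawForm E M :=
  ∑ p ∈ Finset.range (Module.finrank ℝ E + 1), ∑ q ∈ Finset.range (Module.finrank ℝ E + 1),
    J.proj (p + 1) q (exteriorDer (J.proj p q φ))

/-- The operator `∂̄ = ∑_{p,q} Π^{p,q+1} d Π^{p,q}`. -/
def delbar (φ : RawForm E M) : RawForm E M :=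
  ∑ p ∈ Finset.range (Module.finrank ℝ E + 1), ∑ q ∈ Finset.range (Module.finrank ℝ E + 1),
    J.proj p (q + 1) (exteriorDer (J.proj p q φ))

/-- The operator `𝓛^{1,0}_K = [i_K, ∂] = i_K ∂ - (-1)^(k-1) ∂ i_K` for a vector valued `k`-form `K`:
the graded commutator of `i_K`, of degree `k - 1`, and `∂`, of degree `1`. -/
def lie10 (k : ℤ) (K : RawVecForm E M) (φ : RawForm E M) : RawForm E M :=
  interiorDer K (J.del φ) - ((-1 : ℂ) ^ (k - 1)) • J.del (interiorDer K φ)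

/-- The operator `𝓛^{0,1}_K = [i_K, ∂̄] = i_K ∂̄ - (-1)^(k-1) ∂̄ i_K` for a vector valued
`k`-form `K`. -/
def lie01 (k : ℤ) (K : RawVecForm E M) (φ : RawForm E M) : RawForm E M :=
  interiorDer K (J.delbar φ) - ((-1 : ℂ) ^ (k - 1)) • J.delbar (interiorDer K φ)

/-- A complex linear map `D` of `A(M)` is a bigraded derivation of bidegree `(p,q)`. -/
structure IsBigradedDerivation (p q : ℤ) (D : Form E M →ₗ[ℂ] Form E M) : Prop where
  map_bidegForm : ∀ a b : ℤ, ∀ φ ∈ J.bidegForm a b, D φ ∈ J.bidegForm (a + p) (b + q)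
  leibniz : ∀ m : ℕ, ∀ ξ ∈ degForm E M m, ∀ η : Form E M,
    D (ξ * η) = D ξ * η + ((-1 : ℂ) ^ ((p + q) * m)) • (ξ * D η)

end AlmostComplexStructure

end Manifold

end AlmostComplex

end

set_option linter.unusedSectionVars false

/-! A graded derivation of `A(M)` is local, because multiplying by a bump function and applying the
Leibniz rule shows that its value at a point depends only on the germ there. It is therefore
determined by its values on functions and on forms of degree one, and the decomposition is found in
these two stages.

On functions: by Hadamard's lemma a function with zero differential at `x` is, near `x`, a constant
plus a sum of products of functions whose values at `x` are all zero. So `D f` at `x` depends only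
on `df` at `x`, that is, `D f = A (df)` for a smooth family `A` of linear maps from covectors to
forms of type `(p,q)`, the symbol of `D`. Let `K'` and `K''` be the vector valued forms that
correspond to `A` composed with the projections onto covectors of type `(1,0)` and `(0,1)`. Since
`i_K` kills functions, the two Lie derivatives send `f` to `i_{K'} ∂f + i_{K''} ∂̄f = A (df)`. This
is `IsDerivationOfDegree.exists_lie`.

On forms of degree one: the difference `T` of `D` and these Lie derivatives is a derivation of the
same bidegree that kills functions. It is then linear over functions, hence acts pointwise, and on
covectors it is a linear map `C`. Since `T` has bidegree `(p,q)`, `C` takes covectors of type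
`(1,0)` to type `(p+1,q)` and those of type `(0,1)` to type `(p,q+1)`. These two restrictions are
`L'` and `L''`, and `T - i_{L'} - i_{L''}` vanishes on functions and on forms of degree one, hence
everywhere. This is `IsDerivationOfDegree.exists_interior`.

Integrability of `J` plays no role: `∂` and `∂̄` are derivations because each is a component of
fixed type of the derivation `d`, and no other component of `d` enters. Signs are carried by the
automorphism `scale (-1)`, which multiplies a form of degree `m` by `(-1) ^ m`, so that Leibniz
rules can be stated without homogeneity. -/

noncomputable section

namespace AlmostComplex

/-! ### Exterior algebra of one tangent space: signs, contraction, types, naturality. -/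

section Pointwise

variable {V : Type*} [AddCommGroup V] [Module ℝ V]
variable {W : Type*} [AddCommGroup W] [Module ℝ W]

/-- The contraction of exterior forms by a complex tangent vector. -/
def contract (X : Complexification V) : ExtForm V →ₗ[ℂ] ExtForm V :=
  CliffordAlgebra.contractLeft (R := ℂ) (M := Covector V) (Q := 0)
    (Module.Dual.eval ℂ (Complexification V) X)

/-- The automorphism of the algebra of exterior forms that multiplies covectors by `c`. -/
def scale (c : ℂ) : ExtForm V →ₐ[ℂ] ExtForm V :=
  ExteriorAlgebra.map (c • LinearMap.id)

/-- Induction on exterior forms by multiplication with covectors on the left. -/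
theorem extForm_induction {C : ExtForm V → Prop}
    (hc : ∀ c : ℂ, C (algebraMap ℂ _ c)) (ha : ∀ x y, C x → C y → C (x + y))
    (hm : ∀ (α : Covector V) (x), C x → C (ExteriorAlgebra.ι ℂ α * x)) (x : ExtForm V) : C x :=
  CliffordAlgebra.left_induction (Q := 0) (P := C) hc ha (fun x m h => hm m x h) x

@[simp] theorem scale_ι (c : ℂ) (α : Covector V) :
    scale c (ExteriorAlgebra.ι ℂ α) = c • ExteriorAlgebra.ι ℂ α := by
  simp [scale]

theorem scale_algebraMap (c a : ℂ) :
    scale c (algebraMap ℂ (ExtForm V) a) = algebraMap ℂ (ExtForm V) a := by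
  simp

@[simp] theorem scale_one_left (φ : ExtForm V) : scale 1 φ = φ := by
  induction φ using extForm_induction with
  | hc c => simp
  | ha x y hx hy => simp [hx, hy]
  | hm α x hx => simp [hx]

theorem scale_scale (c d : ℂ) (φ : ExtForm V) : scale c (scale d φ) = scale (c * d) φ := by
  induction φ using extForm_induction with
  | hc c => simp
  | ha x y hx hy => simp [hx, hy]
  | hm α x hx => simp [hx, smul_smul, mul_comm]

/-- Translates between Leibniz rules written with `scale` and rules written with explicit powers of
`-1` for homogeneous forms. -/
theorem scale_of_mem_exteriorPower (c : ℂ) {m : ℕ} {ξ : ExtForm V}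
    (hξ : ξ ∈ ⋀[ℂ]^m (Covector V)) : scale c ξ = c ^ m • ξ := by
  induction hξ using Submodule.pow_induction_on_left' with
  | algebraMap r => simp
  | add x y i hx hy h1 h2 => simp [h1, h2]
  | mem_mul x hx i y hy h =>
    obtain ⟨α, rfl⟩ := hx
    simp [h, pow_succ, smul_smul]

/-- Moving a covector past a form costs one sign for each covector factor of the form. -/
theorem ι_mul_eq (α : Covector V) (φ : ExtForm V) :
    ExteriorAlgebra.ι ℂ α * φ = scale (-1) φ * ExteriorAlgebra.ι ℂ α := by
  induction φ using extForm_induction with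
  | hc c => simp [Algebra.commutes]
  | ha x y hx hy => simp [hx, hy, mul_add, add_mul]
  | hm β x hx =>
    have h := ExteriorAlgebra.ι_add_mul_swap (R := ℂ) α β
    rw [← mul_assoc, eq_neg_of_add_eq_zero_left h, map_mul, scale_ι, neg_mul, mul_assoc, hx]
    simp [mul_assoc]

theorem mul_eq_of_mem_exteriorPower {m : ℕ} {ξ : ExtForm V}
    (hξ : ξ ∈ ⋀[ℂ]^m (Covector V)) (φ : ExtForm V) : ξ * φ = scale ((-1) ^ m) φ * ξ := by
  induction hξ using Submodule.pow_induction_on_left' generalizing φ with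
  | algebraMap r => simp [Algebra.commutes]
  | add x y i hx hy h1 h2 => simp [h1, h2, mul_add, add_mul]
  | mem_mul x hx i y hy h =>
    obtain ⟨α, rfl⟩ := hx
    rw [mul_assoc, h, ← mul_assoc, ι_mul_eq, scale_scale, mul_assoc, pow_succ']

/-! ### Contraction -/

@[simp] theorem contract_algebraMap (X : Complexification V) (c : ℂ) :
    contract X (algebraMap ℂ (ExtForm V) c) = 0 := by
  simp [contract]

theorem contract_ι_mul (X : Complexification V) (α : Covector V) (φ : ExtForm V) :
    contract X (ExteriorAlgebra.ι ℂ α * φ) = α X • φ - ExteriorAlgebra.ι ℂ α * contract X φ := by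
  exact CliffordAlgebra.contractLeft_ι_mul (Q := (0 : QuadraticForm ℂ (Covector V)))
    (d := Module.Dual.eval ℂ (Complexification V) X) α φ

theorem contract_ι (X : Complexification V) (α : Covector V) :
    contract X (ExteriorAlgebra.ι ℂ α) = algebraMap ℂ (ExtForm V) (α X) := by
  exact CliffordAlgebra.contractLeft_ι (Q := (0 : QuadraticForm ℂ (Covector V)))
    (d := Module.Dual.eval ℂ (Complexification V) X) α

/-- Contraction removes one covector and hence one factor `c`. Putting that factor on the left
avoids a division, so `c = 0` is allowed. -/
theorem scale_contract (c : ℂ) (X : Complexification V) (φ : ExtForm V) :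
    c • scale c (contract X φ) = contract X (scale c φ) := by
  induction φ using extForm_induction with
  | hc c => simp
  | ha x y hx hy => simp [hx, hy]
  | hm α x hx =>
    simp only [contract_ι_mul, map_sub, map_smul, map_mul, scale_ι, smul_mul_assoc, smul_sub,
      ← hx, mul_smul_comm]

theorem contract_mul (X : Complexification V) (φ ψ : ExtForm V) :
    contract X (φ * ψ) = contract X φ * ψ + scale (-1) φ * contract X ψ := by
  induction φ using extForm_induction with
  | hc c => simp [← Algebra.smul_def]
  | ha x y hx hy => simp only [hx, hy, map_add, add_mul]; abel
  | hm α x hx =>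
    simp only [mul_assoc, contract_ι_mul, hx, map_mul, scale_ι, mul_add, sub_mul, smul_mul_assoc]
    simp
    abel

theorem interiorMap_tmul_contract (ξ : ExtForm V) (X : Complexification V) (φ : ExtForm V) :
    interiorMap (ξ ⊗ₜ[ℂ] X) φ = ξ * contract X φ :=
  interiorMap_tmul ξ X φ

@[simp] theorem interiorMap_algebraMap (K : VecForm V) (c : ℂ) :
    interiorMap K (algebraMap ℂ (ExtForm V) c) = 0 := by
  induction K using TensorProduct.induction_on with
  | zero => simp
  | tmul ξ X => simp [interiorMap_tmul_contract]
  | add K L hK hL => simp only [map_add, LinearMap.add_apply, hK, hL, add_zero]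

/-! ### Types of covectors -/

variable (J : V →ₗ[ℝ] V)

/-- The projection of `V ⊗ ℂ` onto `T^{1,0}`. -/
def vecProj10 : Complexification V →ₗ[ℂ] Complexification V :=
  (1 / 2 : ℂ) • (LinearMap.id - Complex.I • J.baseChange ℂ)

/-- The projection of `V ⊗ ℂ` onto `T^{0,1}`. -/
def vecProj01 : Complexification V →ₗ[ℂ] Complexification V :=
  (1 / 2 : ℂ) • (LinearMap.id + Complex.I • J.baseChange ℂ)

/-- The projections of covectors are the transposes of those of vectors; through this the facts
about covector types follow from eigenvectors of `J`. -/
theorem covecProj10_apply (α : Covector V) (X : Complexification V) :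
    covecProj10 J α X = α (vecProj10 J X) := by
  simp [covecProj10, vecProj10, LinearMap.dualMap_apply]

theorem covecProj01_apply (α : Covector V) (X : Complexification V) :
    covecProj01 J α X = α (vecProj01 J X) := by
  simp [covecProj01, vecProj01, LinearMap.dualMap_apply]

theorem vecProj10_add_vecProj01 (X : Complexification V) : vecProj10 J X + vecProj01 J X = X := by
  simp only [vecProj10, vecProj01, LinearMap.smul_apply, LinearMap.sub_apply, LinearMap.add_apply,
    LinearMap.id_apply]
  module

theorem covecProj10_add_covecProj01 (α : Covector V) : covecProj10 J α + covecProj01 J α = α := by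
  ext X
  simp [covecProj10_apply, covecProj01_apply, ← map_add, vecProj10_add_vecProj01]

variable {J}

theorem baseChange_sq (hJ : ∀ v, J (J v) = -v) (X : Complexification V) :
    J.baseChange ℂ (J.baseChange ℂ X) = -X := by
  induction X using TensorProduct.induction_on with
  | zero => simp
  | tmul c v => simp [hJ, TensorProduct.tmul_neg]
  | add X Y hX hY => simp only [map_add, hX, hY]; abel

theorem vecProj10_mem (hJ : ∀ v, J (J v) = -v) (X : Complexification V) :
    vecProj10 J X ∈ vec10 J := by
  rw [vec10, Module.End.mem_eigenspace_iff]
  simp only [vecProj10, LinearMap.smul_apply, LinearMap.sub_apply, LinearMap.id_apply, map_smul,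
    map_sub, baseChange_sq hJ, smul_smul, smul_sub]
  rw [mul_left_comm, Complex.I_mul_I]
  module

theorem vecProj01_mem (hJ : ∀ v, J (J v) = -v) (X : Complexification V) :
    vecProj01 J X ∈ vec01 J := by
  rw [vec01, Module.End.mem_eigenspace_iff]
  simp only [vecProj01, LinearMap.smul_apply, LinearMap.add_apply, LinearMap.id_apply, map_smul,
    map_add, baseChange_sq hJ, smul_smul, smul_add]
  rw [mul_left_comm, neg_mul Complex.I Complex.I, Complex.I_mul_I]
  module

theorem vecProj10_of_mem {X : Complexification V} (hX : X ∈ vec10 J) : vecProj10 J X = X := by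
  rw [vec10, Module.End.mem_eigenspace_iff] at hX
  simp only [vecProj10, LinearMap.smul_apply, LinearMap.sub_apply, LinearMap.id_apply, hX,
    smul_smul, Complex.I_mul_I]
  module

theorem vecProj01_of_mem {X : Complexification V} (hX : X ∈ vec01 J) : vecProj01 J X = X := by
  rw [vec01, Module.End.mem_eigenspace_iff] at hX
  simp only [vecProj01, LinearMap.smul_apply, LinearMap.add_apply, LinearMap.id_apply, hX,
    smul_smul, mul_neg, Complex.I_mul_I]
  module

theorem vecProj01_of_mem_vec10 {X : Complexification V} (hX : X ∈ vec10 J) :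
    vecProj01 J X = 0 := by
  have := vecProj10_add_vecProj01 J X
  rwa [vecProj10_of_mem hX, add_eq_left] at this

theorem vecProj10_of_mem_vec01 {X : Complexification V} (hX : X ∈ vec01 J) :
    vecProj10 J X = 0 := by
  have := vecProj10_add_vecProj01 J X
  rwa [vecProj01_of_mem hX, add_eq_right] at this

theorem covecProj10_mem (α : Covector V) : covecProj10 J α ∈ covec10 J := by
  rw [covec10, Submodule.mem_dualAnnihilator]
  intro X hX
  rw [covecProj10_apply, vecProj10_of_mem_vec01 hX, map_zero]

theorem covecProj01_mem (α : Covector V) : covecProj01 J α ∈ covec01 J := by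
  rw [covec01, Submodule.mem_dualAnnihilator]
  intro X hX
  rw [covecProj01_apply, vecProj01_of_mem_vec10 hX, map_zero]

theorem covecProj01_of_mem_covec10 (hJ : ∀ v, J (J v) = -v) {α : Covector V}
    (hα : α ∈ covec10 J) : covecProj01 J α = 0 := by
  rw [covec10, Submodule.mem_dualAnnihilator] at hα
  ext X
  simpa using (covecProj01_apply J α _).trans (hα _ (vecProj01_mem hJ _))

theorem covecProj10_of_mem_covec01 (hJ : ∀ v, J (J v) = -v) {α : Covector V}
    (hα : α ∈ covec01 J) : covecProj10 J α = 0 := by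
  rw [covec01, Submodule.mem_dualAnnihilator] at hα
  ext X
  simpa using (covecProj10_apply J α _).trans (hα _ (vecProj10_mem hJ _))

theorem covecProj10_of_mem (hJ : ∀ v, J (J v) = -v) {α : Covector V} (hα : α ∈ covec10 J) :
    covecProj10 J α = α := by
  have := covecProj10_add_covecProj01 J α
  rwa [covecProj01_of_mem_covec10 hJ hα, add_zero] at this

theorem covecProj01_of_mem (hJ : ∀ v, J (J v) = -v) {α : Covector V} (hα : α ∈ covec01 J) :
    covecProj01 J α = α := by
  have := covecProj10_add_covecProj01 J α
  rwa [covecProj10_of_mem_covec01 hJ hα, zero_add] at this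

/-! ### The projections onto types -/

variable (J)

theorem bigrading_ι (α : Covector V) :
    bigrading J (ExteriorAlgebra.ι ℂ α) =
      AddMonoidAlgebra.single ((1, 0) : ℤ × ℤ) (ExteriorAlgebra.ι ℂ (covecProj10 J α)) +
        AddMonoidAlgebra.single ((0, 1) : ℤ × ℤ) (ExteriorAlgebra.ι ℂ (covecProj01 J α)) := by
  simp [bigrading]

/-- Compares coefficients of `s ^ a t ^ b`: a covector contributes either one `s` or one `t`. This
recursion and `bidegProj_algebraMap` determine all the projections, and the inductions on
`bidegProj` below run on these two facts. -/
theorem bidegProj_ι_mul (a b : ℤ) (α : Covector V) (φ : ExtForm V) :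
    bidegProj J a b (ExteriorAlgebra.ι ℂ α * φ) =
      ExteriorAlgebra.ι ℂ (covecProj10 J α) * bidegProj J (a - 1) b φ +
        ExteriorAlgebra.ι ℂ (covecProj01 J α) * bidegProj J a (b - 1) φ := by
  have h1 : ((a, b) : ℤ × ℤ) = (1, 0) + (a - 1, b) := by ext <;> simp
  have h2 : ((a, b) : ℤ × ℤ) = (0, 1) + (a, b - 1) := by ext <;> simp
  change (bigrading J (ExteriorAlgebra.ι ℂ α * φ)).coeff (a, b) = _
  rw [map_mul, bigrading_ι, add_mul]
  change ((AddMonoidAlgebra.single ((1, 0) : ℤ × ℤ) (ExteriorAlgebra.ι ℂ (covecProj10 J α)) *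
    bigrading J φ)).coeff (a, b) + (AddMonoidAlgebra.single ((0, 1) : ℤ × ℤ)
      (ExteriorAlgebra.ι ℂ (covecProj01 J α)) * bigrading J φ).coeff (a, b) = _
  congr 1
  · conv_lhs => rw [h1]
    rw [AddMonoidAlgebra.coeff_single_mul_apply, neg_add_cancel_left]
    rfl
  · conv_lhs => rw [h2]
    rw [AddMonoidAlgebra.coeff_single_mul_apply, neg_add_cancel_left]
    rfl

theorem bidegProj_algebraMap (a b : ℤ) (c : ℂ) :
    bidegProj J a b (algebraMap ℂ (ExtForm V) c) =
      if a = 0 ∧ b = 0 then algebraMap ℂ (ExtForm V) c else 0 := by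
  change (bigrading J (algebraMap ℂ (ExtForm V) c)).coeff (a, b) = _
  rw [AlgHom.commutes, AddMonoidAlgebra.coe_algebraMap]
  simp only [Function.comp_apply, AddMonoidAlgebra.coeff_single, Finsupp.single_apply]
  congr 1
  simp [Prod.ext_iff, eq_comm]

theorem bidegProj_ι (a b : ℤ) (α : Covector V) :
    bidegProj J a b (ExteriorAlgebra.ι ℂ α) =
      (if a = 1 ∧ b = 0 then ExteriorAlgebra.ι ℂ (covecProj10 J α) else 0) +
        if a = 0 ∧ b = 1 then ExteriorAlgebra.ι ℂ (covecProj01 J α) else 0 := by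
  have h := bidegProj_ι_mul J a b α (algebraMap ℂ _ 1)
  simp only [bidegProj_algebraMap, mul_ite, mul_zero, sub_eq_zero] at h
  simpa only [map_one, mul_one] using h

/-- The sum of the components of an exterior form. -/
def bigradingSum : AddMonoidAlgebra (ExtForm V) (ℤ × ℤ) →ₐ[ℂ] ExtForm V :=
  AddMonoidAlgebra.liftNCAlgHom (AlgHom.id ℂ (ExtForm V)) 1 (fun _ _ => Commute.one_right _)

/-- Setting `s = t = 1` turns `s α^{1,0} + t α^{0,1}` back into `α`. -/
theorem bigradingSum_bigrading (φ : ExtForm V) : bigradingSum (bigrading J φ) = φ := by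
  have h1 (x : ℤ × ℤ) (ψ : ExtForm V) : bigradingSum (AddMonoidAlgebra.single x ψ) = ψ := by
    change AddMonoidAlgebra.liftNC _ _ _ = _
    simp
  induction φ using extForm_induction with
  | hc c =>
    rw [AlgHom.commutes]
    exact h1 0 (algebraMap ℂ _ c)
  | ha x y hx hy => simp [hx, hy]
  | hm α x hx =>
    rw [map_mul, map_mul, hx, bigrading_ι, map_add, h1, h1, ← map_add, covecProj10_add_covecProj01]

theorem sum_bidegProj (s : Finset (ℤ × ℤ)) (φ : ExtForm V)
    (hs : ∀ a b, (a, b) ∉ s → bidegProj J a b φ = 0) :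
    ∑ x ∈ s, bidegProj J x.1 x.2 φ = φ := by
  conv_rhs => rw [← bigradingSum_bigrading J φ]
  change _ = AddMonoidAlgebra.liftNC _ _ _
  rw [AddMonoidAlgebra.liftNC]
  change _ = (bigrading J φ).coeff.sum fun _ r => r * 1
  simp only [mul_one]
  rw [Finsupp.sum_of_support_subset _ (s := s) _ _ (by simp)]
  · rfl
  · intro x hx
    by_contra h
    exact Finsupp.mem_support_iff.mp hx (hs x.1 x.2 h)

variable {J}

/-- The relation `J ^ 2 = -1` enters through the covector projections, which it makes idempotent
with product zero; the recursion carries this to all forms. -/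
theorem bidegProj_bidegProj (hJ : ∀ v, J (J v) = -v) (a b c d : ℤ) (φ : ExtForm V) :
    bidegProj J a b (bidegProj J c d φ) = if a = c ∧ b = d then bidegProj J a b φ else 0 := by
  induction φ using extForm_induction generalizing a b c d with
  | hc r =>
    by_cases h : a = c ∧ b = d
    · obtain ⟨rfl, rfl⟩ := h
      by_cases h : a = 0 ∧ b = 0 <;> simp [bidegProj_algebraMap, h]
    · rw [if_neg h, bidegProj_algebraMap]
      split_ifs with h1
      · obtain ⟨rfl, rfl⟩ := h1
        rw [bidegProj_algebraMap, if_neg h]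
      · simp
  | ha x y hx hy =>
    simp only [map_add, hx, hy]
    split_ifs <;> simp
  | hm α x hx =>
    simp only [bidegProj_ι_mul, map_add, hx, covecProj10_of_mem hJ (covecProj10_mem α),
      covecProj01_of_mem hJ (covecProj01_mem α), covecProj01_of_mem_covec10 hJ (covecProj10_mem α),
      covecProj10_of_mem_covec01 hJ (covecProj01_mem α), sub_left_inj]
    split_ifs <;> simp

/-- A vector of type `(1,0)` pairs to zero with covectors of type `(0,1)`, so contraction with it
removes exactly one covector of type `(1,0)`. The pair `(u,v)` lets one proof serve both types. -/
theorem bidegProj_contract {X : Complexification V} {u v : ℤ}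
    (hX : (u = 1 ∧ v = 0 ∧ X ∈ vec10 J) ∨ (u = 0 ∧ v = 1 ∧ X ∈ vec01 J)) (a b : ℤ)
    (φ : ExtForm V) :
    bidegProj J a b (contract X φ) = contract X (bidegProj J (a + u) (b + v) φ) := by
  induction φ using extForm_induction generalizing a b with
  | hc r =>
    simp only [bidegProj_algebraMap, contract_algebraMap, map_zero]
    split_ifs <;> simp
  | ha x y hx hy => simp only [map_add, hx, hy]
  | hm α x hx =>
    simp only [contract_ι_mul, map_sub, bidegProj_ι_mul, map_smul, hx, map_add, covecProj10_apply,
      covecProj01_apply]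
    rcases hX with ⟨rfl, rfl, hX⟩ | ⟨rfl, rfl, hX⟩
    · rw [vecProj10_of_mem hX, vecProj01_of_mem_vec10 hX]
      simp
      abel
    · rw [vecProj01_of_mem hX, vecProj10_of_mem_vec01 hX]
      simp
      abel

theorem bidegPart_eq_bot_of_neg {a b : ℤ} (h : a < 0 ∨ b < 0) : bidegPart J a b = ⊥ := by
  match a, b, h with
  | Int.ofNat a, Int.ofNat b, h => simp at h; omega
  | Int.negSucc a, b, _ => rfl
  | Int.ofNat a, Int.negSucc b, _ => rfl

theorem bidegPart_natCast (a b : ℕ) : bidegPart J a b =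
    (covec10 J).map (ExteriorAlgebra.ι ℂ) ^ a * (covec01 J).map (ExteriorAlgebra.ι ℂ) ^ b := rfl

theorem ι_mul_mem_bidegPart10 {α : Covector V} (hα : α ∈ covec10 J) {a b : ℤ} {φ : ExtForm V}
    (hφ : φ ∈ bidegPart J (a - 1) b) : ExteriorAlgebra.ι ℂ α * φ ∈ bidegPart J a b := by
  by_cases h : a - 1 < 0 ∨ b < 0
  · rw [bidegPart_eq_bot_of_neg h, Submodule.mem_bot] at hφ
    simp [hφ]
  · push Not at h
    obtain ⟨k, hk⟩ := Int.eq_ofNat_of_zero_le h.1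
    obtain rfl : a = (k + 1 : ℕ) := by push_cast; omega
    lift b to ℕ using h.2
    rw [hk, bidegPart_natCast] at hφ
    rw [bidegPart_natCast, pow_succ', mul_assoc]
    exact Submodule.mul_mem_mul (Submodule.mem_map_of_mem hα) hφ

/-- Covectors anticommute, but submodules absorb the sign. This allows a new `(0,1)` covector to be
moved past the `(1,0)` factors, which `bidegPart` lists first. -/
theorem commute_covec10_covec01 : Commute ((covec10 J).map (ExteriorAlgebra.ι ℂ))
    ((covec01 J).map (ExteriorAlgebra.ι ℂ)) := by
  apply le_antisymm
  all_goals
    rw [Submodule.mul_le]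
    rintro _ ⟨α, hα, rfl⟩ _ ⟨β, hβ, rfl⟩
    rw [eq_neg_of_add_eq_zero_left (ExteriorAlgebra.ι_add_mul_swap (R := ℂ) α β)]
    exact Submodule.neg_mem _ (Submodule.mul_mem_mul (Submodule.mem_map_of_mem hβ)
      (Submodule.mem_map_of_mem hα))

theorem ι_mul_mem_bidegPart01 {α : Covector V} (hα : α ∈ covec01 J) {a b : ℤ} {φ : ExtForm V}
    (hφ : φ ∈ bidegPart J a (b - 1)) : ExteriorAlgebra.ι ℂ α * φ ∈ bidegPart J a b := by
  by_cases h : a < 0 ∨ b - 1 < 0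
  · rw [bidegPart_eq_bot_of_neg h, Submodule.mem_bot] at hφ
    simp [hφ]
  · push Not at h
    obtain ⟨k, hk⟩ := Int.eq_ofNat_of_zero_le h.2
    obtain rfl : b = (k + 1 : ℕ) := by push_cast; omega
    lift a to ℕ using h.1
    rw [hk, bidegPart_natCast] at hφ
    rw [bidegPart_natCast, pow_succ', ← mul_assoc, (commute_covec10_covec01.pow_left a).eq,
      mul_assoc]
    exact Submodule.mul_mem_mul (Submodule.mem_map_of_mem hα) hφ

theorem bidegProj_mem (a b : ℤ) (φ : ExtForm V) : bidegProj J a b φ ∈ bidegPart J a b := by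
  induction φ using extForm_induction generalizing a b with
  | hc r =>
    rw [bidegProj_algebraMap]
    split_ifs with h
    · obtain ⟨rfl, rfl⟩ := h
      change _ ∈ _ ^ 0 * _ ^ 0
      simp
    · exact Submodule.zero_mem _
  | ha x y hx hy => simpa only [map_add] using Submodule.add_mem _ (hx a b) (hy a b)
  | hm α x hx =>
    rw [bidegProj_ι_mul]
    exact Submodule.add_mem _ (ι_mul_mem_bidegPart10 (covecProj10_mem α) (hx _ _))
      (ι_mul_mem_bidegPart01 (covecProj01_mem α) (hx _ _))

/-- Forms of pure type become single monomials, so multiplying by them shifts the coefficients of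
the other factor; `bidegProj_mul_of_mem` and `bidegProj_mem_mul` read off that shift. -/
theorem bigrading_of_mem (hJ : ∀ v, J (J v) = -v) {a b : ℤ} {φ : ExtForm V}
    (hφ : φ ∈ bidegPart J a b) : bigrading J φ = AddMonoidAlgebra.single (a, b) φ := by
  have h10 (k : ℕ) : ∀ φ ∈ (covec10 J).map (ExteriorAlgebra.ι ℂ) ^ k,
      bigrading J φ = AddMonoidAlgebra.single ((k, 0) : ℤ × ℤ) φ := by
    intro φ hφ
    induction hφ using Submodule.pow_induction_on_left' with
    | algebraMap r =>
      rw [AlgHom.commutes]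
      rfl
    | add x y i hx hy h1 h2 => rw [map_add, h1, h2, AddMonoidAlgebra.single_add]
    | mem_mul x hx i y hy h =>
      obtain ⟨α, hα, rfl⟩ := hx
      rw [map_mul, h, bigrading_ι, covecProj10_of_mem hJ hα, covecProj01_of_mem_covec10 hJ hα,
        map_zero, AddMonoidAlgebra.single_zero, add_zero, AddMonoidAlgebra.single_mul_single]
      congr 1
      simp [add_comm]
  have h01 (k : ℕ) : ∀ φ ∈ (covec01 J).map (ExteriorAlgebra.ι ℂ) ^ k,
      bigrading J φ = AddMonoidAlgebra.single ((0, k) : ℤ × ℤ) φ := by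
    intro φ hφ
    induction hφ using Submodule.pow_induction_on_left' with
    | algebraMap r =>
      rw [AlgHom.commutes]
      rfl
    | add x y i hx hy h1 h2 => rw [map_add, h1, h2, AddMonoidAlgebra.single_add]
    | mem_mul x hx i y hy h =>
      obtain ⟨α, hα, rfl⟩ := hx
      rw [map_mul, h, bigrading_ι, covecProj01_of_mem hJ hα, covecProj10_of_mem_covec01 hJ hα,
        map_zero, AddMonoidAlgebra.single_zero, zero_add, AddMonoidAlgebra.single_mul_single]
      congr 1
      simp [add_comm]
  by_cases h : a < 0 ∨ b < 0
  · rw [bidegPart_eq_bot_of_neg h, Submodule.mem_bot] at hφ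
    simp [hφ]
  · push Not at h
    lift a to ℕ using h.1
    lift b to ℕ using h.2
    rw [bidegPart_natCast] at hφ
    induction hφ using Submodule.mul_induction_on' with
    | mem_mul_mem x hx y hy =>
      rw [map_mul, h10 a x hx, h01 b y hy, AddMonoidAlgebra.single_mul_single]
      simp
    | add x hx y hy h1 h2 => rw [map_add, h1, h2, AddMonoidAlgebra.single_add]

theorem bidegProj_of_mem (hJ : ∀ v, J (J v) = -v) {a b : ℤ} {φ : ExtForm V}
    (hφ : φ ∈ bidegPart J a b) : bidegProj J a b φ = φ := by
  change (bigrading J φ).coeff (a, b) = _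
  simp [bigrading_of_mem hJ hφ]

/-- Replaces membership in a span of products by a fixed point equation, the form in which types are
checked from here on. -/
theorem mem_bidegPart_iff (hJ : ∀ v, J (J v) = -v) {a b : ℤ} {φ : ExtForm V} :
    φ ∈ bidegPart J a b ↔ bidegProj J a b φ = φ :=
  ⟨bidegProj_of_mem hJ, fun h => h ▸ bidegProj_mem a b φ⟩

theorem bidegProj_mul_of_mem (hJ : ∀ v, J (J v) = -v) {c d : ℤ} {ψ : ExtForm V}
    (hψ : ψ ∈ bidegPart J c d) (a b : ℤ) (φ : ExtForm V) :
    bidegProj J (a + c) (b + d) (φ * ψ) = bidegProj J a b φ * ψ := by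
  change (bigrading J (φ * ψ)).coeff _ = _
  rw [map_mul, bigrading_of_mem hJ hψ, AddMonoidAlgebra.coeff_mul_single_apply]
  simp only [Prod.neg_mk, Prod.mk_add_mk, add_neg_cancel_right]
  rfl

theorem bidegProj_mem_mul (hJ : ∀ v, J (J v) = -v) {c d : ℤ} {ψ : ExtForm V}
    (hψ : ψ ∈ bidegPart J c d) (a b : ℤ) (φ : ExtForm V) :
    bidegProj J (c + a) (d + b) (ψ * φ) = ψ * bidegProj J a b φ := by
  change (bigrading J (ψ * φ)).coeff _ = _
  rw [map_mul, bigrading_of_mem hJ hψ, AddMonoidAlgebra.coeff_single_mul_apply]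
  simp only [Prod.neg_mk, Prod.mk_add_mk, neg_add_cancel_left]
  rfl

theorem bidegPart_le_exteriorPower (a b : ℕ) :
    bidegPart J a b ≤ ⋀[ℂ]^(a + b) (Covector V) := by
  change (covec10 J).map (ExteriorAlgebra.ι ℂ) ^ a * (covec01 J).map (ExteriorAlgebra.ι ℂ) ^ b ≤ _
  rw [ExteriorAlgebra.exteriorPower, pow_add]
  exact mul_le_mul' (pow_le_pow_left' (LinearMap.map_le_range) _)
    (pow_le_pow_left' (LinearMap.map_le_range) _)

theorem scale_of_mem (c : ℂ) {a b : ℤ} {φ : ExtForm V} (hφ : φ ∈ bidegPart J a b) :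
    scale c φ = c ^ (a + b) • φ := by
  by_cases h : a < 0 ∨ b < 0
  · rw [bidegPart_eq_bot_of_neg h, Submodule.mem_bot] at hφ
    simp [hφ]
  · push Not at h
    lift a to ℕ using h.1
    lift b to ℕ using h.2
    rw [scale_of_mem_exteriorPower c (bidegPart_le_exteriorPower a b hφ)]
    norm_cast

theorem mul_eq_of_mem {a b : ℤ} {ξ : ExtForm V} (hξ : ξ ∈ bidegPart J a b) (φ : ExtForm V) :
    ξ * φ = scale ((-1) ^ (a + b)) φ * ξ := by
  by_cases h : a < 0 ∨ b < 0
  · rw [bidegPart_eq_bot_of_neg h, Submodule.mem_bot] at hξ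
    simp [hξ]
  · push Not at h
    lift a to ℕ using h.1
    lift b to ℕ using h.2
    rw [mul_eq_of_mem_exteriorPower (bidegPart_le_exteriorPower a b hξ)]
    norm_cast

/-! ### The interior derivative of a vector valued form of given type -/

theorem vecBidegPart_induction {U : Submodule ℂ (Complexification V)} {a b : ℤ}
    {C : ∀ K ∈ vecBidegPart J U a b, Prop} (h0 : C 0 (Submodule.zero_mem _))
    (hadd : ∀ K hK L hL, C K hK → C L hL → C (K + L) (Submodule.add_mem _ hK hL))
    (hsmul : ∀ (c : ℂ) K hK, C K hK → C (c • K) (Submodule.smul_mem _ c hK))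
    (hm : ∀ ξ (hξ : ξ ∈ bidegPart J a b), ∀ X (hX : X ∈ U),
      C (ξ ⊗ₜ X) (Submodule.apply_mem_map₂ _ hξ hX))
    (K : VecForm V) (hK : K ∈ vecBidegPart J U a b) : C K hK := by
  have hK' := hK
  rw [vecBidegPart, Submodule.map₂_eq_span_image2] at hK'
  suffices h : ∃ hK, C K hK from h.2
  clear hK
  induction hK' using Submodule.span_induction with
  | mem K hK =>
    obtain ⟨ξ, hξ, X, hX, rfl⟩ := hK
    exact ⟨_, hm ξ hξ X hX⟩
  | zero => exact ⟨_, h0⟩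
  | add K L _ _ hK hL => exact ⟨_, hadd K hK.1 L hL.1 hK.2 hL.2⟩
  | smul c K _ hK => exact ⟨_, hsmul c K hK.1 hK.2⟩

/-- `i_K` has degree `a + b - 1`: contraction lowers the degree by one and the form part of `K`
raises it by `a + b`. The exponent can be `-1`, hence `c ≠ 0`. -/
theorem scale_interiorMap {U : Submodule ℂ (Complexification V)} {a b : ℤ} {K : VecForm V}
    (hK : K ∈ vecBidegPart J U a b) {c : ℂ} (hc : c ≠ 0) (φ : ExtForm V) :
    scale c (interiorMap K φ) = c ^ (a + b - 1) • interiorMap K (scale c φ) := by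
  induction K, hK using vecBidegPart_induction with
  | h0 => simp
  | hadd K _ L _ hK hL => simp only [map_add, LinearMap.add_apply, hK, hL, smul_add]
  | hsmul d K _ hK => simp only [map_smul, LinearMap.smul_apply, hK, smul_comm d]
  | hm ξ hξ X hX =>
    rw [interiorMap_tmul_contract, interiorMap_tmul_contract, map_mul, scale_of_mem c hξ,
      ← scale_contract, mul_smul_comm, smul_smul, smul_mul_assoc, ← zpow_add_one₀ hc]
    simp

theorem interiorMap_mul {U : Submodule ℂ (Complexification V)} {a b : ℤ} {K : VecForm V}
    (hK : K ∈ vecBidegPart J U a b) (φ ψ : ExtForm V) :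
    interiorMap K (φ * ψ) =
      interiorMap K φ * ψ + scale ((-1) ^ (a + b - 1)) φ * interiorMap K ψ := by
  induction K, hK using vecBidegPart_induction with
  | h0 => simp
  | hadd K _ L _ hK hL =>
    simp only [map_add, LinearMap.add_apply, hK, hL, add_mul, mul_add]
    abel
  | hsmul d K _ hK =>
    simp only [map_smul, LinearMap.smul_apply, hK, smul_add, smul_mul_assoc, mul_smul_comm]
  | hm ξ hξ X hX =>
    -- The sign of moving `ξ` past the first factor, times the sign of the contraction, is the sign
    -- of a derivation of degree `a + b - 1`.
    have hs : (-1 : ℂ) ^ (a + b) * -1 = (-1) ^ (a + b - 1) := by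
      rw [zpow_sub_one₀ (by norm_num)]
      norm_num
    simp only [interiorMap_tmul_contract, contract_mul, mul_add, ← mul_assoc]
    rw [mul_eq_of_mem hξ (scale (-1) φ), scale_scale, hs]

theorem bidegProj_interiorMap (hJ : ∀ v, J (J v) = -v) {U : Submodule ℂ (Complexification V)}
    {u v : ℤ} (hU : (u = 1 ∧ v = 0 ∧ U = vec10 J) ∨ (u = 0 ∧ v = 1 ∧ U = vec01 J)) {p q : ℤ}
    {K : VecForm V} (hK : K ∈ vecBidegPart J U p q) (a b : ℤ) (φ : ExtForm V) :
    bidegProj J (p + a) (q + b) (interiorMap K φ) =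
      interiorMap K (bidegProj J (a + u) (b + v) φ) := by
  induction K, hK using vecBidegPart_induction with
  | h0 => simp
  | hadd K _ L _ hK hL => simp only [map_add, LinearMap.add_apply, hK, hL]
  | hsmul d K _ hK => simp only [map_smul, LinearMap.smul_apply, hK]
  | hm ξ hξ X hX =>
    rw [interiorMap_tmul_contract, interiorMap_tmul_contract, bidegProj_mem_mul hJ hξ,
      bidegProj_contract]
    rcases hU with ⟨hu, hv, rfl⟩ | ⟨hu, hv, rfl⟩
    · exact Or.inl ⟨hu, hv, hX⟩
    · exact Or.inr ⟨hu, hv, hX⟩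

/-! ### Naturality -/

theorem pullback_ι (f : V →ₗ[ℝ] W) (α : Covector W) :
    pullback f (ExteriorAlgebra.ι ℂ α) = ExteriorAlgebra.ι ℂ (α ∘ₗ f.baseChange ℂ) := by
  simp [pullback]
  rfl

theorem pullback_comp_apply {U : Type*} [AddCommGroup U] [Module ℝ U] (f : V →ₗ[ℝ] W)
    (g : W →ₗ[ℝ] U) (φ : ExtForm U) : pullback f (pullback g φ) = pullback (g ∘ₗ f) φ := by
  induction φ using extForm_induction with
  | hc c => simp
  | ha x y hx hy => simp [hx, hy]
  | hm α x hx => simp [hx, pullback_ι, LinearMap.baseChange_comp, LinearMap.comp_assoc]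

theorem pullback_id (φ : ExtForm V) : pullback (LinearMap.id : V →ₗ[ℝ] V) φ = φ := by
  induction φ using extForm_induction with
  | hc c => simp
  | ha x y hx hy => simp [hx, hy]
  | hm α x hx => simp [hx, pullback_ι]

theorem pullback_scale (f : V →ₗ[ℝ] W) (c : ℂ) (φ : ExtForm W) :
    pullback f (scale c φ) = scale c (pullback f φ) := by
  induction φ using extForm_induction with
  | hc c => simp
  | ha x y hx hy => simp [hx, hy]
  | hm α x hx => simp [hx, pullback_ι]

/-- A map that intertwines the two endomorphisms has a transpose that commutes with the covector
projections. -/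
theorem pullback_bidegProj {J : V →ₗ[ℝ] V} {J' : W →ₗ[ℝ] W} {f : V →ₗ[ℝ] W}
    (h : f ∘ₗ J = J' ∘ₗ f) (a b : ℤ) (φ : ExtForm W) :
    pullback f (bidegProj J' a b φ) = bidegProj J a b (pullback f φ) := by
  have hb : f.baseChange ℂ ∘ₗ J.baseChange ℂ = J'.baseChange ℂ ∘ₗ f.baseChange ℂ := by
    rw [← LinearMap.baseChange_comp, h, LinearMap.baseChange_comp]
  have h' (X : Complexification V) :
    f.baseChange ℂ (J.baseChange ℂ X) = J'.baseChange ℂ (f.baseChange ℂ X) :=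
    LinearMap.congr_fun hb X
  have h1 (α : Covector W) : covecProj10 J' α ∘ₗ f.baseChange ℂ =
      covecProj10 J (α ∘ₗ f.baseChange ℂ) := by
    refine LinearMap.ext fun X => ?_
    simp only [covecProj10_apply, LinearMap.comp_apply, vecProj10, LinearMap.smul_apply,
      LinearMap.sub_apply, LinearMap.id_apply, map_smul, map_sub, h']
  have h2 (α : Covector W) : covecProj01 J' α ∘ₗ f.baseChange ℂ =
      covecProj01 J (α ∘ₗ f.baseChange ℂ) := by
    refine LinearMap.ext fun X => ?_
    simp only [covecProj01_apply, LinearMap.comp_apply, vecProj01, LinearMap.smul_apply,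
      LinearMap.add_apply, LinearMap.id_apply, map_smul, map_add, h']
  induction φ using extForm_induction generalizing a b with
  | hc c =>
    simp only [bidegProj_algebraMap, AlgHom.commutes]
    split_ifs <;> simp
  | ha x y hx hy => simp [hx, hy]
  | hm α x hx => simp [hx, pullback_ι, bidegProj_ι_mul, h1, h2]

theorem pullback_contract (f : V →ₗ[ℝ] W) (X : Complexification V) (φ : ExtForm W) :
    contract X (pullback f φ) = pullback f (contract (f.baseChange ℂ X) φ) := by
  induction φ using extForm_induction with
  | hc c => simp
  | ha x y hx hy => simp [hx, hy]
  | hm α x hx => simp [hx, pullback_ι, contract_ι_mul]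

/-- The vector part of `K` is pushed forward by `f`, and contraction against a form pulled back by
`g` pushes it on by `g`; so only `g ∘ f = id` matters. -/
theorem pullback_interiorMap (f : V →ₗ[ℝ] W) (g : W →ₗ[ℝ] V) (hgf : g ∘ₗ f = LinearMap.id)
    (K : VecForm V) (φ : ExtForm V) :
    interiorMap (TensorProduct.map (pullback g).toLinearMap (f.baseChange ℂ) K) (pullback g φ) =
      pullback g (interiorMap K φ) := by
  induction K using TensorProduct.induction_on with
  | zero => simp
  | tmul ξ X =>
    have : g.baseChange ℂ (f.baseChange ℂ X) = X := by
      rw [← LinearMap.comp_apply, ← LinearMap.baseChange_comp, hgf]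
      simp
    rw [TensorProduct.map_tmul, interiorMap_tmul_contract, interiorMap_tmul_contract,
      pullback_contract, this, map_mul]
    rfl
  | add K L hK hL => simp only [map_add, LinearMap.add_apply, hK, hL]

/-! ### Types beyond the dimension vanish. -/

section FiniteDimensional

variable [Module.Finite ℝ V]

/-- The complex dual of `V ⊗ ℂ` has complex dimension `dim V`, so its higher exterior powers are
zero. The bound is crude, but it justifies the finite ranges in the sums defining `∂` and `∂̄`. -/
theorem bidegPart_eq_bot {J : V →ₗ[ℝ] V} {a b : ℤ}
    (h : (Module.finrank ℝ V : ℤ) < a ∨ (Module.finrank ℝ V : ℤ) < b) : bidegPart J a b = ⊥ := by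
  have hbot (k : ℕ) (hk : Module.finrank ℝ V < k) (N : Submodule ℂ (Covector V)) :
      N.map (ExteriorAlgebra.ι ℂ) ^ k = ⊥ := by
    have h1 : Module.finrank ℂ (Covector V) = Module.finrank ℝ V := by
      rw [Subspace.dual_finrank_eq, Module.finrank_baseChange]
    have h2 : Module.finrank ℂ (⋀[ℂ]^k (Covector V)) = 0 := by
      rw [exteriorPower.finrank_eq, h1, Nat.choose_eq_zero_of_lt hk]
    rw [Submodule.finrank_eq_zero] at h2
    rw [eq_bot_iff, ← h2]
    exact pow_le_pow_left' LinearMap.map_le_range _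
  by_cases h' : a < 0 ∨ b < 0
  · exact bidegPart_eq_bot_of_neg h'
  · push Not at h'
    lift a to ℕ using h'.1
    lift b to ℕ using h'.2
    rw [bidegPart_natCast]
    rcases h with h | h
    · rw [hbot a (by exact_mod_cast h), Submodule.bot_mul]
    · rw [hbot b (by exact_mod_cast h), Submodule.mul_bot]

theorem sum_range_bidegProj (J : V →ₗ[ℝ] V) (φ : ExtForm V) :
    ∑ a ∈ Finset.range (Module.finrank ℝ V + 1), ∑ b ∈ Finset.range (Module.finrank ℝ V + 1),
      bidegProj J a b φ = φ := by
  have h := sum_bidegProj J (((Finset.range (Module.finrank ℝ V + 1)) ×ˢ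
    (Finset.range (Module.finrank ℝ V + 1))).map
      (Nat.castEmbedding.prodMap Nat.castEmbedding)) φ ?_
  · rw [Finset.sum_map, Finset.sum_product] at h
    exact h
  · intro a b hab
    have hm := bidegProj_mem (J := J) a b φ
    suffices h : bidegPart J a b = ⊥ by rwa [h, Submodule.mem_bot] at hm
    by_cases h' : a < 0 ∨ b < 0
    · exact bidegPart_eq_bot_of_neg h'
    · push Not at h'
      lift a to ℕ using h'.1
      lift b to ℕ using h'.2
      apply bidegPart_eq_bot
      by_contra! hc
      apply hab
      simp only [Finset.mem_map, Finset.mem_product, Finset.mem_range]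
      exact ⟨(a, b), ⟨by omega, by omega⟩, rfl⟩

end FiniteDimensional

end Pointwise

/-! ### Hadamard's lemma -/

section Hadamard

variable {E : Type*} [NormedAddCommGroup E] [NormedSpace ℝ E] [FiniteDimensional ℝ E]

theorem hasFDerivAt_integral_of_contDiff {f : E × ℝ → ℂ} (hf : ContDiff ℝ ∞ f) (x : E) :
    HasFDerivAt (fun y => ∫ t in (0 : ℝ)..1, f (y, t))
      (∫ t in (0 : ℝ)..1, (fderiv ℝ f (x, t)).comp (ContinuousLinearMap.inl ℝ E ℝ)) x := by
  have hc : Continuous fun z : E × ℝ => (fderiv ℝ f z).comp (ContinuousLinearMap.inl ℝ E ℝ) :=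
    (hf.continuous_fderiv (by simp)).clm_comp continuous_const
  -- Compactness of the closed ball times `[0,1]` gives a constant that dominates the derivative of
  -- the integrand.
  obtain ⟨C, hC⟩ := ((isCompact_closedBall x 1).prod (isCompact_Icc (a := (0 : ℝ))
    (b := 1))).exists_bound_of_continuousOn hc.continuousOn
  have hct (y : E) : Continuous fun t : ℝ => ((y, t) : E × ℝ) := by fun_prop
  refine intervalIntegral.hasFDerivAt_integral_of_dominated_of_fderiv_le
    (F := fun y t => f (y, t))
    (F' := fun y t => (fderiv ℝ f (y, t)).comp (ContinuousLinearMap.inl ℝ E ℝ))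
    (bound := fun _ => C) (Metric.ball_mem_nhds x one_pos) ?_ ?_ ?_ ?_ ?_ ?_
  · exact Filter.Eventually.of_forall fun y =>
      (hf.continuous.comp (hct y)).aestronglyMeasurable
  · exact (hf.continuous.comp (hct x)).intervalIntegrable _ _
  · exact (hc.comp (hct x)).aestronglyMeasurable
  · refine Filter.Eventually.of_forall fun t ht y hy => hC (y, t)
      ⟨Metric.ball_subset_closedBall hy, ?_⟩
    rw [Set.uIoc_of_le zero_le_one] at ht
    exact Set.Ioc_subset_Icc_self ht
  · exact intervalIntegrable_const
  · refine Filter.Eventually.of_forall fun t ht y hy => ?_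
    have h1 := ((hf.differentiable (by simp)) (y, t)).hasFDerivAt
    exact h1.comp y (hasFDerivAt_prodMk_left y t)

/-- A directional derivative of the integral is the integral of a partial derivative of `f`, again a
smooth integrand; the induction on the order therefore varies `f`. -/
theorem contDiff_integral {f : E × ℝ → ℂ} (hf : ContDiff ℝ ∞ f) :
    ContDiff ℝ ∞ (fun y => ∫ t in (0 : ℝ)..1, f (y, t)) := by
  rw [contDiff_infty]
  intro n
  induction n generalizing f with
  | zero =>
    rw [Nat.cast_zero, contDiff_zero]
    exact continuous_iff_continuousAt.mpr fun x =>
      (hasFDerivAt_integral_of_contDiff hf x).continuousAt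
  | succ n ih =>
    rw [Nat.cast_succ, contDiff_succ_iff_fderiv_apply]
    refine ⟨fun x => (hasFDerivAt_integral_of_contDiff hf x).differentiableAt, by simp, fun v => ?_⟩
    have h : (fun x => fderiv ℝ (fun y => ∫ t in (0 : ℝ)..1, f (y, t)) x v) =
        fun x => ∫ t in (0 : ℝ)..1, fderiv ℝ f (x, t) (v, 0) := by
      funext x
      rw [(hasFDerivAt_integral_of_contDiff hf x).fderiv,
        ContinuousLinearMap.intervalIntegral_apply]
      · simp
      · refine Continuous.intervalIntegrable ?_ _ _
        exact ((hf.continuous_fderiv (by simp)).comp (by fun_prop)).clm_comp continuous_const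
    rw [h]
    exact ih (f := fun z => fderiv ℝ f z (v, 0))
      ((hf.fderiv_right (m := ∞) (by simp)).clm_apply contDiff_const)

/-- Hadamard's lemma. -/
theorem exists_contDiff_eq_sum {h : E → ℂ} (hh : ContDiff ℝ ∞ h) (y₀ : E) :
    ∃ g : Fin (Module.finrank ℝ E) → E → ℂ, (∀ i, ContDiff ℝ ∞ (g i)) ∧
      (∀ i, g i y₀ = fderiv ℝ h y₀ (Module.finBasis ℝ E i)) ∧
      ∀ y, h y = h y₀ + ∑ i, ((Module.finBasis ℝ E).repr (y - y₀) i : ℂ) * g i y := by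
  set b := Module.finBasis ℝ E
  -- `h y - h y₀` is the integral of the derivative of `h` along the segment from `y₀` to `y`;
  -- expanding `y - y₀` in the basis gives these coefficients. At `y = y₀` the integrand is
  -- constant.
  refine ⟨fun i y => ∫ t in (0 : ℝ)..1, fderiv ℝ h (y₀ + t • (y - y₀)) (b i), fun i => ?_,
    fun i => by simp, fun y => ?_⟩
  · refine contDiff_integral (f := fun z => fderiv ℝ h (y₀ + z.2 • (z.1 - y₀)) (b i)) ?_
    refine ContDiff.clm_apply ?_ contDiff_const
    exact (hh.fderiv_right (m := ∞) (by simp)).comp (by fun_prop)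
  · have hd (t : ℝ) : HasDerivAt (fun t : ℝ => h (y₀ + t • (y - y₀)))
        (fderiv ℝ h (y₀ + t • (y - y₀)) (y - y₀)) t := by
      have h1 := ((hh.differentiable (by simp)) (y₀ + t • (y - y₀))).hasFDerivAt
      have h2 : HasDerivAt (fun t : ℝ => y₀ + t • (y - y₀)) (y - y₀) t := by
        simpa using ((hasDerivAt_id t).smul_const (y - y₀)).const_add y₀
      exact h1.comp_hasDerivAt t h2
    have hcont (v : E) : Continuous fun t : ℝ => fderiv ℝ h (y₀ + t • (y - y₀)) v :=
      ((hh.continuous_fderiv (by simp)).comp (by fun_prop)).clm_apply continuous_const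
    have h3 := intervalIntegral.integral_eq_sub_of_hasDerivAt (a := 0) (b := 1)
      (fun t _ => hd t) ((hcont _).intervalIntegrable _ _)
    simp only [one_smul, add_sub_cancel, zero_smul, add_zero] at h3
    have h4 (t : ℝ) : fderiv ℝ h (y₀ + t • (y - y₀)) (y - y₀) =
        ∑ i, (b.repr (y - y₀) i : ℂ) * fderiv ℝ h (y₀ + t • (y - y₀)) (b i) := by
      conv_lhs => rw [← b.sum_repr (y - y₀)]
      rw [map_sum]
      refine Finset.sum_congr rfl fun i _ => ?_
      rw [b.sum_repr, map_smul, Complex.real_smul]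
    simp only [h4] at h3
    rw [intervalIntegral.integral_finsetSum] at h3
    · simp only [intervalIntegral.integral_const_mul] at h3
      rw [h3]
      ring
    · exact fun i _ => (continuous_const.mul (hcont _)).intervalIntegrable _ _

end Hadamard

/-! ### Smooth maps into complex vector spaces -/

section Smooth

variable {E : Type*} [NormedAddCommGroup E] [NormedSpace ℝ E]
variable {X Y : Type*} [AddCommGroup X] [Module ℂ X] [AddCommGroup Y] [Module ℂ Y]
variable {s : Set E}

theorem SmoothVecOn.add {F G : E → X} (hF : SmoothVecOn F s) (hG : SmoothVecOn G s) :
    SmoothVecOn (fun y => F y + G y) s := fun l => by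
  simpa only [map_add] using (hF l).add (hG l)

theorem SmoothVecOn.sum {ι : Type*} {F : ι → E → X} {t : Finset ι}
    (hF : ∀ i ∈ t, SmoothVecOn (F i) s) : SmoothVecOn (fun y => ∑ i ∈ t, F i y) s := fun l => by
  simpa only [map_sum] using ContDiffOn.sum fun i hi => hF i hi l

theorem SmoothVecOn.smul {f : E → ℂ} {F : E → X} (hf : ContDiffOn ℝ ∞ f s)
    (hF : SmoothVecOn F s) : SmoothVecOn (fun y => f y • F y) s := fun l => by
  simpa only [map_smul, smul_eq_mul] using hf.mul (hF l)

theorem smoothVecOn_const (x : X) : SmoothVecOn (fun _ : E => x) s := fun _ => contDiffOn_const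

theorem SmoothVecOn.map {F : E → X} (hF : SmoothVecOn F s) (L : X →ₗ[ℂ] Y) :
    SmoothVecOn (fun y => L (F y)) s := fun l => hF (l ∘ₗ L)

theorem SmoothVecOn.mono {F : E → X} {t : Set E} (hF : SmoothVecOn F s) (h : t ⊆ s) :
    SmoothVecOn F t := fun l => (hF l).mono h

theorem SmoothVecOn.congr {F G : E → X} (hF : SmoothVecOn F s) (h : ∀ y ∈ s, G y = F y) :
    SmoothVecOn G s := fun l => (hF l).congr fun y hy => congrArg l (h y hy)

theorem SmoothVecOn.comp {E' : Type*} [NormedAddCommGroup E'] [NormedSpace ℝ E'] {F : E → X}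
    (hF : SmoothVecOn F s) {g : E' → E} {t : Set E'} (hg : ContDiffOn ℝ ∞ g t)
    (hst : Set.MapsTo g t s) : SmoothVecOn (fun y => F (g y)) t := fun l => (hF l).comp hg hst

theorem smoothVecOn_complex {f : E → ℂ} : SmoothVecOn f s ↔ ContDiffOn ℝ ∞ f s := by
  refine ⟨fun h => h LinearMap.id, fun h => ?_⟩
  have : f = fun y => f y • (1 : ℂ) := by simp
  rw [this]
  exact SmoothVecOn.smul h (smoothVecOn_const _)

/-- A smooth family of linear maps takes smooth maps to smooth maps. -/
theorem SmoothVecOn.apply [Module.Finite ℂ X] {L : E → X →ₗ[ℂ] Y} {F : E → X}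
    (hL : ∀ x, SmoothVecOn (fun y => L y x) s) (hF : SmoothVecOn F s) :
    SmoothVecOn (fun y => L y (F y)) s := by
  have b := Module.finBasis ℂ X
  have h1 : (fun y => L y (F y)) = fun y => ∑ i, b.coord i (F y) • L y (b i) := by
    funext y
    conv_lhs => rw [← b.sum_repr (F y)]
    simp only [map_sum, map_smul, Module.Basis.coord_apply]
  rw [h1]
  exact SmoothVecOn.sum fun i _ => SmoothVecOn.smul (hF _) (hL _)

theorem SmoothVecOn.bilin [Module.Finite ℂ X] {Z : Type*} [AddCommGroup Z] [Module ℂ Z]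
    (B : X →ₗ[ℂ] Y →ₗ[ℂ] Z) {F : E → X} {G : E → Y}
    (hF : SmoothVecOn F s) (hG : SmoothVecOn G s) : SmoothVecOn (fun y => B (F y) (G y)) s :=
  SmoothVecOn.apply (L := fun y => B.flip (G y)) (fun x => hG.map (B x)) hF

/-- Smoothness can be checked locally. -/
theorem smoothVecOn_of_locally {F : E → X}
    (h : ∀ y ∈ s, ∃ t ∈ nhds y, SmoothVecOn F t) : SmoothVecOn F s := by
  intro l y hy
  obtain ⟨t, ht, hF⟩ := h y hy
  exact ((hF l).contDiffAt ht).contDiffWithinAt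

end Smooth

section Calculus

/-! ### Covectors from real linear functions -/

/-- The complex linear extension of a complex valued real linear function. -/
def covectorOf {V : Type*} [AddCommGroup V] [Module ℝ V] : (V →ₗ[ℝ] ℂ) →ₗ[ℂ] Covector V where
  toFun L := L.liftBaseChange ℂ
  map_add' L L' := by
    ext v
    simp
  map_smul' c L := by
    ext v
    simp

theorem covectorOf_tmul {V : Type*} [AddCommGroup V] [Module ℝ V] (L : V →ₗ[ℝ] ℂ) (c : ℂ) (v : V) :
    covectorOf L (c ⊗ₜ v) = c * L v := by
  simp [covectorOf]

/-- The restriction of a covector to the real vectors. -/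
def covectorRestrict {V : Type*} [AddCommGroup V] [Module ℝ V] (α : Covector V) : V →ₗ[ℝ] ℂ :=
  α.restrictScalars ℝ ∘ₗ TensorProduct.mk ℝ ℂ V 1

theorem covectorRestrict_apply {V : Type*} [AddCommGroup V] [Module ℝ V] (α : Covector V) (v : V) :
    covectorRestrict α v = α (1 ⊗ₜ v) := rfl

theorem covectorOf_covectorRestrict {V : Type*} [AddCommGroup V] [Module ℝ V] (α : Covector V) :
    covectorOf (covectorRestrict α) = α := by
  ext v
  simp [covectorOf_tmul, covectorRestrict_apply]

theorem covectorOf_comp {V W : Type*} [AddCommGroup V] [Module ℝ V] [AddCommGroup W] [Module ℝ W]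
    (L : W →ₗ[ℝ] ℂ) (f : V →ₗ[ℝ] W) :
    covectorOf (L ∘ₗ f) = covectorOf L ∘ₗ f.baseChange ℂ := by
  ext v
  simp [covectorOf_tmul]

theorem pullback_covectorOf {V W : Type*} [AddCommGroup V] [Module ℝ V] [AddCommGroup W]
    [Module ℝ W] (L : W →ₗ[ℝ] ℂ) (f : V →ₗ[ℝ] W) :
    pullback f (ExteriorAlgebra.ι ℂ (covectorOf L)) =
      ExteriorAlgebra.ι ℂ (covectorOf (L ∘ₗ f)) := by
  rw [pullback_ι, covectorOf_comp]

variable {E : Type*} [NormedAddCommGroup E] [NormedSpace ℝ E]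

/-- A map to a complex vector space is differentiable if all its coordinates are. -/
def DiffVecAt {X : Type*} [AddCommGroup X] [Module ℂ X] (F : E → X) (y : E) : Prop :=
  ∀ l : Module.Dual ℂ X, DifferentiableAt ℝ (fun z => l (F z)) y

theorem SmoothVecOn.diffVecAt {X : Type*} [AddCommGroup X] [Module ℂ X] {F : E → X} {s : Set E}
    (hF : SmoothVecOn F s) {y : E} (hs : s ∈ nhds y) : DiffVecAt F y := fun l =>
  ((hF l).contDiffAt hs).differentiableAt (by simp)

theorem DiffVecAt.smul {X : Type*} [AddCommGroup X] [Module ℂ X] {f : E → ℂ} {F : E → X} {y : E}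
    (hf : DifferentiableAt ℝ f y) (hF : DiffVecAt F y) : DiffVecAt (fun z => f z • F z) y := by
  intro l
  simpa only [map_smul, smul_eq_mul] using hf.fun_mul (hF l)

theorem DiffVecAt.sum {X : Type*} [AddCommGroup X] [Module ℂ X] {ι : Type*} {F : ι → E → X}
    {t : Finset ι} {y : E} (hF : ∀ i ∈ t, DiffVecAt (F i) y) :
    DiffVecAt (fun z => ∑ i ∈ t, F i z) y := by
  intro l
  simpa only [map_sum] using DifferentiableAt.fun_sum fun i hi => hF i hi l

variable [FiniteDimensional ℝ E]

theorem dx_tmul (i j : Fin (Module.finrank ℝ E)) (c : ℂ) :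
    dx E i (c ⊗ₜ Module.finBasis ℝ E j) = if i = j then c else 0 := by
  have h : (c ⊗ₜ[ℝ] Module.finBasis ℝ E j) = c • (Module.finBasis ℝ E).baseChange ℂ j := by
    rw [Module.Basis.baseChange_apply, TensorProduct.smul_tmul', smul_eq_mul, mul_one]
  rw [h, map_smul, dx, Module.Basis.dualBasis_apply_self]
  simp [eq_comm]

theorem covectorOf_eq_sum (L : E →ₗ[ℝ] ℂ) :
    covectorOf L = ∑ i, L (Module.finBasis ℝ E i) • dx E i := by
  refine ((Module.finBasis ℝ E).baseChange ℂ).ext fun j => ?_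
  simp [covectorOf_tmul, dx_tmul]

theorem covector_eq_sum (α : Covector E) :
    α = ∑ i, α (1 ⊗ₜ Module.finBasis ℝ E i) • dx E i := by
  conv_lhs => rw [← covectorOf_covectorRestrict α, covectorOf_eq_sum]
  rfl

/-! ### Smoothness of pullbacks and projections -/

theorem contDiffOn_linear {s : Set E} {f : E → E} (hf : ContDiffOn ℝ ∞ f s) (L : E →ₗ[ℝ] ℂ) :
    ContDiffOn ℝ ∞ (fun y => L (f y)) s :=
  (LinearMap.toContinuousLinearMap L).contDiff.comp_contDiffOn hf

theorem smoothVecOn_covectorOf {s : Set E} {L : E → E →ₗ[ℝ] ℂ}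
    (hL : ∀ v, ContDiffOn ℝ ∞ (fun y => L y v) s) : SmoothVecOn (fun y => covectorOf (L y)) s := by
  simp only [covectorOf_eq_sum]
  exact SmoothVecOn.sum fun i _ => SmoothVecOn.smul (hL _) (smoothVecOn_const _)

/-- A covector is the complex extension of its restriction to real vectors, so the coefficients of
the composite are a fixed real linear function applied to vectors `A y v`. -/
theorem smoothVecOn_covector_comp {s : Set E} {A : E → E →ₗ[ℝ] E}
    (hA : ∀ v, ContDiffOn ℝ ∞ (fun y => A y v) s) (α : Covector E) :
    SmoothVecOn (fun y => α ∘ₗ (A y).baseChange ℂ) s := by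
  have h : (fun y => α ∘ₗ (A y).baseChange ℂ) =
      fun y => covectorOf (covectorRestrict α ∘ₗ A y) := by
    funext y
    rw [covectorOf_comp, covectorOf_covectorRestrict]
  rw [h]
  exact smoothVecOn_covectorOf fun v => contDiffOn_linear (hA v) (covectorRestrict α)

theorem smoothVecOn_pullback_const {s : Set E} {A : E → E →ₗ[ℝ] E}
    (hA : ∀ v, ContDiffOn ℝ ∞ (fun y => A y v) s) (φ : ExtForm E) :
    SmoothVecOn (fun y => pullback (A y) φ) s := by
  induction φ using extForm_induction with
  | hc c =>
    simp only [AlgHom.commutes]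
    exact smoothVecOn_const _
  | ha φ ψ hφ hψ =>
    simp only [map_add]
    exact hφ.add hψ
  | hm α φ hφ =>
    simp only [map_mul, pullback_ι]
    exact ((smoothVecOn_covector_comp hA α).map _).mul hφ

theorem SmoothVecOn.pullback {s : Set E} {A : E → E →ₗ[ℝ] E}
    (hA : ∀ v, ContDiffOn ℝ ∞ (fun y => A y v) s) {F : E → ExtForm E} (hF : SmoothVecOn F s) :
    SmoothVecOn (fun y => pullback (A y) (F y)) s :=
  SmoothVecOn.apply (L := fun y => (AlmostComplex.pullback (A y)).toLinearMap)
    (smoothVecOn_pullback_const hA) hF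

theorem smoothVecOn_bidegProj_const {s : Set E} {J : E → E →ₗ[ℝ] E}
    (hJ : ∀ v, ContDiffOn ℝ ∞ (fun y => J y v) s) (a b : ℤ) (φ : ExtForm E) :
    SmoothVecOn (fun y => bidegProj (J y) a b φ) s := by
  induction φ using extForm_induction generalizing a b with
  | hc c =>
    simp only [bidegProj_algebraMap]
    exact smoothVecOn_const _
  | ha φ ψ hφ hψ =>
    simp only [map_add]
    exact (hφ a b).add (hψ a b)
  | hm α φ hφ =>
    have h := smoothVecOn_covector_comp hJ α
    have h1 (c : ℂ) := (SmoothVecOn.smul contDiffOn_const h (f := fun _ => c))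
    have h10 : SmoothVecOn (fun y => covecProj10 (J y) α) s :=
      SmoothVecOn.smul contDiffOn_const (f := fun _ => (1 / 2 : ℂ))
        ((smoothVecOn_const α).add (h1 (-Complex.I))) |>.congr fun y _ => by
          rw [neg_smul, ← sub_eq_add_neg]
          rfl
    have h01 : SmoothVecOn (fun y => covecProj01 (J y) α) s :=
      SmoothVecOn.smul contDiffOn_const (f := fun _ => (1 / 2 : ℂ))
        ((smoothVecOn_const α).add (h1 Complex.I))
    simp only [bidegProj_ι_mul]
    exact ((h10.map _).mul (hφ _ _)).add ((h01.map _).mul (hφ _ _))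

theorem SmoothVecOn.bidegProj {s : Set E} {J : E → E →ₗ[ℝ] E}
    (hJ : ∀ v, ContDiffOn ℝ ∞ (fun y => J y v) s) (a b : ℤ) {F : E → ExtForm E}
    (hF : SmoothVecOn F s) : SmoothVecOn (fun y => bidegProj (J y) a b (F y)) s :=
  SmoothVecOn.apply (L := fun y => AlmostComplex.bidegProj (J y) a b)
    (smoothVecOn_bidegProj_const hJ a b) hF

/-! ### Partial derivatives of exterior forms -/

theorem DiffVecAt.mul {F G : E → ExtForm E} {y : E} (hF : DiffVecAt F y) (hG : DiffVecAt G y) :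
    DiffVecAt (fun z => F z * G z) y := by
  intro l
  have h : (fun y => l (F y * G y)) = fun y => ∑ S, ∑ T,
      (dxBasis E).coord S (F y) * (dxBasis E).coord T (G y) *
        l (dxBasis E S * dxBasis E T) := by
    funext y
    conv_lhs => rw [← (dxBasis E).sum_repr (F y), ← (dxBasis E).sum_repr (G y)]
    simp only [Finset.sum_mul_sum, map_sum, smul_mul_smul_comm, map_smul,
      smul_eq_mul, Module.Basis.coord_apply]
  rw [h]
  exact DifferentiableAt.fun_sum fun S _ => DifferentiableAt.fun_sum fun T _ =>
    ((hF _).mul (hG _)).mul (differentiableAt_const _)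

/-- The derivative of a family of exterior forms in the direction of a vector. -/
def dirDeriv (F : E → ExtForm E) (y v : E) : ExtForm E :=
  ∑ S, (fderiv ℝ (fun z => (dxBasis E).repr (F z) S) y v) • dxBasis E S

/-- Characterises the directional derivative by scalar derivatives, without the basis. With
`eq_of_dual` it reduces the calculus rules below to rules for scalar functions. -/
theorem dual_dirDeriv {F : E → ExtForm E} {y : E} (hF : DiffVecAt F y) (v : E)
    (l : Module.Dual ℂ (ExtForm E)) :
    l (dirDeriv F y v) = fderiv ℝ (fun z => l (F z)) y v := by
  have h : (fun z => l (F z)) = fun z => ∑ S, (dxBasis E).coord S (F z) * l (dxBasis E S) := by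
    funext z
    conv_lhs => rw [← (dxBasis E).sum_repr (F z)]
    simp only [map_sum, map_smul, smul_eq_mul, Module.Basis.coord_apply]
  rw [h, fderiv_fun_sum fun S _ => (hF _).mul_const _, dirDeriv, map_sum,
    sum_apply]
  refine Finset.sum_congr rfl fun S _ => ?_
  rw [fderiv_mul_const (hF _), map_smul]
  simp [mul_comm]

theorem eq_of_dual {X : Type*} [AddCommGroup X] [Module ℂ X] {x y : X}
    (h : ∀ l : Module.Dual ℂ X, l x = l y) : x = y := by
  rw [← sub_eq_zero, ← Module.forall_dual_apply_eq_zero_iff ℂ]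
  intro l
  rw [map_sub, h, sub_self]

theorem dirDeriv_congr {F G : E → ExtForm E} {y : E} (h : F =ᶠ[nhds y] G) (v : E) :
    dirDeriv F y v = dirDeriv G y v := by
  refine Finset.sum_congr rfl fun S _ => ?_
  rw [Filter.EventuallyEq.fderiv_eq]
  filter_upwards [h] with z hz
  rw [hz]

theorem dirDeriv_mul {F G : E → ExtForm E} {y : E} (hF : DiffVecAt F y) (hG : DiffVecAt G y)
    (v : E) : dirDeriv (fun z => F z * G z) y v = dirDeriv F y v * G y + F y * dirDeriv G y v := by
  refine eq_of_dual fun l => ?_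
  rw [dual_dirDeriv (hF.mul hG)]
  have h : (fun y => l (F y * G y)) = fun y => ∑ S, ∑ T,
      (dxBasis E).coord S (F y) * (dxBasis E).coord T (G y) *
        l (dxBasis E S * dxBasis E T) := by
    funext y
    conv_lhs => rw [← (dxBasis E).sum_repr (F y), ← (dxBasis E).sum_repr (G y)]
    simp only [Finset.sum_mul_sum, map_sum, smul_mul_smul_comm, map_smul,
      smul_eq_mul, Module.Basis.coord_apply]
  have h1 (ξ η : ExtForm E) : l (ξ * η) = ∑ S, ∑ T,
      (dxBasis E).coord S ξ * (dxBasis E).coord T η * l (dxBasis E S * dxBasis E T) := by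
    conv_lhs => rw [← (dxBasis E).sum_repr ξ, ← (dxBasis E).sum_repr η]
    simp only [Finset.sum_mul_sum, map_sum, smul_mul_smul_comm, map_smul,
      smul_eq_mul, Module.Basis.coord_apply]
  rw [h, map_add, h1, h1, ← Finset.sum_add_distrib,
    fderiv_fun_sum fun S _ => DifferentiableAt.fun_sum fun T _ =>
      ((hF _).fun_mul (hG _)).mul_const _, sum_apply]
  refine Finset.sum_congr rfl fun S _ => ?_
  rw [← Finset.sum_add_distrib, fderiv_fun_sum fun T _ => ((hF _).fun_mul (hG _)).mul_const _,
    sum_apply]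
  refine Finset.sum_congr rfl fun T _ => ?_
  rw [fderiv_mul_const ((hF _).fun_mul (hG _)), fderiv_fun_mul (hF _) (hG _), dual_dirDeriv hF,
    dual_dirDeriv hG]
  simp
  ring

theorem dirDeriv_map {F : E → ExtForm E} {y : E} (hF : DiffVecAt F y) (v : E)
    (L : ExtForm E →ₗ[ℂ] ExtForm E) :
    dirDeriv (fun z => L (F z)) y v = L (dirDeriv F y v) := by
  refine eq_of_dual fun l => ?_
  rw [dual_dirDeriv (fun l' => hF (l' ∘ₗ L))]
  exact (dual_dirDeriv hF v (l ∘ₗ L)).symm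

theorem dirDeriv_const (φ : ExtForm E) (y v : E) : dirDeriv (fun _ => φ) y v = 0 := by
  simp [dirDeriv]

theorem dirDeriv_add {F G : E → ExtForm E} {y : E} (hF : DiffVecAt F y) (hG : DiffVecAt G y)
    (v : E) : dirDeriv (fun z => F z + G z) y v = dirDeriv F y v + dirDeriv G y v := by
  refine eq_of_dual fun l => ?_
  rw [map_add, dual_dirDeriv hF, dual_dirDeriv hG, dual_dirDeriv fun l => by
    simpa only [map_add] using (hF l).fun_add (hG l)]
  simp only [map_add]
  rw [fderiv_fun_add (hF l) (hG l)]
  rfl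

theorem dirDeriv_algebraMap {f : E → ℂ} {y : E} (hf : DifferentiableAt ℝ f y) (v : E) :
    dirDeriv (fun z => algebraMap ℂ (ExtForm E) (f z)) y v =
      algebraMap ℂ (ExtForm E) (fderiv ℝ f y v) := by
  have h : DiffVecAt (fun z => algebraMap ℂ (ExtForm E) (f z)) y := fun l => by
    simpa only [Algebra.algebraMap_eq_smul_one, map_smul, smul_eq_mul] using hf.mul_const _
  refine eq_of_dual fun l => ?_
  rw [dual_dirDeriv h]
  simp only [Algebra.algebraMap_eq_smul_one, map_smul, smul_eq_mul]
  rw [fderiv_mul_const hf]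
  simp [mul_comm]

/-! ### The exterior derivative on a vector space -/

/-- Writing `d = ∑ dx^i ∧ ∂_i` separates differentiation from the wedge product. -/
theorem extDerivModel_eq (F : E → ExtForm E) (y : E) :
    extDerivModel F y =
      ∑ i, ExteriorAlgebra.ι ℂ (dx E i) * dirDeriv F y (Module.finBasis ℝ E i) := by
  simp only [extDerivModel, dirDeriv, Finset.mul_sum, mul_smul_comm]

theorem extDerivModel_congr {F G : E → ExtForm E} {y : E} (h : F =ᶠ[nhds y] G) :
    extDerivModel F y = extDerivModel G y := by
  simp only [extDerivModel_eq, dirDeriv_congr h]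

theorem extDerivModel_mul {F G : E → ExtForm E} {y : E} (hF : DiffVecAt F y)
    (hG : DiffVecAt G y) : extDerivModel (fun z => F z * G z) y =
      extDerivModel F y * G y + scale (-1) (F y) * extDerivModel G y := by
  simp only [extDerivModel_eq, dirDeriv_mul hF hG, mul_add, Finset.sum_add_distrib,
    Finset.sum_mul, Finset.mul_sum, mul_assoc]
  congr 1
  refine Finset.sum_congr rfl fun i _ => ?_
  -- The sign of the Leibniz rule comes from moving `dx^i` past `F`.
  rw [← mul_assoc, ι_mul_eq, mul_assoc]

theorem extDerivModel_const (φ : ExtForm E) (y : E) : extDerivModel (fun _ => φ) y = 0 := by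
  simp [extDerivModel_eq, dirDeriv_const]

theorem extDerivModel_add {F G : E → ExtForm E} {y : E} (hF : DiffVecAt F y)
    (hG : DiffVecAt G y) :
    extDerivModel (fun z => F z + G z) y = extDerivModel F y + extDerivModel G y := by
  simp only [extDerivModel_eq, dirDeriv_add hF hG, mul_add, Finset.sum_add_distrib]

theorem extDerivModel_sum {ι : Type*} {F : ι → E → ExtForm E} {t : Finset ι} {y : E}
    (hF : ∀ i ∈ t, DiffVecAt (F i) y) :
    extDerivModel (fun z => ∑ i ∈ t, F i z) y = ∑ i ∈ t, extDerivModel (F i) y := by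
  classical
  induction t using Finset.induction_on with
  | empty => simpa using extDerivModel_const 0 y
  | insert i t hi ih =>
    simp only [Finset.sum_insert hi]
    rw [extDerivModel_add (hF i (by simp)) (DiffVecAt.sum fun j hj => hF j (by simp [hj])),
      ih fun j hj => hF j (by simp [hj])]

theorem extDerivModel_const_smul {F : E → ExtForm E} {y : E} (hF : DiffVecAt F y) (c : ℂ) :
    extDerivModel (fun z => c • F z) y = c • extDerivModel F y := by
  simp only [extDerivModel_eq, Finset.smul_sum]
  refine Finset.sum_congr rfl fun i _ => ?_
  have := dirDeriv_map hF (Module.finBasis ℝ E i) (c • LinearMap.id : ExtForm E →ₗ[ℂ] ExtForm E)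
  simp only [LinearMap.smul_apply, LinearMap.id_apply] at this
  rw [this, mul_smul_comm]

/-- `d` raises the degree by one, so applying it before scaling gains one factor `c`. -/
theorem smul_extDerivModel_scale {F : E → ExtForm E} {y : E} (hF : DiffVecAt F y) (c : ℂ) :
    c • extDerivModel (fun z => scale c (F z)) y = scale c (extDerivModel F y) := by
  simp only [extDerivModel_eq, map_sum, map_mul, scale_ι, Finset.smul_sum]
  refine Finset.sum_congr rfl fun i _ => ?_
  rw [smul_mul_assoc]
  congr 2
  exact dirDeriv_map hF (Module.finBasis ℝ E i) (scale c : ExtForm E →ₐ[ℂ] ExtForm E).toLinearMap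

theorem extDerivModel_algebraMap {f : E → ℂ} {y : E} (hf : DifferentiableAt ℝ f y) :
    extDerivModel (fun z => algebraMap ℂ (ExtForm E) (f z)) y =
      ExteriorAlgebra.ι ℂ (covectorOf (fderiv ℝ f y).toLinearMap) := by
  rw [extDerivModel_eq, covectorOf_eq_sum, map_sum]
  refine Finset.sum_congr rfl fun i _ => ?_
  rw [dirDeriv_algebraMap hf, map_smul, Algebra.algebraMap_eq_smul_one, mul_smul_comm, mul_one]
  rfl

theorem extDerivModel_smul {f : E → ℂ} {G : E → ExtForm E} {y : E} (hf : DifferentiableAt ℝ f y)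
    (hG : DiffVecAt G y) : extDerivModel (fun z => f z • G z) y =
      ExteriorAlgebra.ι ℂ (covectorOf (fderiv ℝ f y).toLinearMap) * G y +
        f y • extDerivModel G y := by
  have h : DiffVecAt (fun z => algebraMap ℂ (ExtForm E) (f z)) y := fun l => by
    simpa only [Algebra.algebraMap_eq_smul_one, map_smul, smul_eq_mul] using hf.mul_const _
  have h1 := extDerivModel_mul h hG
  rw [extDerivModel_algebraMap hf, AlgHom.commutes] at h1
  simpa only [← Algebra.smul_def] using h1

/-- This is `d (dh) = 0`: the second derivative is symmetric and the wedge of two covectors is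
antisymmetric. -/
theorem extDerivModel_fderiv {h : E → ℂ} {y : E} (hh : ContDiffAt ℝ 2 h y) :
    extDerivModel (fun z => ExteriorAlgebra.ι ℂ (covectorOf (fderiv ℝ h z).toLinearMap)) y = 0 := by
  set b := Module.finBasis ℝ E
  have hd : DifferentiableAt ℝ (fderiv ℝ h) y :=
    (hh.fderiv_right (m := 1) (by norm_num)).differentiableAt (by simp)
  have hF (i : Fin (Module.finrank ℝ E)) (v : E) :
      fderiv ℝ (fun z => fderiv ℝ h z (b i)) y v = fderiv ℝ (fderiv ℝ h) y v (b i) := by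
    rw [fderiv_clm_apply hd (differentiableAt_const _)]
    simp
  have hdi (i : Fin (Module.finrank ℝ E)) : DifferentiableAt ℝ (fun z => fderiv ℝ h z (b i)) y :=
    hd.clm_apply (differentiableAt_const _)
  have hsymm : IsSymmSndFDerivAt ℝ h y := hh.isSymmSndFDerivAt (by simp)
  have hF0 : DiffVecAt
      (fun z => ExteriorAlgebra.ι ℂ (covectorOf (fderiv ℝ h z).toLinearMap)) y := by
    intro l
    simp only [covectorOf_eq_sum, map_sum, map_smul, smul_eq_mul]
    exact DifferentiableAt.fun_sum fun i _ => (hdi i).mul_const _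
  have hdir (v : E) : dirDeriv
      (fun z => ExteriorAlgebra.ι ℂ (covectorOf (fderiv ℝ h z).toLinearMap)) y v =
        ∑ j, fderiv ℝ (fderiv ℝ h) y v (b j) • ExteriorAlgebra.ι ℂ (dx E j) := by
    refine eq_of_dual fun l => ?_
    rw [dual_dirDeriv hF0]
    simp only [covectorOf_eq_sum, map_sum, map_smul, smul_eq_mul, ContinuousLinearMap.coe_coe]
    rw [fderiv_fun_sum fun i _ => DifferentiableAt.mul_const (hdi i) _,
      sum_apply]
    refine Finset.sum_congr rfl fun i _ => ?_
    rw [fderiv_mul_const (hdi i)]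
    simp [hF, mul_comm]
  rw [extDerivModel_eq]
  simp only [hdir, Finset.mul_sum, mul_smul_comm]
  set S := ∑ i, ∑ j, fderiv ℝ (fderiv ℝ h) y (b i) (b j) •
    (ExteriorAlgebra.ι ℂ (dx E i) * ExteriorAlgebra.ι ℂ (dx E j)) with hS
  -- Exchange the two summation indices.
  have h1 : S = -S := by
    conv_lhs => rw [hS, Finset.sum_comm]
    rw [hS, ← Finset.sum_neg_distrib]
    refine Finset.sum_congr rfl fun i _ => ?_
    rw [← Finset.sum_neg_distrib]
    refine Finset.sum_congr rfl fun j _ => ?_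
    rw [hsymm (b j) (b i), ← smul_neg,
      eq_neg_of_add_eq_zero_left (ExteriorAlgebra.ι_add_mul_swap (R := ℂ) (dx E j) (dx E i))]
  have h2 : (2 : ℂ) • S = 0 := by
    rw [two_smul]
    nth_rewrite 1 [h1]
    simp
  simpa using h2

theorem diffVecAt_pullback_const {g : E → E} {y : E} (hg : ContDiffAt ℝ 2 g y) (φ : ExtForm E) :
    DiffVecAt (fun z => pullback (fderiv ℝ g z).toLinearMap φ) y := by
  have hd : DifferentiableAt ℝ (fderiv ℝ g) y :=
    (hg.fderiv_right (m := 1) (by norm_num)).differentiableAt (by simp)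
  induction φ using extForm_induction with
  | hc c =>
    simp only [AlgHom.commutes]
    exact fun l => differentiableAt_const _
  | ha φ ψ hφ hψ =>
    intro l
    simp only [map_add]
    exact (hφ l).add (hψ l)
  | hm α φ hφ =>
    simp only [map_mul]
    refine DiffVecAt.mul (fun l => ?_) hφ
    rw [← covectorOf_covectorRestrict α]
    simp only [pullback_covectorOf]
    simp only [covectorOf_eq_sum, map_sum, map_smul, smul_eq_mul]
    refine DifferentiableAt.fun_sum fun i _ => DifferentiableAt.mul_const ?_ _
    exact (LinearMap.toContinuousLinearMap (covectorRestrict α)).differentiableAt.comp y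
      (hd.clm_apply (differentiableAt_const _))

/-- A constant form is built from constant covectors, and the pullback of a constant covector `α` is
the differential of `α ∘ g`, hence closed. -/
theorem extDerivModel_pullback_const {g : E → E} {y : E} (hg : ContDiffAt ℝ 2 g y)
    (φ : ExtForm E) :
    extDerivModel (fun z => pullback (fderiv ℝ g z).toLinearMap φ) y = 0 := by
  induction φ using extForm_induction with
  | hc c =>
    simp only [AlgHom.commutes]
    exact extDerivModel_const _ _
  | ha φ ψ hφ hψ =>
    simp only [map_add]
    rw [extDerivModel_add (diffVecAt_pullback_const hg φ) (diffVecAt_pullback_const hg ψ), hφ, hψ,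
      add_zero]
  | hm α φ hφ =>
    simp only [map_mul]
    rw [extDerivModel_mul (diffVecAt_pullback_const hg _) (diffVecAt_pullback_const hg φ), hφ,
      mul_zero, add_zero]
    set a := LinearMap.toContinuousLinearMap (covectorRestrict α) with ha
    have h2 : extDerivModel (fun z => pullback (fderiv ℝ g z).toLinearMap
        (ExteriorAlgebra.ι ℂ α)) y = 0 := by
      rw [← extDerivModel_fderiv (h := fun z => a (g z)) (a.contDiff.contDiffAt.comp y hg)]
      refine extDerivModel_congr ?_
      filter_upwards [hg.eventually (by simp)] with z hz
      conv_lhs => rw [← covectorOf_covectorRestrict α]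
      rw [pullback_covectorOf]
      congr 2
      have := (a.hasFDerivAt.comp z (hz.differentiableAt (by simp)).hasFDerivAt).fderiv
      erw [this]
      rfl
    rw [h2, zero_mul]

/-- The exterior derivative commutes with pullbacks. -/
theorem extDerivModel_pullback {g : E → E} {y : E} (hg : ContDiffAt ℝ 2 g y) {F : E → ExtForm E}
    (hF : DiffVecAt F (g y)) :
    extDerivModel (fun z => pullback (fderiv ℝ g z).toLinearMap (F (g z))) y =
      pullback (fderiv ℝ g y).toLinearMap (extDerivModel F (g y)) := by
  have hgd : DifferentiableAt ℝ g y := hg.differentiableAt (by simp)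
  have hd (S : Finset (Fin (Module.finrank ℝ E))) :
      DifferentiableAt ℝ (fun z => (dxBasis E).coord S (F z)) (g y) := hF _
  have hc (S : Finset (Fin (Module.finrank ℝ E))) :
      DifferentiableAt ℝ (fun z => (dxBasis E).coord S (F (g z))) y := (hd S).comp y hgd
  -- Since the pullbacks of the `dx^S` are closed, only the coefficients get differentiated, and for
  -- them the claim is the chain rule.
  have h1 : F = fun z => ∑ S, (dxBasis E).coord S (F z) • dxBasis E S :=
    funext fun z => ((dxBasis E).sum_repr (F z)).symm
  have h2 : extDerivModel F (g y) = ∑ S, ExteriorAlgebra.ι ℂ (covectorOf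
      (fderiv ℝ (fun z => (dxBasis E).coord S (F z)) (g y)).toLinearMap) * dxBasis E S := by
    conv_lhs => rw [h1]
    rw [extDerivModel_sum (F := fun S z => (dxBasis E).coord S (F z) • dxBasis E S)
      fun S _ => DiffVecAt.smul (hd S) fun l => differentiableAt_const _]
    refine Finset.sum_congr rfl fun S _ => ?_
    rw [extDerivModel_smul (hd S) fun l => differentiableAt_const _, extDerivModel_const, smul_zero,
      add_zero]
  have h3 : (fun z => pullback (fderiv ℝ g z).toLinearMap (F (g z))) = fun z => ∑ S,
      (dxBasis E).coord S (F (g z)) • pullback (fderiv ℝ g z).toLinearMap (dxBasis E S) := by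
    funext z
    conv_lhs => rw [← (dxBasis E).sum_repr (F (g z))]
    simp only [map_sum, map_smul, Module.Basis.coord_apply]
  rw [h2, h3, extDerivModel_sum fun S _ => DiffVecAt.smul (hc S) (diffVecAt_pullback_const hg _),
    map_sum]
  refine Finset.sum_congr rfl fun S _ => ?_
  rw [extDerivModel_smul (hc S) (diffVecAt_pullback_const hg _), extDerivModel_pullback_const hg,
    smul_zero, add_zero, map_mul, pullback_covectorOf]
  congr 3
  exact congrArg ContinuousLinearMap.toLinearMap
    ((hd S).hasFDerivAt.comp y hgd.hasFDerivAt).fderiv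

theorem SmoothVecOn.extDerivModel {F : E → ExtForm E} {s : Set E} (hs : IsOpen s)
    (hF : SmoothVecOn F s) : SmoothVecOn (extDerivModel F) s := by
  refine SmoothVecOn.sum fun i _ => SmoothVecOn.sum fun S _ =>
    SmoothVecOn.smul ?_ (smoothVecOn_const _)
  exact ((hF ((dxBasis E).coord S)).fderiv_of_isOpen hs (m := ∞) (by simp)).clm_apply
    contDiffOn_const

end Calculus

/-! ### Charts -/

section Charts

variable {E : Type*} [NormedAddCommGroup E] [NormedSpace ℝ E]
variable {M : Type*} [TopologicalSpace M] [ChartedSpace E M]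

variable (E) in
/-- The change of charts from the preferred chart at `x₁` to the preferred chart at `x₀`. -/
def chartChange (x₀ x₁ : M) (y : E) : E :=
  extChartAt 𝓘(ℝ, E) x₀ ((extChartAt 𝓘(ℝ, E) x₁).symm y)

theorem chartAt_mem_source {x₀ x : M} (hx : x ∈ (extChartAt 𝓘(ℝ, E) x₀).source) :
    x ∈ (chartAt E x₀).source := by
  rwa [← extChartAt_source 𝓘(ℝ, E)]

theorem exists_eq_symm {x₀ x : M} (hx : x ∈ (extChartAt 𝓘(ℝ, E) x₀).source) :
    ∃ y ∈ (extChartAt 𝓘(ℝ, E) x₀).target, (extChartAt 𝓘(ℝ, E) x₀).symm y = x ∧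
      extChartAt 𝓘(ℝ, E) x₀ x = y :=
  ⟨extChartAt 𝓘(ℝ, E) x₀ x, (extChartAt 𝓘(ℝ, E) x₀).map_source hx,
    (extChartAt 𝓘(ℝ, E) x₀).left_inv hx, rfl⟩

theorem target_mem_nhds {x₀ : M} {y : E} (hy : y ∈ (extChartAt 𝓘(ℝ, E) x₀).target) :
    (extChartAt 𝓘(ℝ, E) x₀).target ∈ nhds y :=
  (isOpen_extChartAt_target x₀).mem_nhds hy

variable (E) in
/-- The domain of `chartChange E x₀ x₁`. -/
def chartChangeDomain (x₀ x₁ : M) : Set E :=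
  (extChartAt 𝓘(ℝ, E) x₁).target ∩
    (extChartAt 𝓘(ℝ, E) x₁).symm ⁻¹' (extChartAt 𝓘(ℝ, E) x₀).source

theorem isOpen_chartChangeDomain (x₀ x₁ : M) : IsOpen (chartChangeDomain E x₀ x₁) :=
  (continuousOn_extChartAt_symm x₁).isOpen_inter_preimage (isOpen_extChartAt_target x₁)
    (isOpen_extChartAt_source x₀)

theorem chartChange_mem_target {x₀ x₁ : M} {y : E} (hy : y ∈ chartChangeDomain E x₀ x₁) :
    chartChange E x₀ x₁ y ∈ (extChartAt 𝓘(ℝ, E) x₀).target :=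
  (extChartAt 𝓘(ℝ, E) x₀).map_source hy.2

variable [IsManifold 𝓘(ℝ, E) ∞ M]

theorem contDiffOn_chartChange (x₀ x₁ : M) :
    ContDiffOn ℝ ∞ (chartChange E x₀ x₁) (chartChangeDomain E x₀ x₁) := by
  have := contDiffOn_ext_coord_change (I := 𝓘(ℝ, E)) (n := ∞) x₀ x₁
  rwa [PartialEquiv.trans_source, PartialEquiv.symm_source] at this

theorem isManifold_one : IsManifold 𝓘(ℝ, E) 1 M := IsManifold.of_le (n := ∞) (by simp)

theorem chartDeriv_comp_chartSymmDeriv {x₀ : M} {y : E}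
    (hy : y ∈ (extChartAt 𝓘(ℝ, E) x₀).target) :
    chartDeriv E x₀ ((extChartAt 𝓘(ℝ, E) x₀).symm y) ∘ₗ chartSymmDeriv E x₀ y = LinearMap.id := by
  have := isManifold_one (E := E) (M := M)
  have h := mfderiv_extChartAt_comp_mfderivWithin_extChartAt_symm (I := 𝓘(ℝ, E)) hy
  rw [ModelWithCorners.Boundaryless.range_eq_univ, mfderivWithin_univ] at h
  ext v
  exact congrArg (fun L => L v) h

theorem chartSymmDeriv_comp_chartDeriv {x₀ : M} {y : E}
    (hy : y ∈ (extChartAt 𝓘(ℝ, E) x₀).target) :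
    chartSymmDeriv E x₀ y ∘ₗ chartDeriv E x₀ ((extChartAt 𝓘(ℝ, E) x₀).symm y) = LinearMap.id := by
  have := isManifold_one (E := E) (M := M)
  have h := mfderivWithin_extChartAt_symm_comp_mfderiv_extChartAt (I := 𝓘(ℝ, E)) hy
  rw [ModelWithCorners.Boundaryless.range_eq_univ, mfderivWithin_univ] at h
  ext v
  exact congrArg (fun L => L v) h

/-- Brings tangent maps of the manifold down to Fréchet derivatives on `E`, so that the naturality
of `extDerivModel` applies to changes of charts. -/
theorem chartDeriv_comp_chartSymmDeriv_eq_fderiv {x₀ x₁ : M} {y : E}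
    (hy : y ∈ chartChangeDomain E x₀ x₁) :
    chartDeriv E x₀ ((extChartAt 𝓘(ℝ, E) x₁).symm y) ∘ₗ chartSymmDeriv E x₁ y =
      (fderiv ℝ (chartChange E x₀ x₁) y).toLinearMap := by
  have := isManifold_one (E := E) (M := M)
  have h1 : MDifferentiableAt 𝓘(ℝ, E) 𝓘(ℝ, E) (extChartAt 𝓘(ℝ, E) x₁).symm y := by
    have := mdifferentiableWithinAt_extChartAt_symm (I := 𝓘(ℝ, E)) hy.1
    rwa [ModelWithCorners.Boundaryless.range_eq_univ, mdifferentiableWithinAt_univ] at this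
  have h2 := mdifferentiableAt_extChartAt (I := 𝓘(ℝ, E)) (chartAt_mem_source hy.2)
  have h3 := mfderiv_comp y h2 h1
  rw [mfderiv_eq_fderiv] at h3
  ext v
  exact (congrArg (fun L => L v) h3).symm

theorem fderiv_chartChange_comp {x₀ x₁ x : M} (h₀ : x ∈ (extChartAt 𝓘(ℝ, E) x₀).source)
    (h₁ : x ∈ (extChartAt 𝓘(ℝ, E) x₁).source) :
    (fderiv ℝ (chartChange E x₀ x₁) (extChartAt 𝓘(ℝ, E) x₁ x)).toLinearMap ∘ₗ chartDeriv E x₁ x =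
      chartDeriv E x₀ x := by
  obtain ⟨y, hy, rfl, -⟩ := exists_eq_symm h₁
  rw [(extChartAt 𝓘(ℝ, E) x₁).right_inv hy, ← chartDeriv_comp_chartSymmDeriv_eq_fderiv ⟨hy, h₀⟩,
    LinearMap.comp_assoc, chartSymmDeriv_comp_chartDeriv hy, LinearMap.comp_id]

theorem mem_chartChangeDomain {x₀ x₁ x : M} (h₀ : x ∈ (extChartAt 𝓘(ℝ, E) x₀).source)
    (h₁ : x ∈ (extChartAt 𝓘(ℝ, E) x₁).source) :
    extChartAt 𝓘(ℝ, E) x₁ x ∈ chartChangeDomain E x₀ x₁ := by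
  obtain ⟨y, hy, rfl, h⟩ := exists_eq_symm h₁
  rw [h]
  exact ⟨hy, h₀⟩

end Charts

/-! ### Forms in charts -/

section Forms

variable {E : Type*} [NormedAddCommGroup E] [NormedSpace ℝ E] [FiniteDimensional ℝ E]
variable {M : Type*} [TopologicalSpace M] [ChartedSpace E M] [IsManifold 𝓘(ℝ, E) ∞ M]

theorem RawForm.eq_pullback_inChart (φ : RawForm E M) {x₀ x : M}
    (hx : x ∈ (extChartAt 𝓘(ℝ, E) x₀).source) :
    φ x = pullback (chartDeriv E x₀ x) (φ.inChart x₀ (extChartAt 𝓘(ℝ, E) x₀ x)) := by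
  obtain ⟨y, hy, rfl, h⟩ := exists_eq_symm hx
  rw [h, RawForm.inChart, pullback_comp_apply, chartSymmDeriv_comp_chartDeriv hy, pullback_id]

theorem pullback_chartSymmDeriv_chartDeriv {x₀ : M} {y : E}
    (hy : y ∈ (extChartAt 𝓘(ℝ, E) x₀).target) (ξ : ExtForm E) :
    pullback (chartSymmDeriv E x₀ y)
      (pullback (chartDeriv E x₀ ((extChartAt 𝓘(ℝ, E) x₀).symm y)) ξ) = ξ := by
  rw [pullback_comp_apply, chartDeriv_comp_chartSymmDeriv hy, pullback_id]

theorem RawForm.inChart_eq_chartChange (φ : RawForm E M) {x₀ x₁ : M} {y : E}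
    (hy : y ∈ chartChangeDomain E x₀ x₁) :
    φ.inChart x₁ y = pullback (fderiv ℝ (chartChange E x₀ x₁) y).toLinearMap
      (φ.inChart x₀ (chartChange E x₀ x₁ y)) := by
  rw [← chartDeriv_comp_chartSymmDeriv_eq_fderiv hy, ← pullback_comp_apply]
  exact congrArg _ (φ.eq_pullback_inChart hy.2)

theorem contDiffAt_chartChange {x₀ x₁ : M} {y : E} (hy : y ∈ chartChangeDomain E x₀ x₁) :
    ContDiffAt ℝ ∞ (chartChange E x₀ x₁) y :=
  (contDiffOn_chartChange x₀ x₁).contDiffAt ((isOpen_chartChangeDomain x₀ x₁).mem_nhds hy)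

theorem RawForm.Smooth.diffVecAt {φ : RawForm E M} (hφ : φ.Smooth) {x₀ : M} {y : E}
    (hy : y ∈ (extChartAt 𝓘(ℝ, E) x₀).target) : DiffVecAt (φ.inChart x₀) y :=
  (hφ x₀).diffVecAt (target_mem_nhds hy)

/-- The exterior derivative can be computed in any chart. -/
theorem exteriorDer_eq {φ : RawForm E M} (hφ : φ.Smooth) {x₀ x : M}
    (hx : x ∈ (extChartAt 𝓘(ℝ, E) x₀).source) :
    exteriorDer φ x = pullback (chartDeriv E x₀ x)
      (extDerivModel (φ.inChart x₀) (extChartAt 𝓘(ℝ, E) x₀ x)) := by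
  have hx' : x ∈ (extChartAt 𝓘(ℝ, E) x).source := mem_extChartAt_source x
  have hy := mem_chartChangeDomain hx hx'
  -- The definition uses the chart at the point itself; near that point it differs from the chart at
  -- `x₀` by a pullback along a smooth map, which commutes with `d`.
  have h1 : φ.inChart x =ᶠ[nhds (extChartAt 𝓘(ℝ, E) x x)]
      fun y => pullback (fderiv ℝ (chartChange E x₀ x) y).toLinearMap
        (φ.inChart x₀ (chartChange E x₀ x y)) := by
    filter_upwards [(isOpen_chartChangeDomain x₀ x).mem_nhds hy] with y hy
    exact φ.inChart_eq_chartChange hy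
  have h2 : chartChange E x₀ x (extChartAt 𝓘(ℝ, E) x x) = extChartAt 𝓘(ℝ, E) x₀ x := by
    rw [chartChange, (extChartAt 𝓘(ℝ, E) x).left_inv hx']
  rw [exteriorDer, extDerivModel_congr h1, extDerivModel_pullback
    ((contDiffAt_chartChange hy).of_le (by norm_cast))
    (hφ.diffVecAt (chartChange_mem_target hy)), pullback_comp_apply, fderiv_chartChange_comp hx hx',
    h2]

/-- Since `exteriorDer` changes the chart with the point, its smoothness becomes visible only in one
fixed chart. -/
theorem exteriorDer_inChart {φ : RawForm E M} (hφ : φ.Smooth) {x₀ : M} {y : E}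
    (hy : y ∈ (extChartAt 𝓘(ℝ, E) x₀).target) :
    (exteriorDer φ).inChart x₀ y = extDerivModel (φ.inChart x₀) y := by
  rw [RawForm.inChart, exteriorDer_eq hφ ((extChartAt 𝓘(ℝ, E) x₀).map_target hy),
    pullback_chartSymmDeriv_chartDeriv hy, (extChartAt 𝓘(ℝ, E) x₀).right_inv hy]

theorem RawForm.Smooth.exteriorDer {φ : RawForm E M} (hφ : φ.Smooth) :
    (exteriorDer φ).Smooth := fun x₀ =>
  (SmoothVecOn.extDerivModel (isOpen_extChartAt_target x₀) (hφ x₀)).congr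
    fun _ hy => exteriorDer_inChart hφ hy

/-- The expression of an almost complex structure in the preferred chart at `x₀`. -/
def AlmostComplexStructure.inChart (J : AlmostComplexStructure E M) (x₀ : M) (y : E) : E →ₗ[ℝ] E :=
  chartDeriv E x₀ ((extChartAt 𝓘(ℝ, E) x₀).symm y) ∘ₗ
    J.toEnd ((extChartAt 𝓘(ℝ, E) x₀).symm y) ∘ₗ chartSymmDeriv E x₀ y

theorem proj_inChart (J : AlmostComplexStructure E M) (a b : ℤ) (φ : RawForm E M) {x₀ : M} {y : E}
    (hy : y ∈ (extChartAt 𝓘(ℝ, E) x₀).target) :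
    (J.proj a b φ).inChart x₀ y = bidegProj (J.inChart x₀ y) a b (φ.inChart x₀ y) := by
  refine pullback_bidegProj ?_ a b _
  rw [AlmostComplexStructure.inChart, ← LinearMap.comp_assoc, chartSymmDeriv_comp_chartDeriv hy,
    LinearMap.id_comp]

theorem RawForm.Smooth.proj {φ : RawForm E M} (hφ : φ.Smooth) (J : AlmostComplexStructure E M)
    (a b : ℤ) : (J.proj a b φ).Smooth := fun x₀ =>
  (SmoothVecOn.bidegProj (J := J.inChart x₀) (J.smooth x₀) a b (hφ x₀)).congr
    fun _ hy => proj_inChart J a b φ hy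

theorem interiorDer_inChart (K : RawVecForm E M) (φ : RawForm E M) {x₀ : M} {y : E}
    (hy : y ∈ (extChartAt 𝓘(ℝ, E) x₀).target) :
    (interiorDer K φ).inChart x₀ y = interiorMap (K.inChart x₀ y) (φ.inChart x₀ y) :=
  (pullback_interiorMap _ _ (chartSymmDeriv_comp_chartDeriv hy) _ _).symm

theorem RawForm.Smooth.interiorDer {φ : RawForm E M} (hφ : φ.Smooth) {K : RawVecForm E M}
    (hK : K.Smooth) : (interiorDer K φ).Smooth := fun x₀ =>
  (SmoothVecOn.bilin interiorMap (hK x₀) (hφ x₀)).congr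
    fun _ hy => interiorDer_inChart K φ hy

/-- The form that multiplies covectors by `c`. -/
def RawForm.scale (c : ℂ) (φ : RawForm E M) : RawForm E M := fun x => AlmostComplex.scale c (φ x)

theorem RawForm.Smooth.scale {φ : RawForm E M} (hφ : φ.Smooth) (c : ℂ) : (φ.scale c).Smooth :=
  fun x₀ => ((hφ x₀).map (AlmostComplex.scale c : ExtForm E →ₐ[ℂ] ExtForm E).toLinearMap).congr
    fun _ _ => pullback_scale _ c _

theorem RawForm.scale_inChart (c : ℂ) (φ : RawForm E M) (x₀ : M) (y : E) :
    (φ.scale c).inChart x₀ y = AlmostComplex.scale c (φ.inChart x₀ y) :=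
  pullback_scale _ c _

/-- Smoothness of forms can be checked locally, in any charts. -/
theorem RawForm.smooth_of_locally {φ : RawForm E M}
    (h : ∀ x, ∃ x₀, x ∈ (extChartAt 𝓘(ℝ, E) x₀).source ∧
      ∃ t ∈ nhds (extChartAt 𝓘(ℝ, E) x₀ x), SmoothVecOn (φ.inChart x₀) t) : φ.Smooth := by
  intro x₁
  refine smoothVecOn_of_locally fun y hy => ?_
  obtain ⟨x₀, hx₀, t, ht, hφ⟩ := h ((extChartAt 𝓘(ℝ, E) x₁).symm y)
  obtain ⟨t', ht', ht'o, hyt'⟩ := mem_nhds_iff.mp ht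
  have hy' : y ∈ chartChangeDomain E x₀ x₁ := ⟨hy, hx₀⟩
  have ho := (contDiffOn_chartChange x₀ x₁).continuousOn.isOpen_inter_preimage
    (isOpen_chartChangeDomain x₀ x₁) ht'o
  refine ⟨_, ho.mem_nhds ⟨hy', hyt'⟩, ?_⟩
  have hA (v : E) : ContDiffOn ℝ ∞ (fun y => (fderiv ℝ (chartChange E x₀ x₁) y).toLinearMap v)
      (chartChangeDomain E x₀ x₁) :=
    ((contDiffOn_chartChange x₀ x₁).fderiv_of_isOpen (isOpen_chartChangeDomain x₀ x₁)
      (m := ∞) (by simp)).clm_apply contDiffOn_const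
  -- On the overlap, the expression in one chart is the pullback of the other along the smooth
  -- change of charts.
  refine (SmoothVecOn.pullback (fun v => (hA v).mono Set.inter_subset_left)
    ((hφ.mono ht').comp ((contDiffOn_chartChange x₀ x₁).mono Set.inter_subset_left)
      fun z hz => hz.2)).congr fun z hz => ?_
  exact φ.inChart_eq_chartChange hz.1

theorem symm_tendsto {x₀ x : M} (hx : x ∈ (extChartAt 𝓘(ℝ, E) x₀).source) :
    Filter.Tendsto (extChartAt 𝓘(ℝ, E) x₀).symm (nhds (extChartAt 𝓘(ℝ, E) x₀ x)) (nhds x) := by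
  have := continuousAt_extChartAt_symm' (I := 𝓘(ℝ, E)) hx
  rwa [ContinuousAt, (extChartAt 𝓘(ℝ, E) x₀).left_inv hx] at this

/-- A form that agrees locally with smooth forms is smooth. -/
theorem RawForm.smooth_of_eventuallyEq {φ : RawForm E M}
    (h : ∀ x, ∃ ψ : RawForm E M, ψ.Smooth ∧ ∀ᶠ z in nhds x, φ z = ψ z) : φ.Smooth := by
  refine RawForm.smooth_of_locally fun x => ⟨x, mem_extChartAt_source x, ?_⟩
  obtain ⟨ψ, hψ, heq⟩ := h x
  have h1 := (symm_tendsto (mem_extChartAt_source (I := 𝓘(ℝ, E)) x)).eventually heq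
  refine ⟨_, Filter.inter_mem h1 (extChartAt_target_mem_nhds (I := 𝓘(ℝ, E)) x), ?_⟩
  refine ((hψ x).mono Set.inter_subset_right).congr fun y hy => ?_
  exact congrArg _ hy.1

end Forms

/-! ### Projections onto types commute with scaling. -/

section ScaleProj

variable {V : Type*} [AddCommGroup V] [Module ℝ V]

theorem bidegProj_scale (J : V →ₗ[ℝ] V) (a b : ℤ) (c : ℂ) (φ : ExtForm V) :
    bidegProj J a b (scale c φ) = scale c (bidegProj J a b φ) := by
  induction φ using extForm_induction generalizing a b with
  | hc r =>
    rw [scale_algebraMap, bidegProj_algebraMap]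
    split_ifs <;> simp
  | ha x y hx hy => simp only [map_add, hx, hy]
  | hm α x hx =>
    simp only [map_mul, scale_ι, smul_mul_assoc, map_smul, bidegProj_ι_mul, hx, map_add, smul_add]

end ScaleProj

/-! ### The Leibniz rule for graded commutators. -/

section Algebra

variable {A : Type*} [Ring A] [Algebra ℂ A]

theorem leibniz_sub (c : ℂ) (x x' y y' ξ η : A) :
    x * η + c • (ξ * y) - (x' * η + c • (ξ * y')) = (x - x') * η + c • (ξ * (y - y')) := by
  simp only [sub_mul, mul_sub, smul_sub]
  abel

/-- `σ c` and `σ (-1)` carry the signs of `i` and `d`. In the expansion the terms in which one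
operator hits `ξ` and the other hits `η` cancel by `hσi`, `hσd` and `c * c = 1`; the remaining sign
is the product, as degrees add. -/
theorem leibniz_commutator {c : ℂ} (hc : c * c = 1) (i d : A →ₗ[ℂ] A) (σ : ℂ → A →ₗ[ℂ] A)
    (hσ : ∀ a b ξ, σ a (σ b ξ) = σ (a * b) ξ)
    (hi : ∀ ξ η, i (ξ * η) = i ξ * η + σ c ξ * i η)
    (hd : ∀ ξ η, d (ξ * η) = d ξ * η + σ (-1) ξ * d η)
    (hσi : ∀ ξ, σ (-1) (i ξ) = c • i (σ (-1) ξ)) (hσd : ∀ ξ, c • d (σ c ξ) = σ c (d ξ)) (ξ η : A) :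
    (i ∘ₗ d - c • (d ∘ₗ i)) (ξ * η) =
      (i ∘ₗ d - c • (d ∘ₗ i)) ξ * η + σ (c * -1) ξ * (i ∘ₗ d - c • (d ∘ₗ i)) η := by
  simp only [LinearMap.sub_apply, LinearMap.comp_apply, LinearMap.smul_apply, hd, hi, map_add, hσi,
    hσ, sub_mul, mul_sub, smul_add, smul_mul_assoc, mul_smul_comm, smul_smul, hc, one_smul]
  rw [← hσd, mul_comm (-1) c, smul_mul_assoc]
  abel

end Algebra

section Operators

variable {E : Type*} [NormedAddCommGroup E] [NormedSpace ℝ E] [FiniteDimensional ℝ E]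
variable {M : Type*} [TopologicalSpace M] [ChartedSpace E M] [IsManifold 𝓘(ℝ, E) ∞ M]

/-! ### The operators on smooth forms -/

theorem center_mem_target (x : M) :
    extChartAt 𝓘(ℝ, E) x x ∈ (extChartAt 𝓘(ℝ, E) x).target := mem_extChartAt_target x

theorem RawForm.inChart_add (φ ψ : RawForm E M) (x₀ : M) :
    (φ + ψ).inChart x₀ = fun y => φ.inChart x₀ y + ψ.inChart x₀ y :=
  funext fun y => map_add (pullback (chartSymmDeriv E x₀ y)) _ _

theorem RawForm.inChart_mul (φ ψ : RawForm E M) (x₀ : M) :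
    (φ * ψ).inChart x₀ = fun y => φ.inChart x₀ y * ψ.inChart x₀ y :=
  funext fun y => map_mul (pullback (chartSymmDeriv E x₀ y)) _ _

theorem RawForm.inChart_smul (c : ℂ) (φ : RawForm E M) (x₀ : M) :
    (c • φ).inChart x₀ = fun y => c • φ.inChart x₀ y :=
  funext fun y => map_smul (pullback (chartSymmDeriv E x₀ y)) _ _

theorem exteriorDer_add {φ ψ : RawForm E M} (hφ : φ.Smooth) (hψ : ψ.Smooth) :
    exteriorDer (φ + ψ) = exteriorDer φ + exteriorDer ψ := by
  funext x
  rw [exteriorDer, RawForm.inChart_add, extDerivModel_add (hφ.diffVecAt (center_mem_target x))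
    (hψ.diffVecAt (center_mem_target x)), map_add]
  rfl

theorem exteriorDer_smul (c : ℂ) {φ : RawForm E M} (hφ : φ.Smooth) :
    exteriorDer (c • φ) = c • exteriorDer φ := by
  funext x
  rw [exteriorDer, RawForm.inChart_smul,
    extDerivModel_const_smul (hφ.diffVecAt (center_mem_target x)), map_smul]
  rfl

theorem exteriorDer_mul {φ ψ : RawForm E M} (hφ : φ.Smooth) (hψ : ψ.Smooth) :
    exteriorDer (φ * ψ) = exteriorDer φ * ψ + φ.scale (-1) * exteriorDer ψ := by
  funext x
  have h1 := RawForm.eq_pullback_inChart φ (mem_extChartAt_source (I := 𝓘(ℝ, E)) x)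
  have h2 := RawForm.eq_pullback_inChart ψ (mem_extChartAt_source (I := 𝓘(ℝ, E)) x)
  rw [exteriorDer, RawForm.inChart_mul, extDerivModel_mul (hφ.diffVecAt (center_mem_target x))
    (hψ.diffVecAt (center_mem_target x)), map_add, map_mul, map_mul, ← h2, pullback_scale, ← h1]
  rfl

theorem smul_exteriorDer_scale (c : ℂ) {φ : RawForm E M} (hφ : φ.Smooth) :
    c • exteriorDer (φ.scale c) = (exteriorDer φ).scale c := by
  funext x
  have h : (φ.scale c).inChart x = fun y => scale c (φ.inChart x y) :=
    funext fun y => φ.scale_inChart c x y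
  change c • pullback _ (extDerivModel _ _) = scale c (pullback _ _)
  rw [h, ← map_smul, smul_extDerivModel_scale (hφ.diffVecAt (center_mem_target x)), pullback_scale]

variable (E M) in
/-- The exterior derivative of smooth forms. -/
def formD : Form E M →ₗ[ℂ] Form E M where
  toFun φ := ⟨exteriorDer φ.1, RawForm.Smooth.exteriorDer φ.2⟩
  map_add' φ ψ := Subtype.ext (exteriorDer_add φ.2 ψ.2)
  map_smul' c φ := Subtype.ext (exteriorDer_smul c φ.2)

variable (E M) in
/-- The automorphism of the smooth forms that multiplies forms of degree `k` by `c ^ k`. -/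
def formScale (c : ℂ) : Form E M →ₗ[ℂ] Form E M where
  toFun φ := ⟨φ.1.scale c, RawForm.Smooth.scale φ.2 c⟩
  map_add' _ _ := Subtype.ext (funext fun _ => map_add (scale c) _ _)
  map_smul' _ _ := Subtype.ext (funext fun _ => map_smul (scale c) _ _)

/-- The interior derivative of smooth forms. -/
def formInterior (K : RawVecForm E M) (hK : K.Smooth) : Form E M →ₗ[ℂ] Form E M where
  toFun φ := ⟨interiorDer K φ.1, RawForm.Smooth.interiorDer φ.2 hK⟩
  map_add' _ _ := Subtype.ext (funext fun _ => map_add (interiorMap _) _ _)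
  map_smul' _ _ := Subtype.ext (funext fun _ => map_smul (interiorMap _) _ _)

variable (J : AlmostComplexStructure E M)

/-- The projection of smooth forms onto their component of type `(a,b)`. -/
def formProj (a b : ℤ) : Form E M →ₗ[ℂ] Form E M where
  toFun φ := ⟨J.proj a b φ.1, RawForm.Smooth.proj φ.2 J a b⟩
  map_add' _ _ := Subtype.ext (funext fun _ => map_add (bidegProj _ a b) _ _)
  map_smul' _ _ := Subtype.ext (funext fun _ => map_smul (bidegProj _ a b) _ _)

/-- The component of type `(u,v)` of the exterior derivative. -/
def formDelta (u v : ℤ) : Form E M →ₗ[ℂ] Form E M :=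
  ∑ p ∈ Finset.range (Module.finrank ℝ E + 1), ∑ q ∈ Finset.range (Module.finrank ℝ E + 1),
    formProj J (p + u) (q + v) ∘ₗ formD E M ∘ₗ formProj J p q

theorem coe_formDelta10 (φ : Form E M) : (formDelta J 1 0 φ).1 = J.del φ.1 := by
  simp only [formDelta, LinearMap.sum_apply, AlmostComplexStructure.del]
  rw [← Subalgebra.coe_val (Form E M), map_sum]
  refine Finset.sum_congr rfl fun p _ => ?_
  rw [map_sum]
  refine Finset.sum_congr rfl fun q _ => ?_
  rw [add_zero]
  rfl

theorem coe_formDelta01 (φ : Form E M) : (formDelta J 0 1 φ).1 = J.delbar φ.1 := by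
  simp only [formDelta, LinearMap.sum_apply, AlmostComplexStructure.delbar]
  rw [← Subalgebra.coe_val (Form E M), map_sum]
  refine Finset.sum_congr rfl fun p _ => ?_
  rw [map_sum]
  refine Finset.sum_congr rfl fun q _ => ?_
  rw [add_zero]
  rfl

variable {J}

theorem mem_bidegForm_iff {a b : ℤ} {φ : Form E M} :
    φ ∈ J.bidegForm a b ↔ formProj J a b φ = φ := by
  refine ⟨fun h => Subtype.ext (funext fun x => bidegProj_of_mem (J.sq_eq x) (h x)), fun h x => ?_⟩
  rw [mem_bidegPart_iff (J.sq_eq x)]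
  exact congrFun (congrArg Subtype.val h) x

theorem formProj_mem (a b : ℤ) (φ : Form E M) : formProj J a b φ ∈ J.bidegForm a b :=
  fun _ => bidegProj_mem a b _

theorem formProj_formProj (a b c d : ℤ) (φ : Form E M) :
    formProj J a b (formProj J c d φ) = if a = c ∧ b = d then formProj J a b φ else 0 := by
  refine Subtype.ext (funext fun x => ?_)
  have := bidegProj_bidegProj (J.sq_eq x) a b c d (φ.1 x)
  split_ifs with h
  · rw [if_pos h] at this
    exact this
  · rw [if_neg h] at this
    exact this

theorem formProj_of_mem {a b c d : ℤ} {φ : Form E M} (hφ : φ ∈ J.bidegForm c d) :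
    formProj J a b φ = if a = c ∧ b = d then φ else 0 := by
  conv_lhs => rw [← mem_bidegForm_iff.mp hφ]
  rw [formProj_formProj]
  split_ifs with h
  · rw [h.1, h.2, mem_bidegForm_iff.mp hφ]
  · rfl

theorem eq_zero_of_mem_bidegForm {a b : ℤ} {φ : Form E M} (hφ : φ ∈ J.bidegForm a b)
    (h : (a < 0 ∨ b < 0) ∨ (Module.finrank ℝ E : ℤ) < a ∨ (Module.finrank ℝ E : ℤ) < b) :
    φ = 0 := by
  refine Subtype.ext (funext fun x => ?_)
  have hx := hφ x
  have hfin : Module.Finite ℝ (TangentSpace 𝓘(ℝ, E) x) := inferInstanceAs (Module.Finite ℝ E)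
  have hbot : bidegPart (J.toEnd x) a b = ⊥ := by
    rcases h with h | h
    · exact bidegPart_eq_bot_of_neg h
    · exact bidegPart_eq_bot h
  rwa [hbot, Submodule.mem_bot] at hx

theorem sum_formProj (φ : Form E M) :
    ∑ p ∈ Finset.range (Module.finrank ℝ E + 1), ∑ q ∈ Finset.range (Module.finrank ℝ E + 1),
      formProj J p q φ = φ := by
  refine Subtype.ext (funext fun x => ?_)
  have hfin : Module.Finite ℝ (TangentSpace 𝓘(ℝ, E) x) := inferInstanceAs (Module.Finite ℝ E)
  have h : ((∑ p ∈ Finset.range (Module.finrank ℝ E + 1),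
      ∑ q ∈ Finset.range (Module.finrank ℝ E + 1), formProj J p q φ : Form E M) : RawForm E M) x =
      ∑ p ∈ Finset.range (Module.finrank ℝ E + 1), ∑ q ∈ Finset.range (Module.finrank ℝ E + 1),
        bidegProj (J.toEnd x) p q (φ.1 x) := by
    simp only [AddSubmonoidClass.coe_finsetSum, Finset.sum_apply]
    rfl
  rw [h]
  exact sum_range_bidegProj (J.toEnd x) (φ.1 x)

variable (J) in
/-- Induction on smooth forms by their components. -/
theorem form_induction {C : Form E M → Prop} (h : ∀ a b, ∀ φ ∈ J.bidegForm a b, C φ)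
    (ha : ∀ φ ψ, C φ → C ψ → C (φ + ψ)) (φ : Form E M) : C φ := by
  have h0 : C 0 := h 0 0 0 (Submodule.zero_mem _)
  rw [← sum_formProj (J := J) φ]
  exact Finset.sum_induction _ C ha h0 fun p _ => Finset.sum_induction _ C ha h0 fun q _ =>
    h p q _ (formProj_mem _ _ _)

/-- One term of the double sum survives. If `(a, b)` is outside the range of summation, the form
itself is zero. -/
theorem formDelta_of_mem (u v : ℤ) {a b : ℤ} {φ : Form E M} (hφ : φ ∈ J.bidegForm a b) :
    formDelta J u v φ = formProj J (a + u) (b + v) (formD E M φ) := by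
  by_cases h : (a < 0 ∨ b < 0) ∨ (Module.finrank ℝ E : ℤ) < a ∨ (Module.finrank ℝ E : ℤ) < b
  · rw [eq_zero_of_mem_bidegForm hφ h]
    simp
  · push Not at h
    obtain ⟨⟨ha, hb⟩, ha', hb'⟩ := h
    lift a to ℕ using ha
    lift b to ℕ using hb
    simp only [formDelta, LinearMap.sum_apply, LinearMap.comp_apply, formProj_of_mem hφ]
    rw [Finset.sum_eq_single a, Finset.sum_eq_single b]
    · simp
    · intro c _ hc
      simp [hc]
    · intro hb
      exact absurd (Finset.mem_range.mpr (by omega)) hb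
    · intro c _ hc
      simp [hc]
    · intro hb
      exact absurd (Finset.mem_range.mpr (by omega)) hb

theorem formD_mul (ξ η : Form E M) :
    formD E M (ξ * η) = formD E M ξ * η + formScale E M (-1) ξ * formD E M η :=
  Subtype.ext (exteriorDer_mul ξ.2 η.2)

theorem smul_formD_scale (c : ℂ) (φ : Form E M) :
    c • formD E M (formScale E M c φ) = formScale E M c (formD E M φ) :=
  Subtype.ext (smul_exteriorDer_scale c φ.2)

theorem formProj_scale (a b : ℤ) (c : ℂ) (φ : Form E M) :
    formProj J a b (formScale E M c φ) = formScale E M c (formProj J a b φ) :=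
  Subtype.ext (funext fun x => bidegProj_scale (J.toEnd x) a b c (φ.1 x))

theorem formProj_mul_of_mem {c d : ℤ} {η : Form E M} (hη : η ∈ J.bidegForm c d) (a b : ℤ)
    (ξ : Form E M) : formProj J (a + c) (b + d) (ξ * η) = formProj J a b ξ * η :=
  Subtype.ext (funext fun x => bidegProj_mul_of_mem (J.sq_eq x) (hη x) a b (ξ.1 x))

theorem formProj_mem_mul {c d : ℤ} {ξ : Form E M} (hξ : ξ ∈ J.bidegForm c d) (a b : ℤ)
    (η : Form E M) : formProj J (c + a) (d + b) (ξ * η) = ξ * formProj J a b η :=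
  Subtype.ext (funext fun x => bidegProj_mem_mul (J.sq_eq x) (hξ x) a b (η.1 x))

theorem mul_mem_bidegForm {a b c d : ℤ} {ξ η : Form E M} (hξ : ξ ∈ J.bidegForm a b)
    (hη : η ∈ J.bidegForm c d) : ξ * η ∈ J.bidegForm (a + c) (b + d) := by
  rw [mem_bidegForm_iff, formProj_mul_of_mem hη, mem_bidegForm_iff.mp hξ]

theorem formScale_mem {a b : ℤ} {ξ : Form E M} (hξ : ξ ∈ J.bidegForm a b) (c : ℂ) :
    formScale E M c ξ ∈ J.bidegForm a b := by
  rw [mem_bidegForm_iff, formProj_scale, mem_bidegForm_iff.mp hξ]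

theorem smul_formDelta_scale (u v : ℤ) (c : ℂ) (φ : Form E M) :
    c • formDelta J u v (formScale E M c φ) = formScale E M c (formDelta J u v φ) := by
  simp only [formDelta, LinearMap.sum_apply, LinearMap.comp_apply, Finset.smul_sum, map_sum]
  refine Finset.sum_congr rfl fun p _ => Finset.sum_congr rfl fun q _ => ?_
  rw [← map_smul, formProj_scale, smul_formD_scale, formProj_scale]

/-- For factors of pure type this is one component of the Leibniz rule of `d`, because
multiplication by such a form shifts components; additivity in both factors gives the rest. -/
theorem formDelta_mul (u v : ℤ) (ξ η : Form E M) :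
    formDelta J u v (ξ * η) =
      formDelta J u v ξ * η + formScale E M (-1) ξ * formDelta J u v η := by
  induction ξ using form_induction J with
  | ha φ ψ hφ hψ =>
    simp only [add_mul, map_add, hφ, hψ]
    abel
  | h a b ξ hξ =>
    induction η using form_induction J with
    | ha φ ψ hφ hψ =>
      simp only [mul_add, map_add, hφ, hψ]
      abel
    | h c d η hη =>
      have h1 := formProj_mul_of_mem hη (a + u) (b + v) (formD E M ξ)
      have h2 := formProj_mem_mul (formScale_mem hξ (-1)) (c + u) (d + v) (formD E M η)
      rw [← formDelta_of_mem u v hξ, add_right_comm a u c, add_right_comm b v d] at h1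
      rw [← formDelta_of_mem u v hη, ← add_assoc a c u, ← add_assoc b d v] at h2
      rw [← h1, ← h2, ← map_add, ← formD_mul]
      exact formDelta_of_mem u v (mul_mem_bidegForm hξ hη)

theorem formDelta_mem (u v : ℤ) {a b : ℤ} {φ : Form E M} (hφ : φ ∈ J.bidegForm a b) :
    formDelta J u v φ ∈ J.bidegForm (a + u) (b + v) := by
  rw [formDelta_of_mem u v hφ]
  exact formProj_mem _ _ _

/-! ### Derivations -/

variable (E M) in
/-- The derivations of degree `k` on smooth forms. -/
def IsDerivationOfDegree (k : ℤ) (T : Form E M →ₗ[ℂ] Form E M) : Prop :=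
  ∀ m : ℕ, ∀ ξ ∈ degForm E M m, ∀ η : Form E M,
    T (ξ * η) = T ξ * η + ((-1 : ℂ) ^ (k * m)) • (ξ * T η)

theorem IsDerivationOfDegree.sub {k : ℤ} {T S : Form E M →ₗ[ℂ] Form E M}
    (hT : IsDerivationOfDegree E M k T) (hS : IsDerivationOfDegree E M k S) :
    IsDerivationOfDegree E M k (T - S) := by
  intro m ξ hξ η
  rw [LinearMap.sub_apply, LinearMap.sub_apply, LinearMap.sub_apply, hT m ξ hξ η, hS m ξ hξ η,
    leibniz_sub]

theorem formScale_of_mem (c : ℂ) {m : ℕ} {ξ : Form E M} (hξ : ξ ∈ degForm E M m) :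
    formScale E M c ξ = c ^ m • ξ :=
  Subtype.ext (funext fun x => scale_of_mem_exteriorPower c (hξ x))

theorem isDerivationOfDegree_of_scale {k : ℤ} {T : Form E M →ₗ[ℂ] Form E M}
    (h : ∀ ξ η, T (ξ * η) = T ξ * η + formScale E M ((-1) ^ k) ξ * T η) :
    IsDerivationOfDegree E M k T := by
  intro m ξ hξ η
  rw [h, formScale_of_mem _ hξ, smul_mul_assoc, zpow_mul, zpow_natCast]

variable {U : ∀ x : M, Submodule ℂ (Complexification (TangentSpace 𝓘(ℝ, E) x))} {p q : ℤ}
  {K : RawVecForm E M}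

theorem formInterior_mul (hK : K.Smooth) (h : ∀ x, K x ∈ vecBidegPart (J.toEnd x) (U x) p q)
    (ξ η : Form E M) : formInterior K hK (ξ * η) = formInterior K hK ξ * η +
      formScale E M ((-1) ^ (p + q - 1)) ξ * formInterior K hK η :=
  Subtype.ext (funext fun x => interiorMap_mul (h x) (ξ.1 x) (η.1 x))

theorem formScale_interior (hK : K.Smooth) (h : ∀ x, K x ∈ vecBidegPart (J.toEnd x) (U x) p q)
    {c : ℂ} (hc : c ≠ 0) (φ : Form E M) : formScale E M c (formInterior K hK φ) =
      c ^ (p + q - 1) • formInterior K hK (formScale E M c φ) :=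
  Subtype.ext (funext fun x => scale_interiorMap (h x) hc (φ.1 x))

theorem isDerivationOfDegree_interior (hK : K.Smooth)
    (h : ∀ x, K x ∈ vecBidegPart (J.toEnd x) (U x) p q) :
    IsDerivationOfDegree E M (p + q - 1) (formInterior K hK) :=
  isDerivationOfDegree_of_scale (formInterior_mul hK h)

variable (J) in
/-- The graded commutator of `i_K`, where `K` has degree `k`, and the component of type `(u,v)` of
the exterior derivative. -/
def formLie (u v k : ℤ) (K : RawVecForm E M) (hK : K.Smooth) : Form E M →ₗ[ℂ] Form E M :=
  formInterior K hK ∘ₗ formDelta J u v -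
    ((-1 : ℂ) ^ (k - 1)) • (formDelta J u v ∘ₗ formInterior K hK)

theorem coe_formLie10 (k : ℤ) (hK : K.Smooth) (φ : Form E M) :
    (formLie J 1 0 k K hK φ).1 = J.lie10 k K φ.1 := by
  rw [AlmostComplexStructure.lie10, ← coe_formDelta10]
  change _ = _ - _ • J.del (formInterior K hK φ).1
  rw [← coe_formDelta10]
  rfl

theorem coe_formLie01 (k : ℤ) (hK : K.Smooth) (φ : Form E M) :
    (formLie J 0 1 k K hK φ).1 = J.lie01 k K φ.1 := by
  rw [AlmostComplexStructure.lie01, ← coe_formDelta01]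
  change _ = _ - _ • J.delbar (formInterior K hK φ).1
  rw [← coe_formDelta01]
  rfl

theorem formScale_scale (c d : ℂ) (φ : Form E M) :
    formScale E M c (formScale E M d φ) = formScale E M (c * d) φ :=
  Subtype.ext (funext fun x => scale_scale c d (φ.1 x))

/-- The degrees `p + q - 1` of `i_K` and `1` of the component of `d` add up to `p + q`. -/
theorem isDerivationOfDegree_lie (u v : ℤ) (hK : K.Smooth)
    (h : ∀ x, K x ∈ vecBidegPart (J.toEnd x) (U x) p q) :
    IsDerivationOfDegree E M (p + q) (formLie J u v (p + q) K hK) := by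
  refine isDerivationOfDegree_of_scale fun ξ η => ?_
  have hc : (-1 : ℂ) ^ (p + q) = (-1) ^ (p + q - 1) * (-1) := by
    rw [← zpow_add_one₀ (by norm_num), sub_add_cancel]
  have hcc : (-1 : ℂ) ^ (p + q - 1) * (-1) ^ (p + q - 1) = 1 := by
    rw [← mul_zpow]
    simp
  rw [hc]
  exact leibniz_commutator hcc (formInterior K hK) (formDelta J u v) (formScale E M)
    formScale_scale (formInterior_mul hK h) (formDelta_mul u v)
    (formScale_interior hK h (by norm_num)) (smul_formDelta_scale u v _) ξ η

theorem formInterior_mem {u v : ℤ} (hK : K.Smooth)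
    (h : ∀ x, K x ∈ vecBidegPart (J.toEnd x) (U x) p q)
    (hU : (u = 1 ∧ v = 0 ∧ ∀ x, U x = vec10 (J.toEnd x)) ∨
      (u = 0 ∧ v = 1 ∧ ∀ x, U x = vec01 (J.toEnd x))) {a b : ℤ} {φ : Form E M}
    (hφ : φ ∈ J.bidegForm (a + u) (b + v)) :
    formInterior K hK φ ∈ J.bidegForm (p + a) (q + b) := by
  intro x
  rw [mem_bidegPart_iff (J.sq_eq x)]
  refine (bidegProj_interiorMap (J.sq_eq x) (u := u) (v := v) ?_ (h x) a b (φ.1 x)).trans ?_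
  · rcases hU with ⟨hu, hv, hU⟩ | ⟨hu, hv, hU⟩
    · exact Or.inl ⟨hu, hv, hU x⟩
    · exact Or.inr ⟨hu, hv, hU x⟩
  · rw [bidegProj_of_mem (J.sq_eq x) (hφ x)]
    rfl

theorem formLie_mem {u v : ℤ} (hK : K.Smooth)
    (h : ∀ x, K x ∈ vecBidegPart (J.toEnd x) (U x) p q)
    (hU : (u = 1 ∧ v = 0 ∧ ∀ x, U x = vec10 (J.toEnd x)) ∨
      (u = 0 ∧ v = 1 ∧ ∀ x, U x = vec01 (J.toEnd x))) {a b : ℤ} {φ : Form E M}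
    (hφ : φ ∈ J.bidegForm a b) (k : ℤ) :
    formLie J u v k K hK φ ∈ J.bidegForm (p + a) (q + b) := by
  refine Submodule.sub_mem _ (formInterior_mem hK h hU (formDelta_mem u v hφ))
    (Submodule.smul_mem _ _ ?_)
  -- Here `a - u` or `b - v` may be negative; with integer types the argument needs no separate
  -- case.
  have h1 : formInterior K hK φ ∈ J.bidegForm (p + (a - u)) (q + (b - v)) :=
    formInterior_mem hK h hU (by simpa using hφ)
  have h2 := formDelta_mem u v h1
  rwa [add_assoc, sub_add_cancel, add_assoc, sub_add_cancel] at h2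

end Operators

section Bump

variable {E : Type*} [NormedAddCommGroup E] [NormedSpace ℝ E] [FiniteDimensional ℝ E]
variable {M : Type*} [TopologicalSpace M] [ChartedSpace E M] [IsManifold 𝓘(ℝ, E) ∞ M]

/-! ### Forms extended from charts by bump functions -/

/-- The form that the preferred chart at `x₀` pulls back from `F`, multiplied by `χ`. -/
def bumpForm (χ : M → ℝ) (x₀ : M) (F : E → ExtForm E) : RawForm E M := fun x =>
  (χ x : ℂ) • pullback (chartDeriv E x₀ x) (F (extChartAt 𝓘(ℝ, E) x₀ x))

variable (E) in
/-- A smooth function with support in the domain of the preferred chart at `x₀` which is `1`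
near `x`. -/
structure IsBumpAt (χ : M → ℝ) (x₀ x : M) : Prop where
  contMDiff : ContMDiff 𝓘(ℝ, E) 𝓘(ℝ, ℝ) ∞ χ
  tsupport_subset : tsupport χ ⊆ (extChartAt 𝓘(ℝ, E) x₀).source
  eventually_eq_one : ∀ᶠ z in nhds x, χ z = 1

theorem exists_isBumpAt [T2Space M] {x₀ x : M} (hx : x ∈ (extChartAt 𝓘(ℝ, E) x₀).source)
    {U : Set M} (hU : U ∈ nhds x) : ∃ χ : M → ℝ, IsBumpAt E χ x₀ x ∧ tsupport χ ⊆ U := by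
  obtain ⟨f, -, hf⟩ := (SmoothBumpFunction.nhds_basis_tsupport (I := 𝓘(ℝ, E)) x).mem_iff.mp
    (Filter.inter_mem hU ((isOpen_extChartAt_source x₀).mem_nhds hx))
  exact ⟨f, ⟨f.contMDiff, fun z hz => (hf hz).2, f.eventuallyEq_one⟩, fun z hz => (hf hz).1⟩

theorem bumpForm_inChart (χ : M → ℝ) {x₀ : M} (F : E → ExtForm E) {y : E}
    (hy : y ∈ (extChartAt 𝓘(ℝ, E) x₀).target) :
    (bumpForm χ x₀ F).inChart x₀ y = (χ ((extChartAt 𝓘(ℝ, E) x₀).symm y) : ℂ) • F y := by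
  rw [RawForm.inChart, bumpForm, map_smul, pullback_chartSymmDeriv_chartDeriv hy,
    (extChartAt 𝓘(ℝ, E) x₀).right_inv hy]

theorem bumpForm_smooth {χ : M → ℝ} {x₀ x : M} (hχ : IsBumpAt E χ x₀ x) {F : E → ExtForm E}
    (hF : SmoothVecOn F (extChartAt 𝓘(ℝ, E) x₀).target) : (bumpForm χ x₀ F).Smooth := by
  refine RawForm.smooth_of_locally fun z => ?_
  -- The support lies in the chart domain, where the form is visibly smooth; off the support it
  -- vanishes near the point.
  by_cases hz : z ∈ tsupport χ
  · have hz0 := hχ.tsupport_subset hz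
    refine ⟨x₀, hz0, _, target_mem_nhds ((extChartAt 𝓘(ℝ, E) x₀).map_source hz0), ?_⟩
    refine (SmoothVecOn.smul ?_ hF).congr fun y hy => bumpForm_inChart χ F hy
    have h1 := (hχ.contMDiff.contMDiffOn (s := Set.univ)).comp
      (contMDiffOn_extChartAt_symm (I := 𝓘(ℝ, E)) (n := ∞) x₀) (fun _ _ => Set.mem_univ _)
    exact Complex.ofRealCLM.contDiff.comp_contDiffOn h1.contDiffOn
  · refine ⟨z, mem_extChartAt_source z, _, (symm_tendsto (mem_extChartAt_source z)).eventually
      ((isClosed_tsupport χ).isOpen_compl.mem_nhds hz), ?_⟩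
    refine (smoothVecOn_const 0).congr fun y hy => ?_
    have h0 : χ ((extChartAt 𝓘(ℝ, E) z).symm y) = 0 := image_eq_zero_of_notMem_tsupport hy
    rw [RawForm.inChart, bumpForm, h0, Complex.ofReal_zero, zero_smul, map_zero]

/-- The smooth form defined by `bumpForm`. -/
def chartForm {χ : M → ℝ} {x₀ x : M} (hχ : IsBumpAt E χ x₀ x) (F : E → ExtForm E)
    (hF : SmoothVecOn F (extChartAt 𝓘(ℝ, E) x₀).target) : Form E M :=
  ⟨bumpForm χ x₀ F, bumpForm_smooth hχ hF⟩

theorem chartForm_eventually {χ : M → ℝ} {x₀ x : M} (hχ : IsBumpAt E χ x₀ x) (F : E → ExtForm E)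
    (hF : SmoothVecOn F (extChartAt 𝓘(ℝ, E) x₀).target) :
    ∀ᶠ z in nhds x, (chartForm hχ F hF).1 z =
      pullback (chartDeriv E x₀ z) (F (extChartAt 𝓘(ℝ, E) x₀ z)) := by
  filter_upwards [hχ.eventually_eq_one] with z hz
  change ((χ z : ℝ) : ℂ) • _ = _
  rw [hz, Complex.ofReal_one, one_smul]

/-- The smooth functions defined by `bumpForm`. -/
def chartFunction {χ : M → ℝ} {x₀ x : M} (hχ : IsBumpAt E χ x₀ x) (f : E → ℂ)
    (hf : ContDiffOn ℝ ∞ f (extChartAt 𝓘(ℝ, E) x₀).target) : Form E M :=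
  chartForm hχ (fun y => algebraMap ℂ (ExtForm E) (f y))
    ((smoothVecOn_complex.mpr hf).map (Algebra.linearMap ℂ (ExtForm E)))

theorem chartFunction_eventually {χ : M → ℝ} {x₀ x : M} (hχ : IsBumpAt E χ x₀ x) (f : E → ℂ)
    (hf : ContDiffOn ℝ ∞ f (extChartAt 𝓘(ℝ, E) x₀).target) :
    ∀ᶠ z in nhds x, (chartFunction hχ f hf).1 z =
      algebraMap ℂ _ (f (extChartAt 𝓘(ℝ, E) x₀ z)) := by
  filter_upwards [chartForm_eventually hχ (fun y => algebraMap ℂ (ExtForm E) (f y)) _] with z hz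
  exact hz.trans (AlgHom.commutes _ _)

theorem mem_degForm_zero_iff {φ : Form E M} :
    φ ∈ degForm E M 0 ↔ ∀ x, ∃ c : ℂ, φ.1 x = algebraMap ℂ _ c := by
  refine forall_congr' fun x => ?_
  change _ ∈ _ ^ 0 ↔ _
  rw [pow_zero, Submodule.mem_one]
  exact exists_congr fun c => eq_comm

theorem chartFunction_mem {χ : M → ℝ} {x₀ x : M} (hχ : IsBumpAt E χ x₀ x) (f : E → ℂ)
    (hf : ContDiffOn ℝ ∞ f (extChartAt 𝓘(ℝ, E) x₀).target) :
    chartFunction hχ f hf ∈ degForm E M 0 := by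
  rw [mem_degForm_zero_iff]
  intro z
  refine ⟨χ z * f (extChartAt 𝓘(ℝ, E) x₀ z), ?_⟩
  change (χ z : ℂ) • pullback _ (algebraMap ℂ _ _) = _
  rw [AlgHom.commutes, map_mul, Algebra.smul_def]

/-- The exterior derivative of a form extended from a chart. -/
theorem exteriorDer_chartForm {χ : M → ℝ} {x₀ x : M} (hχ : IsBumpAt E χ x₀ x)
    (hx : x ∈ (extChartAt 𝓘(ℝ, E) x₀).source) (F : E → ExtForm E)
    (hF : SmoothVecOn F (extChartAt 𝓘(ℝ, E) x₀).target) :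
    ∀ᶠ z in nhds x, exteriorDer (chartForm hχ F hF).1 z =
      pullback (chartDeriv E x₀ z) (extDerivModel F (extChartAt 𝓘(ℝ, E) x₀ z)) := by
  filter_upwards [hχ.eventually_eq_one.eventually_nhds,
    (isOpen_extChartAt_source x₀).mem_nhds hx] with z hz hz0
  rw [exteriorDer_eq (chartForm hχ F hF).2 hz0]
  congr 1
  refine extDerivModel_congr ?_
  filter_upwards [(symm_tendsto hz0).eventually hz,
    target_mem_nhds ((extChartAt 𝓘(ℝ, E) x₀).map_source hz0)] with y hy1 hy
  refine (bumpForm_inChart χ F hy).trans ?_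
  rw [hy1, Complex.ofReal_one, one_smul]

/-! ### Derivations are local -/

variable [T2Space M] {k : ℤ} {T : Form E M →ₗ[ℂ] Form E M}

/-- For a factor of degree zero the Leibniz rule has no sign, whatever `k` is. -/
theorem IsDerivationOfDegree.apply_function_mul (hT : IsDerivationOfDegree E M k T) {f : Form E M}
    (hf : f ∈ degForm E M 0) (φ : Form E M) (x : M) :
    (T (f * φ)).1 x = (T f).1 x * φ.1 x + f.1 x * (T φ).1 x := by
  rw [hT 0 f hf φ]
  simp only [Nat.cast_zero, mul_zero, zpow_zero, one_smul]
  rfl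

/-- Take a bump function `f` supported where `φ` vanishes, with `f = 1` at `x`. Then `f φ = 0`, and
the Leibniz rule leaves `T φ` at `x`. -/
theorem IsDerivationOfDegree.apply_eq_zero (hT : IsDerivationOfDegree E M k T) {φ : Form E M}
    {x : M} (hφ : ∀ᶠ z in nhds x, φ.1 z = 0) : (T φ).1 x = 0 := by
  obtain ⟨χ, hχ, hsupp⟩ := exists_isBumpAt (mem_extChartAt_source (I := 𝓘(ℝ, E)) x) hφ
  have hf := chartFunction_mem hχ (fun _ => 1) contDiffOn_const
  have hf1 := (chartFunction_eventually hχ (fun _ => 1) contDiffOn_const).self_of_nhds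
  set f := chartFunction hχ (fun _ => 1) contDiffOn_const
  have h0 : f * φ = 0 := by
    refine Subtype.ext (funext fun z => ?_)
    by_cases hz : z ∈ tsupport χ
    · have : φ.1 z = 0 := hsupp hz
      change f.1 z * φ.1 z = 0
      rw [this, mul_zero]
    · change ((χ z : ℂ) • _) * φ.1 z = 0
      rw [image_eq_zero_of_notMem_tsupport hz, Complex.ofReal_zero, zero_smul, zero_mul]
  have h1 := hT.apply_function_mul hf φ x
  rw [h0, map_zero, hφ.self_of_nhds, mul_zero, zero_add, hf1, map_one, one_mul] at h1
  exact h1.symm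

theorem IsDerivationOfDegree.congr (hT : IsDerivationOfDegree E M k T) {φ ψ : Form E M}
    {x : M} (h : ∀ᶠ z in nhds x, φ.1 z = ψ.1 z) : (T φ).1 x = (T ψ).1 x := by
  have h1 : (T (φ - ψ)).1 x = 0 := by
    refine hT.apply_eq_zero ?_
    filter_upwards [h] with z hz
    change φ.1 z - ψ.1 z = 0
    rw [hz, sub_self]
  rw [map_sub] at h1
  exact sub_eq_zero.mp h1

theorem coe_sum_apply {ι : Type*} (t : Finset ι) (φ : ι → Form E M) (x : M) :
    (∑ i ∈ t, φ i : Form E M).1 x = ∑ i ∈ t, (φ i).1 x := by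
  rw [AddSubmonoidClass.coe_finsetSum, Finset.sum_apply]

/-- A derivation that vanishes on functions is pointwise. -/
theorem IsDerivationOfDegree.apply_eq_zero_of_eq_zero (hT : IsDerivationOfDegree E M k T)
    (h0 : ∀ f ∈ degForm E M 0, T f = 0) {φ : Form E M} {x : M} (hφ : φ.1 x = 0) :
    (T φ).1 x = 0 := by
  have hx := mem_extChartAt_source (I := 𝓘(ℝ, E)) x
  obtain ⟨χ, hχ, -⟩ := exists_isBumpAt hx Filter.univ_mem
  have hc (S) : ContDiffOn ℝ ∞ (fun y => (dxBasis E).coord S (φ.1.inChart x y))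
      (extChartAt 𝓘(ℝ, E) x).target := φ.2 x _
  set f := fun S => chartFunction hχ _ (hc S) with hf
  set ψ := fun S => chartForm hχ (fun _ => dxBasis E S) (smoothVecOn_const _) with hψ
  -- Near `x` the form is a sum of global functions times global forms. `T` passes through the
  -- functions, and all of them vanish at `x`.
  have h1 : ∀ᶠ z in nhds x, φ.1 z = (∑ S, f S * ψ S : Form E M).1 z := by
    have e1 := (Filter.eventually_all (ι := Finset (Fin (Module.finrank ℝ E)))).mpr
      fun S => chartFunction_eventually hχ _ (hc S)
    have e2 := (Filter.eventually_all (ι := Finset (Fin (Module.finrank ℝ E)))).mpr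
      fun S => chartForm_eventually hχ (fun _ => dxBasis E S) (smoothVecOn_const _)
    filter_upwards [e1, e2, (isOpen_extChartAt_source x).mem_nhds hx] with z hz1 hz2 hz
    rw [coe_sum_apply, φ.1.eq_pullback_inChart hz]
    conv_lhs => rw [← (dxBasis E).sum_repr (φ.1.inChart x (extChartAt 𝓘(ℝ, E) x z))]
    rw [map_sum]
    refine Finset.sum_congr rfl fun S _ => ?_
    change _ = (f S).1 z * (ψ S).1 z
    rw [hf, hψ, hz1 S, hz2 S, map_smul, Algebra.smul_def]
    rfl
  rw [hT.congr h1, map_sum, coe_sum_apply]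
  refine Finset.sum_eq_zero fun S _ => ?_
  have hval : φ.1.inChart x (extChartAt 𝓘(ℝ, E) x x) = 0 := by
    obtain ⟨y, hy, h, h'⟩ := exists_eq_symm hx
    rw [h', RawForm.inChart]
    have : φ.1 ((extChartAt 𝓘(ℝ, E) x).symm y) = 0 := by rw [h]; exact hφ
    rw [this, map_zero]
  rw [hT.apply_function_mul (chartFunction_mem hχ _ (hc S)), h0 _ (chartFunction_mem hχ _ (hc S)),
    (chartFunction_eventually hχ _ (hc S)).self_of_nhds, hval]
  simp

theorem IsDerivationOfDegree.apply_one (hT : IsDerivationOfDegree E M k T) : T 1 = 0 := by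
  have h : (1 : Form E M) ∈ degForm E M 0 := by
    rw [mem_degForm_zero_iff]
    exact fun x => ⟨1, (map_one _).symm⟩
  refine Subtype.ext (funext fun x => ?_)
  have h1 := hT.apply_function_mul h 1 x
  rw [one_mul] at h1
  change (T 1).1 x = (T 1).1 x * 1 + 1 * (T 1).1 x at h1
  rw [mul_one, one_mul, left_eq_add] at h1
  exact h1

/-- The function on the chart domain that a form of degree zero defines. -/
def functionInChart (f : Form E M) (x₀ : M) (y : E) : ℂ :=
  ExteriorAlgebra.algebraMapInv (f.1.inChart x₀ y)

theorem contDiffOn_functionInChart (f : Form E M) (x₀ : M) :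
    ContDiffOn ℝ ∞ (functionInChart f x₀) (extChartAt 𝓘(ℝ, E) x₀).target :=
  f.2 x₀ (ExteriorAlgebra.algebraMapInv (R := ℂ) (M := Covector E)).toLinearMap

theorem inChart_eq_functionInChart {f : Form E M} (hf : f ∈ degForm E M 0) (x₀ : M) (y : E) :
    f.1.inChart x₀ y = algebraMap ℂ _ (functionInChart f x₀ y) := by
  obtain ⟨c, hc⟩ := mem_degForm_zero_iff.mp hf ((extChartAt 𝓘(ℝ, E) x₀).symm y)
  rw [functionInChart, RawForm.inChart, hc, AlgHom.commutes,
    ExteriorAlgebra.algebraMap_leftInverse]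

theorem eq_functionInChart {f : Form E M} (hf : f ∈ degForm E M 0) {x₀ x : M}
    (hx : x ∈ (extChartAt 𝓘(ℝ, E) x₀).source) :
    f.1 x = algebraMap ℂ _ (functionInChart f x₀ (extChartAt 𝓘(ℝ, E) x₀ x)) := by
  rw [f.1.eq_pullback_inChart hx, inChart_eq_functionInChart hf, AlgHom.commutes]

theorem exteriorDer_function {f : Form E M} (hf : f ∈ degForm E M 0) {x₀ x : M}
    (hx : x ∈ (extChartAt 𝓘(ℝ, E) x₀).source) :
    exteriorDer f.1 x = ExteriorAlgebra.ι ℂ (covectorOf ((fderiv ℝ (functionInChart f x₀)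
      (extChartAt 𝓘(ℝ, E) x₀ x)).toLinearMap ∘ₗ chartDeriv E x₀ x)) := by
  have h1 : f.1.inChart x₀ = fun y => algebraMap ℂ _ (functionInChart f x₀ y) :=
    funext fun y => inChart_eq_functionInChart hf x₀ y
  rw [exteriorDer_eq f.2 hx, h1, extDerivModel_algebraMap, pullback_covectorOf]
  exact ((contDiffOn_functionInChart f x₀).contDiffAt
    (target_mem_nhds ((extChartAt 𝓘(ℝ, E) x₀).map_source hx))).differentiableAt (by simp)

theorem exists_contDiff_eventuallyEq {h : E → ℂ} {s : Set E} (hh : ContDiffOn ℝ ∞ h s) {y : E}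
    (hs : s ∈ nhds y) : ∃ g : E → ℂ, ContDiff ℝ ∞ g ∧ g =ᶠ[nhds y] h := by
  obtain ⟨r, hr, hrs⟩ := Metric.mem_nhds_iff.mp hs
  let ψ : ContDiffBump y := ⟨r / 4, r / 2, by positivity, by linarith⟩
  refine ⟨fun z => ψ z • h z, ?_, ?_⟩
  · rw [contDiff_iff_contDiffAt]
    intro z
    by_cases hz : z ∈ tsupport ψ
    · rw [ψ.tsupport_eq] at hz
      have hz' : z ∈ Metric.ball y r :=
        Metric.closedBall_subset_ball (by change r / 2 < r; linarith) hz
      exact ψ.contDiff.contDiffAt.smul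
        ((hh.mono hrs).contDiffAt (Metric.isOpen_ball.mem_nhds hz'))
    · refine (contDiffAt_const (c := (0 : ℂ))).congr_of_eventuallyEq ?_
      filter_upwards [(isClosed_tsupport ψ).isOpen_compl.mem_nhds hz] with w hw
      rw [image_eq_zero_of_notMem_tsupport hw, zero_smul]
  · filter_upwards [ψ.eventuallyEq_one] with z hz
    rw [hz]
    simp

theorem chartDeriv_bijective {x₀ x : M} (hx : x ∈ (extChartAt 𝓘(ℝ, E) x₀).source) :
    Function.Bijective (chartDeriv E x₀ x) := by
  obtain ⟨y, hy, rfl, -⟩ := exists_eq_symm hx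
  refine Function.bijective_iff_has_inverse.mpr ⟨chartSymmDeriv E x₀ y, fun v => ?_, fun v => ?_⟩
  · exact LinearMap.congr_fun (chartSymmDeriv_comp_chartDeriv hy) v
  · exact LinearMap.congr_fun (chartDeriv_comp_chartSymmDeriv hy) v

theorem covectorOf_injective {V : Type*} [AddCommGroup V] [Module ℝ V] :
    Function.Injective (covectorOf (V := V)) := by
  intro L L' h
  ext v
  have := LinearMap.congr_fun h (1 ⊗ₜ v)
  simpa [covectorOf_tmul] using this

/-- On functions, a derivation depends only on the differential. -/
theorem IsDerivationOfDegree.apply_function_eq_zero (hT : IsDerivationOfDegree E M k T)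
    {f : Form E M} (hf : f ∈ degForm E M 0) {x : M} (hd : exteriorDer f.1 x = 0) :
    (T f).1 x = 0 := by
  have hx := mem_extChartAt_source (I := 𝓘(ℝ, E)) x
  have ht := extChartAt_target_mem_nhds (I := 𝓘(ℝ, E)) x
  obtain ⟨χ, hχ, -⟩ := exists_isBumpAt hx Filter.univ_mem
  set y₀ := extChartAt 𝓘(ℝ, E) x x
  -- Hadamard's lemma integrates along segments in `E`, so the local expression is first replaced by
  -- a function smooth on all of `E`.
  obtain ⟨g, hg, hgf⟩ := exists_contDiff_eventuallyEq (contDiffOn_functionInChart f x) ht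
  have hg0 : fderiv ℝ g y₀ = 0 := by
    rw [hgf.fderiv_eq]
    rw [exteriorDer_function hf hx, ← map_zero (ExteriorAlgebra.ι ℂ),
      (ExteriorAlgebra.ι_leftInverse (R := ℂ)).injective.eq_iff, ← map_zero covectorOf,
      covectorOf_injective.eq_iff] at hd
    ext v
    obtain ⟨w, rfl⟩ := (chartDeriv_bijective hx).2 v
    exact LinearMap.congr_fun hd w
  obtain ⟨a, ha, ha0, hga⟩ := exists_contDiff_eq_sum hg y₀
  have hb (i : Fin (Module.finrank ℝ E)) :
      ContDiff ℝ ∞ (fun y => (((Module.finBasis ℝ E).repr (y - y₀) i : ℝ) : ℂ)) :=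
    Complex.ofRealCLM.contDiff.comp ((LinearMap.toContinuousLinearMap
      ((Module.finBasis ℝ E).coord i)).contDiff.comp (contDiff_id.sub contDiff_const))
  set A := fun i => chartFunction hχ _ (ha i).contDiffOn with hA
  set B := fun i => chartFunction hχ _ (hb i).contDiffOn with hB
  -- In each product `B i` vanishes at `x` as a coordinate difference, and `A i` vanishes there as a
  -- partial derivative of `g`; both Leibniz terms are then zero.
  have h1 : ∀ᶠ z in nhds x, f.1 z = (g y₀ • (1 : Form E M) + ∑ i, B i * A i : Form E M).1 z := by
    have e1 := Filter.eventually_all.mpr fun i => chartFunction_eventually hχ _ (ha i).contDiffOn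
    have e2 := Filter.eventually_all.mpr fun i => chartFunction_eventually hχ _ (hb i).contDiffOn
    have e3 := (continuousAt_extChartAt (I := 𝓘(ℝ, E)) x).eventually hgf
    filter_upwards [e1, e2, e3, (isOpen_extChartAt_source x).mem_nhds hx] with z hz1 hz2 hz3 hz
    rw [eq_functionInChart hf hz, ← hz3, hga]
    change _ = g y₀ • (1 : ExtForm _) + (∑ i, B i * A i : Form E M).1 z
    rw [coe_sum_apply, map_add, map_sum, Algebra.algebraMap_eq_smul_one (g y₀)]
    congr 1
    refine Finset.sum_congr rfl fun i _ => ?_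
    change _ = (B i).1 z * (A i).1 z
    rw [hA, hB, hz1 i, hz2 i, map_mul]
  rw [hT.congr h1, map_add, map_smul, hT.apply_one, smul_zero, zero_add, map_sum, coe_sum_apply]
  refine Finset.sum_eq_zero fun i _ => ?_
  rw [hT.apply_function_mul (chartFunction_mem hχ _ (hb i).contDiffOn),
    (chartFunction_eventually hχ _ (ha i).contDiffOn).self_of_nhds,
    (chartFunction_eventually hχ _ (hb i).contDiffOn).self_of_nhds]
  change _ * algebraMap ℂ _ (a i y₀) + algebraMap ℂ _
    (((Module.finBasis ℝ E).repr (y₀ - y₀) i : ℝ) : ℂ) * _ = 0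
  rw [ha0, hg0]
  simp

end Bump

/-! ### Vector valued forms from linear maps on covectors -/

section Tensor

variable {V : Type*} [AddCommGroup V] [Module ℝ V] [Module.Finite ℝ V]

/-- The vector valued form that corresponds to a linear map from covectors to exterior forms. -/
def tensorOf (A : Covector V →ₗ[ℂ] ExtForm V) : VecForm V :=
  ∑ i, A (((Module.finBasis ℝ V).baseChange ℂ).dualBasis i) ⊗ₜ
    (Module.finBasis ℝ V).baseChange ℂ i

/-- The sum does not depend on the choice of dual frames, and a transpose applied to covectors may
be moved to the vectors. So composing with a covector projection makes the vector part take values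
in `T^{1,0}` or `T^{0,1}`. -/
theorem tensorOf_comp_dualMap (A : Covector V →ₗ[ℂ] ExtForm V)
    (P : Complexification V →ₗ[ℂ] Complexification V) {ι : Type*} [Fintype ι]
    (ε : ι → Covector V) (X : ι → Complexification V) (h : ∀ Y, ∑ j, ε j Y • X j = Y) :
    tensorOf (A ∘ₗ P.dualMap) = ∑ j, A (ε j) ⊗ₜ P (X j) := by
  set b := (Module.finBasis ℝ V).baseChange ℂ with hb
  have h1 (α : Covector V) : P.dualMap α = ∑ j, α (P (X j)) • ε j := by
    refine LinearMap.ext fun Y => ?_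
    have h2 := congrArg (fun Z => α (P Z)) (h Y)
    simp only [map_sum, map_smul, smul_eq_mul] at h2
    simp only [LinearMap.dualMap_apply, LinearMap.sum_apply, LinearMap.smul_apply, smul_eq_mul]
    rw [← h2]
    exact Finset.sum_congr rfl fun j _ => mul_comm _ _
  simp only [tensorOf, LinearMap.comp_apply, h1, map_sum, map_smul, TensorProduct.sum_tmul]
  rw [Finset.sum_comm]
  refine Finset.sum_congr rfl fun j _ => ?_
  simp only [TensorProduct.smul_tmul]
  rw [← TensorProduct.tmul_sum]
  congr 1
  conv_rhs => rw [← b.sum_repr (P (X j))]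
  simp only [b, Module.Basis.dualBasis_apply]

theorem tensorOf_eq_sum (A : Covector V →ₗ[ℂ] ExtForm V) {ι : Type*} [Fintype ι]
    (ε : ι → Covector V) (X : ι → Complexification V) (h : ∀ Y, ∑ j, ε j Y • X j = Y) :
    tensorOf A = ∑ j, A (ε j) ⊗ₜ X j :=
  tensorOf_comp_dualMap A LinearMap.id ε X h

/-- A vector valued form can thus be prescribed by the action of its interior derivative on
covectors. -/
theorem interiorMap_tensorOf (A : Covector V →ₗ[ℂ] ExtForm V) (α : Covector V) :
    interiorMap (tensorOf A) (ExteriorAlgebra.ι ℂ α) = A α := by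
  set b := (Module.finBasis ℝ V).baseChange ℂ with hb
  have h1 : α = ∑ i, α (b i) • b.dualBasis i := by
    refine b.ext fun j => ?_
    simp
  conv_rhs => rw [h1]
  simp only [tensorOf, map_sum, LinearMap.sum_apply, interiorMap_tmul_contract, contract_ι,
    map_smul]
  refine Finset.sum_congr rfl fun i _ => ?_
  rw [← Algebra.commutes, ← Algebra.smul_def]

theorem covecProj10_eq_dualMap (J : V →ₗ[ℝ] V) : covecProj10 J = (vecProj10 J).dualMap :=
  LinearMap.ext fun α => LinearMap.ext fun X => covecProj10_apply J α X

theorem covecProj01_eq_dualMap (J : V →ₗ[ℝ] V) : covecProj01 J = (vecProj01 J).dualMap :=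
  LinearMap.ext fun α => LinearMap.ext fun X => covecProj01_apply J α X

theorem sum_dualBasis_smul (Y : Complexification V) :
    ∑ i, ((Module.finBasis ℝ V).baseChange ℂ).dualBasis i Y •
      (Module.finBasis ℝ V).baseChange ℂ i = Y := by
  conv_rhs => rw [← ((Module.finBasis ℝ V).baseChange ℂ).sum_repr Y]
  simp only [Module.Basis.dualBasis_apply]

variable {J : V →ₗ[ℝ] V} {p q : ℤ} {A : Covector V →ₗ[ℂ] ExtForm V}

theorem tensorOf_mem10 (hJ : ∀ v, J (J v) = -v) (hA : ∀ α, A α ∈ bidegPart J p q) :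
    tensorOf (A ∘ₗ covecProj10 J) ∈ vecBidegPart J (vec10 J) p q := by
  rw [covecProj10_eq_dualMap, tensorOf_comp_dualMap A _ _ _ sum_dualBasis_smul]
  exact Submodule.sum_mem _ fun i _ => Submodule.apply_mem_map₂ _ (hA _) (vecProj10_mem hJ _)

theorem tensorOf_mem01 (hJ : ∀ v, J (J v) = -v) (hA : ∀ α, A α ∈ bidegPart J p q) :
    tensorOf (A ∘ₗ covecProj01 J) ∈ vecBidegPart J (vec01 J) p q := by
  rw [covecProj01_eq_dualMap, tensorOf_comp_dualMap A _ _ _ sum_dualBasis_smul]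
  exact Submodule.sum_mem _ fun i _ => Submodule.apply_mem_map₂ _ (hA _) (vecProj01_mem hJ _)

end Tensor

/-! ### Smooth families of linear maps on covectors, and derivations given by them. -/

section Family

variable {E : Type*} [NormedAddCommGroup E] [NormedSpace ℝ E] [FiniteDimensional ℝ E]
variable {M : Type*} [TopologicalSpace M] [ChartedSpace E M] [IsManifold 𝓘(ℝ, E) ∞ M]

instance (x : M) : Module.Finite ℝ (TangentSpace 𝓘(ℝ, E) x) := inferInstanceAs (Module.Finite ℝ E)

/-- A family of linear maps from covectors to exterior forms is smooth if it takes smooth forms of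
degree one to smooth forms. -/
def SmoothFamily (A : ∀ x : M, Covector (TangentSpace 𝓘(ℝ, E) x) →ₗ[ℂ]
    ExtForm (TangentSpace 𝓘(ℝ, E) x)) : Prop :=
  ∀ α : ∀ x : M, Covector (TangentSpace 𝓘(ℝ, E) x),
    RawForm.Smooth (E := E) (fun x => ExteriorAlgebra.ι ℂ (α x)) →
      RawForm.Smooth (E := E) (fun x => A x (α x))

variable (E) in
/-- The coordinate covectors of the preferred chart at `x₀`. -/
def chartCovector (x₀ x : M) (i : Fin (Module.finrank ℝ E)) :
    Covector (TangentSpace 𝓘(ℝ, E) x) :=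
  dx E i ∘ₗ (chartDeriv E x₀ x).baseChange ℂ

theorem pullback_ι_dx (x₀ x : M) (i : Fin (Module.finrank ℝ E)) :
    pullback (chartDeriv E x₀ x) (ExteriorAlgebra.ι ℂ (dx E i)) =
      ExteriorAlgebra.ι ℂ (chartCovector E x₀ x i) :=
  pullback_ι _ _

theorem covector_eq_sum_chartCovector {x₀ : M} {y : E}
    (hy : y ∈ (extChartAt 𝓘(ℝ, E) x₀).target)
    (α : Covector (TangentSpace 𝓘(ℝ, E) ((extChartAt 𝓘(ℝ, E) x₀).symm y))) :
    α = ∑ i, α ((chartSymmDeriv E x₀ y).baseChange ℂ (1 ⊗ₜ Module.finBasis ℝ E i)) •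
      chartCovector E x₀ ((extChartAt 𝓘(ℝ, E) x₀).symm y) i := by
  have h1 := covector_eq_sum (α ∘ₗ (chartSymmDeriv E x₀ y).baseChange ℂ)
  have h2 : α = (α ∘ₗ (chartSymmDeriv E x₀ y).baseChange ℂ) ∘ₗ
      (chartDeriv E x₀ ((extChartAt 𝓘(ℝ, E) x₀).symm y)).baseChange ℂ := by
    rw [LinearMap.comp_assoc, ← LinearMap.baseChange_comp, chartSymmDeriv_comp_chartDeriv hy,
      LinearMap.baseChange_id, LinearMap.comp_id]
  conv_lhs => rw [h2, h1]
  refine LinearMap.ext fun Y => ?_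
  simp only [chartCovector, LinearMap.comp_apply, LinearMap.sum_apply, LinearMap.smul_apply]

theorem exists_coordinates {x₀ x : M} (hx : x ∈ (extChartAt 𝓘(ℝ, E) x₀).source) :
    ∃ c : Fin (Module.finrank ℝ E) → Covector (TangentSpace 𝓘(ℝ, E) x) →ₗ[ℂ] ℂ,
      ∀ α, α = ∑ i, c i α • chartCovector E x₀ x i := by
  obtain ⟨y, hy, rfl, -⟩ := exists_eq_symm hx
  exact ⟨fun i => Module.Dual.eval ℂ _ ((chartSymmDeriv E x₀ y).baseChange ℂ
    (1 ⊗ₜ Module.finBasis ℝ E i)), fun α => covector_eq_sum_chartCovector hy α⟩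

theorem tensorOf_smooth [T2Space M] {A : ∀ x : M, Covector (TangentSpace 𝓘(ℝ, E) x) →ₗ[ℂ]
    ExtForm (TangentSpace 𝓘(ℝ, E) x)} (hA : SmoothFamily A) :
    RawVecForm.Smooth (E := E) (fun x => tensorOf (A x)) := by
  intro x₀
  refine smoothVecOn_of_locally fun y₁ hy₁ => ?_
  have hx₁ := (extChartAt 𝓘(ℝ, E) x₀).map_target hy₁
  obtain ⟨χ, hχ, -⟩ := exists_isBumpAt hx₁ Filter.univ_mem
  -- The coordinate covectors live on the chart domain only; multiplied by `χ` they become global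
  -- smooth forms to which `hA` applies.
  have hψ (i : Fin (Module.finrank ℝ E)) : RawForm.Smooth (E := E) (M := M)
      (fun x => A x ((χ x : ℂ) • chartCovector E x₀ x i)) := by
    refine hA _ ?_
    have h := bumpForm_smooth hχ (F := fun _ => ExteriorAlgebra.ι ℂ (dx E i)) (smoothVecOn_const _)
    convert! h using 1
    funext x
    rw [map_smul, ← pullback_ι_dx]
    rfl
  have h1 := (symm_tendsto hx₁).eventually hχ.eventually_eq_one
  rw [(extChartAt 𝓘(ℝ, E) x₀).right_inv hy₁] at h1
  refine ⟨_, Filter.inter_mem h1 (target_mem_nhds hy₁), ?_⟩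
  refine (SmoothVecOn.sum (t := Finset.univ) fun i _ => SmoothVecOn.bilin
    (TensorProduct.mk ℂ (ExtForm E) (Complexification E))
    ((hψ i x₀).mono Set.inter_subset_right)
    (smoothVecOn_const (1 ⊗ₜ Module.finBasis ℝ E i))).congr fun y hy => ?_
  obtain ⟨hy1, hy⟩ := hy
  have hcomp (Z : Complexification E) :
      (chartDeriv E x₀ ((extChartAt 𝓘(ℝ, E) x₀).symm y)).baseChange ℂ
        ((chartSymmDeriv E x₀ y).baseChange ℂ Z) = Z := by
    rw [← LinearMap.comp_apply, ← LinearMap.baseChange_comp, chartDeriv_comp_chartSymmDeriv hy,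
      LinearMap.baseChange_id, LinearMap.id_apply]
  -- The coordinate frame and coframe are dual, so `tensorOf` can be computed in them.
  have hres (Y : Complexification (TangentSpace 𝓘(ℝ, E) ((extChartAt 𝓘(ℝ, E) x₀).symm y))) :
      ∑ i, chartCovector E x₀ ((extChartAt 𝓘(ℝ, E) x₀).symm y) i Y •
        (chartSymmDeriv E x₀ y).baseChange ℂ (1 ⊗ₜ Module.finBasis ℝ E i) = Y := by
    have h2 := sum_dualBasis_smul (V := E)
      ((chartDeriv E x₀ ((extChartAt 𝓘(ℝ, E) x₀).symm y)).baseChange ℂ Y)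
    have h3 := congrArg ((chartSymmDeriv E x₀ y).baseChange ℂ) h2
    rw [← LinearMap.comp_apply, ← LinearMap.baseChange_comp, chartSymmDeriv_comp_chartDeriv hy,
      LinearMap.baseChange_id, LinearMap.id_apply] at h3
    conv_rhs => rw [← h3]
    rw [map_sum]
    refine Finset.sum_congr rfl fun i _ => ?_
    rw [map_smul, Module.Basis.baseChange_apply]
    rfl
  rw [RawVecForm.inChart, tensorOf_eq_sum _ _ _ hres, map_sum]
  refine Finset.sum_congr rfl fun i _ => ?_
  rw [TensorProduct.map_tmul, hcomp, RawForm.inChart]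
  have hy1' : χ ((extChartAt 𝓘(ℝ, E) x₀).symm y) = 1 := hy1
  rw [hy1', Complex.ofReal_one, one_smul]
  rfl

/-! ### The symbol of a derivation -/

variable [T2Space M] {k : ℤ} {T : Form E M →ₗ[ℂ] Form E M}

theorem contDiff_coordinate (i : Fin (Module.finrank ℝ E)) :
    ContDiff ℝ ∞ (fun y : E => (((Module.finBasis ℝ E).repr y i : ℝ) : ℂ)) :=
  Complex.ofRealCLM.contDiff.comp
    (LinearMap.toContinuousLinearMap ((Module.finBasis ℝ E).coord i)).contDiff

/-- The coordinate functions of a chart, extended to the manifold. -/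
def chartCoordinate {χ : M → ℝ} {x₀ x : M} (hχ : IsBumpAt E χ x₀ x)
    (i : Fin (Module.finrank ℝ E)) : Form E M :=
  chartFunction hχ _ (contDiff_coordinate i).contDiffOn

theorem chartCoordinate_mem {χ : M → ℝ} {x₀ x : M} (hχ : IsBumpAt E χ x₀ x)
    (i : Fin (Module.finrank ℝ E)) : chartCoordinate hχ i ∈ degForm E M 0 :=
  chartFunction_mem hχ _ _

theorem exteriorDer_chartCoordinate {χ : M → ℝ} {x₀ x : M} (hχ : IsBumpAt E χ x₀ x)
    (hx : x ∈ (extChartAt 𝓘(ℝ, E) x₀).source) (i : Fin (Module.finrank ℝ E)) :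
    ∀ᶠ z in nhds x, exteriorDer (chartCoordinate hχ i).1 z =
      ExteriorAlgebra.ι ℂ (chartCovector E x₀ z i) := by
  filter_upwards [exteriorDer_chartForm hχ hx _ ((smoothVecOn_complex.mpr
    (contDiff_coordinate i).contDiffOn).map (Algebra.linearMap ℂ (ExtForm E)))] with z hz
  refine hz.trans ?_
  simp only [Algebra.linearMap_apply]
  rw [← pullback_ι_dx, extDerivModel_algebraMap
    ((contDiff_coordinate i).differentiable (by simp) _)]
  congr 2
  rw [covectorOf_eq_sum]
  have h1 (y : E) : fderiv ℝ (fun y : E => (((Module.finBasis ℝ E).repr y i : ℝ) : ℂ)) y =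
      Complex.ofRealCLM ∘L (LinearMap.toContinuousLinearMap ((Module.finBasis ℝ E).coord i)) :=
    (Complex.ofRealCLM ∘L
      (LinearMap.toContinuousLinearMap ((Module.finBasis ℝ E).coord i))).fderiv
  rw [h1]
  simp [Finsupp.single_apply]

/-- A combination of cut off coordinate functions with the coordinates of `α` as constants. -/
theorem exists_function_exteriorDer_eq (x : M) (α : Covector (TangentSpace 𝓘(ℝ, E) x)) :
    ∃ f ∈ degForm E M 0, exteriorDer f.1 x = ExteriorAlgebra.ι ℂ α := by
  have hx := mem_extChartAt_source (I := 𝓘(ℝ, E)) x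
  obtain ⟨χ, hχ, -⟩ := exists_isBumpAt hx Filter.univ_mem
  obtain ⟨c, hc⟩ := exists_coordinates hx
  refine ⟨∑ i, c i α • chartCoordinate hχ i, Submodule.sum_mem _ fun i _ =>
    Submodule.smul_mem _ _ (chartCoordinate_mem hχ i), ?_⟩
  change (formD E M _).1 x = _
  rw [map_sum, coe_sum_apply]
  conv_rhs => rw [hc α, map_sum]
  refine Finset.sum_congr rfl fun i _ => ?_
  rw [map_smul, map_smul, ← (exteriorDer_chartCoordinate hχ hx i).self_of_nhds]
  rfl

/-- On functions, a derivation is a linear map of the differential. -/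
theorem IsDerivationOfDegree.exists_symbol (hT : IsDerivationOfDegree E M k T) (x : M) :
    ∃ A : Covector (TangentSpace 𝓘(ℝ, E) x) →ₗ[ℂ] ExtForm (TangentSpace 𝓘(ℝ, E) x),
      ∀ f ∈ degForm E M 0, ∀ α, exteriorDer f.1 x = ExteriorAlgebra.ι ℂ α → (T f).1 x = A α := by
  have hx := mem_extChartAt_source (I := 𝓘(ℝ, E)) x
  obtain ⟨χ, hχ, -⟩ := exists_isBumpAt hx Filter.univ_mem
  obtain ⟨c, hc⟩ := exists_coordinates hx
  refine ⟨∑ i, (c i).smulRight ((T (chartCoordinate hχ i)).1 x), fun f hf α hα => ?_⟩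
  -- Subtracting the coordinate functions with the partial derivatives of `f` as coefficients makes
  -- the differential at `x` zero.
  have hg : f - ∑ i, c i α • chartCoordinate hχ i ∈ degForm E M 0 :=
    Submodule.sub_mem _ hf (Submodule.sum_mem _ fun i _ =>
      Submodule.smul_mem _ _ (chartCoordinate_mem hχ i))
  have h1 := hT.apply_function_eq_zero hg (x := x) ?_
  · rw [map_sub, map_sum] at h1
    refine (sub_eq_zero.mp h1).trans ?_
    rw [LinearMap.sum_apply]
    change (∑ i, T (c i α • chartCoordinate hχ i) : Form E M).1 x = _
    rw [coe_sum_apply]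
    refine Finset.sum_congr rfl fun i _ => ?_
    rw [map_smul]
    rfl
  · change (formD E M _).1 x = 0
    rw [map_sub, map_sum]
    refine sub_eq_zero.mpr (hα.trans ?_)
    change _ = (∑ i, formD E M (c i α • chartCoordinate hχ i) : Form E M).1 x
    rw [coe_sum_apply]
    conv_lhs => rw [hc α, map_sum]
    refine Finset.sum_congr rfl fun i _ => ?_
    rw [map_smul, map_smul, ← (exteriorDer_chartCoordinate hχ hx i).self_of_nhds]
    rfl

/-- Near each point `A α` is the sum of the coefficients of `α` times `T` of the coordinate
functions, and these are smooth because `T` takes values in smooth forms. -/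
theorem smoothFamily_of_symbol {A : ∀ x : M, Covector (TangentSpace 𝓘(ℝ, E) x) →ₗ[ℂ]
    ExtForm (TangentSpace 𝓘(ℝ, E) x)} (hA : ∀ x, ∀ f ∈ degForm E M 0, ∀ α,
      exteriorDer f.1 x = ExteriorAlgebra.ι ℂ α → (T f).1 x = A x α) : SmoothFamily A := by
  intro α hα
  refine RawForm.smooth_of_eventuallyEq fun x => ?_
  have hx := mem_extChartAt_source (I := 𝓘(ℝ, E)) x
  obtain ⟨χ, hχ, -⟩ := exists_isBumpAt hx Filter.univ_mem
  set φ : RawForm E M := fun x => ExteriorAlgebra.ι ℂ (α x) with hφ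
  have hc (i : Fin (Module.finrank ℝ E)) : ContDiffOn ℝ ∞
      (fun y => ExteriorAlgebra.ιInv (R := ℂ) (φ.inChart x y) (1 ⊗ₜ Module.finBasis ℝ E i))
      (extChartAt 𝓘(ℝ, E) x).target :=
    hα x (Module.Dual.eval ℂ _ (1 ⊗ₜ Module.finBasis ℝ E i) ∘ₗ ExteriorAlgebra.ιInv)
  refine ⟨(∑ i, chartFunction hχ _ (hc i) * T (chartCoordinate hχ i) : Form E M).1,
    (∑ i, chartFunction hχ _ (hc i) * T (chartCoordinate hχ i) : Form E M).2, ?_⟩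
  have e1 := Filter.eventually_all.mpr fun i => chartFunction_eventually hχ _ (hc i)
  have e2 := Filter.eventually_all.mpr fun i => exteriorDer_chartCoordinate hχ hx i
  filter_upwards [e1, e2, (isOpen_extChartAt_source x).mem_nhds hx] with z hz1 hz2 hz
  rw [coe_sum_apply]
  have h1 : α z = ∑ i, ExteriorAlgebra.ιInv (R := ℂ) (φ.inChart x (extChartAt 𝓘(ℝ, E) x z))
      (1 ⊗ₜ Module.finBasis ℝ E i) • chartCovector E x z i := by
    obtain ⟨y, hy, rfl, h⟩ := exists_eq_symm hz
    rw [h]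
    have h2 : ExteriorAlgebra.ιInv (R := ℂ) (φ.inChart x y) =
        α ((extChartAt 𝓘(ℝ, E) x).symm y) ∘ₗ (chartSymmDeriv E x y).baseChange ℂ := by
      rw [RawForm.inChart, hφ, pullback_ι]
      exact ExteriorAlgebra.ι_leftInverse _
    rw [h2]
    exact covector_eq_sum_chartCovector hy _
  conv_lhs => rw [h1]
  rw [map_sum]
  refine Finset.sum_congr rfl fun i _ => ?_
  change _ = (chartFunction hχ _ (hc i)).1 z * (T (chartCoordinate hχ i)).1 z
  rw [hz1 i, hA z _ (chartCoordinate_mem hχ i) _ (hz2 i), map_smul, Algebra.smul_def]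

theorem exists_form_eq (x : M) (α : Covector (TangentSpace 𝓘(ℝ, E) x)) :
    ∃ φ : Form E M, φ.1 x = ExteriorAlgebra.ι ℂ α := by
  obtain ⟨f, -, hf⟩ := exists_function_exteriorDer_eq x α
  exact ⟨formD E M f, hf⟩

/-- A derivation that vanishes on functions is given on forms of degree one by a linear map at each
point. -/
theorem IsDerivationOfDegree.exists_linearMap (hT : IsDerivationOfDegree E M k T)
    (h0 : ∀ f ∈ degForm E M 0, T f = 0) (x : M) :
    ∃ A : Covector (TangentSpace 𝓘(ℝ, E) x) →ₗ[ℂ] ExtForm (TangentSpace 𝓘(ℝ, E) x),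
      ∀ (φ : Form E M) (α), φ.1 x = ExteriorAlgebra.ι ℂ α → (T φ).1 x = A α := by
  have hx := mem_extChartAt_source (I := 𝓘(ℝ, E)) x
  obtain ⟨c, hc⟩ := exists_coordinates hx
  choose ψ hψ using fun i => exists_form_eq x (chartCovector E x x i)
  refine ⟨∑ i, (c i).smulRight ((T (ψ i)).1 x), fun φ α hα => ?_⟩
  have h1 := hT.apply_eq_zero_of_eq_zero h0 (φ := φ - ∑ i, c i α • ψ i) (x := x) ?_
  · rw [map_sub, map_sum] at h1
    refine (sub_eq_zero.mp h1).trans ?_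
    rw [LinearMap.sum_apply]
    change (∑ i, T (c i α • ψ i) : Form E M).1 x = _
    rw [coe_sum_apply]
    refine Finset.sum_congr rfl fun i _ => ?_
    rw [map_smul]
    rfl
  · refine sub_eq_zero.mpr (hα.trans ?_)
    change _ = (∑ i, c i α • ψ i : Form E M).1 x
    rw [coe_sum_apply]
    conv_lhs => rw [hc α, map_sum]
    refine Finset.sum_congr rfl fun i _ => ?_
    rw [map_smul, ← hψ i]
    rfl

/-- A derivation that vanishes on functions and on forms of degree one vanishes. -/
theorem IsDerivationOfDegree.eq_zero (hT : IsDerivationOfDegree E M k T)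
    (h0 : ∀ f ∈ degForm E M 0, T f = 0)
    (h1 : ∀ (φ : Form E M) (x : M) (α), φ.1 x = ExteriorAlgebra.ι ℂ α → (T φ).1 x = 0)
    (φ : Form E M) : T φ = 0 := by
  refine Subtype.ext (funext fun x => ?_)
  -- As `T` is pointwise, it suffices to find, for each value at `x`, one form with that value that
  -- `T` kills at `x`. Products of differentials of functions provide it.
  have h2 (ξ : ExtForm (TangentSpace 𝓘(ℝ, E) x)) :
      ∃ ψ : Form E M, ψ.1 x = ξ ∧ (T ψ).1 x = 0 := by
    induction ξ using extForm_induction with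
    | hc c =>
      refine ⟨c • 1, ?_, ?_⟩
      · rw [Algebra.algebraMap_eq_smul_one]
        rfl
      · rw [map_smul, hT.apply_one, smul_zero]
        rfl
    | ha ξ η hξ hη =>
      obtain ⟨ψ, rfl, hψ⟩ := hξ
      obtain ⟨ψ', rfl, hψ'⟩ := hη
      refine ⟨ψ + ψ', rfl, ?_⟩
      rw [map_add]
      change (T ψ).1 x + (T ψ').1 x = 0
      rw [hψ, hψ', add_zero]
    | hm α ξ hξ =>
      obtain ⟨ψ, rfl, hψ⟩ := hξ
      obtain ⟨f, hf, hfα⟩ := exists_function_exteriorDer_eq x α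
      have hdf : formD E M f ∈ degForm E M 1 := by
        intro z
        change exteriorDer f.1 z ∈ _ ^ 1
        rw [pow_one, exteriorDer_function hf (mem_extChartAt_source z)]
        exact ⟨_, rfl⟩
      refine ⟨formD E M f * ψ, ?_, ?_⟩
      · rw [← hfα]
        rfl
      · rw [hT 1 _ hdf ψ]
        change (T (formD E M f)).1 x * ψ.1 x +
          ((-1 : ℂ) ^ (k * ((1 : ℕ) : ℤ))) • ((formD E M f).1 x * (T ψ).1 x) = 0
        rw [h1 _ x α hfα, hψ, zero_mul, mul_zero, smul_zero, add_zero]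
  obtain ⟨ψ, hψ, hTψ⟩ := h2 (φ.1 x)
  have h3 := hT.apply_eq_zero_of_eq_zero h0 (φ := φ - ψ) (x := x) (sub_eq_zero.mpr hψ.symm)
  rw [map_sub] at h3
  exact (sub_eq_zero.mp h3).trans hTψ

end Family

/-! ### The two stages of the decomposition. -/

section Decomposition

variable {E : Type*} [NormedAddCommGroup E] [NormedSpace ℝ E] [FiniteDimensional ℝ E]
variable {M : Type*} [TopologicalSpace M] [ChartedSpace E M] [IsManifold 𝓘(ℝ, E) ∞ M]
variable {J : AlmostComplexStructure E M} {p q : ℤ}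

theorem bidegProj_one_zero_ι {V : Type*} [AddCommGroup V] [Module ℝ V] (J : V →ₗ[ℝ] V)
    (α : Covector V) :
    bidegProj J 1 0 (ExteriorAlgebra.ι ℂ α) = ExteriorAlgebra.ι ℂ (covecProj10 J α) := by
  simp [bidegProj_ι]

theorem bidegProj_zero_one_ι {V : Type*} [AddCommGroup V] [Module ℝ V] (J : V →ₗ[ℝ] V)
    (α : Covector V) :
    bidegProj J 0 1 (ExteriorAlgebra.ι ℂ α) = ExteriorAlgebra.ι ℂ (covecProj01 J α) := by
  simp [bidegProj_ι]

theorem covecProj10_covecProj10 {V : Type*} [AddCommGroup V] [Module ℝ V] {J : V →ₗ[ℝ] V}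
    (hJ : ∀ v, J (J v) = -v) (α : Covector V) :
    covecProj10 J (covecProj10 J α) = covecProj10 J α :=
  covecProj10_of_mem hJ (covecProj10_mem α)

theorem covecProj01_covecProj01 {V : Type*} [AddCommGroup V] [Module ℝ V] {J : V →ₗ[ℝ] V}
    (hJ : ∀ v, J (J v) = -v) (α : Covector V) :
    covecProj01 J (covecProj01 J α) = covecProj01 J α :=
  covecProj01_of_mem hJ (covecProj01_mem α)

variable {A : ∀ x : M, Covector (TangentSpace 𝓘(ℝ, E) x) →ₗ[ℂ]
    ExtForm (TangentSpace 𝓘(ℝ, E) x)}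

theorem SmoothFamily.comp_covecProj10 (hA : SmoothFamily A) (J : AlmostComplexStructure E M) :
    SmoothFamily (fun x => A x ∘ₗ covecProj10 (J.toEnd x)) := fun α hα =>
  hA (fun x => covecProj10 (J.toEnd x) (α x)) <|
    (funext fun x => bidegProj_one_zero_ι (J.toEnd x) (α x) :
      J.proj 1 0 (fun x => ExteriorAlgebra.ι ℂ (α x)) = _) ▸ hα.proj J 1 0

theorem SmoothFamily.comp_covecProj01 (hA : SmoothFamily A) (J : AlmostComplexStructure E M) :
    SmoothFamily (fun x => A x ∘ₗ covecProj01 (J.toEnd x)) := fun α hα =>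
  hA (fun x => covecProj01 (J.toEnd x) (α x)) <|
    (funext fun x => bidegProj_zero_one_ι (J.toEnd x) (α x) :
      J.proj 0 1 (fun x => ExteriorAlgebra.ι ℂ (α x)) = _) ▸ hα.proj J 0 1

theorem mem_bidegForm_zero {f : Form E M} (hf : f ∈ degForm E M 0) : f ∈ J.bidegForm 0 0 := by
  intro x
  obtain ⟨c, hc⟩ := mem_degForm_zero_iff.mp hf x
  rw [mem_bidegPart_iff (J.sq_eq x), hc, bidegProj_algebraMap, if_pos ⟨rfl, rfl⟩]

variable {K : RawVecForm E M}

theorem formInterior_function (hK : K.Smooth) {f : Form E M} (hf : f ∈ degForm E M 0) :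
    formInterior K hK f = 0 := by
  refine Subtype.ext (funext fun x => ?_)
  obtain ⟨c, hc⟩ := mem_degForm_zero_iff.mp hf x
  change interiorMap (K x) (f.1 x) = 0
  rw [hc, interiorMap_algebraMap]

/-- The second term of the commutator drops out because `i_K` kills functions. -/
theorem formLie_function (u v k : ℤ) (hK : K.Smooth) {f : Form E M} (hf : f ∈ degForm E M 0)
    (x : M) : (formLie J u v k K hK f).1 x =
      interiorMap (K x) (bidegProj (J.toEnd x) u v (exteriorDer f.1 x)) := by
  have h1 : formDelta J u v f = formProj J u v (formD E M f) := by
    have h := formDelta_of_mem u v (mem_bidegForm_zero (J := J) hf)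
    rwa [show 0 + u = u from zero_add u, show 0 + v = v from zero_add v] at h
  have h2 : formLie J u v k K hK f = formInterior K hK (formDelta J u v f) := by
    rw [formLie, LinearMap.sub_apply, LinearMap.comp_apply, LinearMap.smul_apply,
      LinearMap.comp_apply, formInterior_function hK hf, LinearMap.map_zero, smul_zero, sub_zero]
  exact congrFun (congrArg Subtype.val (h2.trans (congrArg (formInterior K hK) h1))) x

variable [T2Space M] {T : Form E M →ₗ[ℂ] Form E M}

/-- A derivation that maps functions to forms of type `(p,q)` agrees on functions with the sum of
two Lie derivatives. -/
theorem IsDerivationOfDegree.exists_lie (hT : IsDerivationOfDegree E M (p + q) T)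
    (hTf : ∀ f ∈ degForm E M 0, T f ∈ J.bidegForm p q) :
    ∃ (K' : RawVecForm E M) (hK' : K' ∈ J.vecForm10 p q)
      (K'' : RawVecForm E M) (hK'' : K'' ∈ J.vecForm01 p q), ∀ f ∈ degForm E M 0,
        (T - formLie J 1 0 (p + q) K' hK'.1 - formLie J 0 1 (p + q) K'' hK''.1) f = 0 := by
  choose A hA using hT.exists_symbol
  have hAs : SmoothFamily A := smoothFamily_of_symbol hA
  have hAm (x : M) (α) : A x α ∈ bidegPart (J.toEnd x) p q := by
    obtain ⟨f, hf, hfα⟩ := exists_function_exteriorDer_eq x α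
    rw [← hA x f hf α hfα]
    exact hTf f hf x
  -- The symbol takes every covector to type `(p,q)`, so a single projection is enough to give the
  -- two vector valued forms their types.
  refine ⟨fun x => tensorOf (A x ∘ₗ covecProj10 (J.toEnd x)),
    ⟨tensorOf_smooth (hAs.comp_covecProj10 J), fun x => tensorOf_mem10 (J.sq_eq x) (hAm x)⟩,
    fun x => tensorOf (A x ∘ₗ covecProj01 (J.toEnd x)),
    ⟨tensorOf_smooth (hAs.comp_covecProj01 J), fun x => tensorOf_mem01 (J.sq_eq x) (hAm x)⟩,
    fun f hf => Subtype.ext (funext fun x => ?_)⟩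
  rw [LinearMap.sub_apply, LinearMap.sub_apply]
  refine (congrArg₂ (fun a b => (T f).1 x - a - b) (formLie_function 1 0 _ _ hf x)
    (formLie_function 0 1 _ _ hf x)).trans ?_
  have hx := exteriorDer_function hf (mem_extChartAt_source (I := 𝓘(ℝ, E)) x)
  simp only [hA x f hf _ hx]
  rw [hx, bidegProj_one_zero_ι, bidegProj_zero_one_ι, interiorMap_tensorOf, interiorMap_tensorOf,
    LinearMap.comp_apply, LinearMap.comp_apply, covecProj10_covecProj10 (J.sq_eq x),
    covecProj01_covecProj01 (J.sq_eq x), sub_sub, ← map_add, covecProj10_add_covecProj01, sub_self]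
  rfl

/-- A derivation that vanishes on functions is the sum of two interior derivatives. -/
theorem IsDerivationOfDegree.exists_interior (hT : IsDerivationOfDegree E M (p + q) T)
    (h0 : ∀ f ∈ degForm E M 0, T f = 0)
    (h10 : ∀ φ ∈ J.bidegForm 1 0, T φ ∈ J.bidegForm (p + 1) q)
    (h01 : ∀ φ ∈ J.bidegForm 0 1, T φ ∈ J.bidegForm p (q + 1)) :
    ∃ (L' : RawVecForm E M) (hL' : L' ∈ J.vecForm10 (p + 1) q)
      (L'' : RawVecForm E M) (hL'' : L'' ∈ J.vecForm01 p (q + 1)),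
        ∀ φ, T φ = formInterior L' hL'.1 φ + formInterior L'' hL''.1 φ := by
  choose C hC using hT.exists_linearMap h0
  have hCs : SmoothFamily C := fun α hα =>
    (funext fun x => hC x ⟨_, hα⟩ (α x) rfl : (T ⟨_, hα⟩).1 = _) ▸ (T ⟨_, hα⟩).2
  have hC10 (x : M) (α) : (C x ∘ₗ covecProj10 (J.toEnd x)) α ∈
      bidegPart (J.toEnd x) (p + 1) q := by
    obtain ⟨φ, hφ⟩ := exists_form_eq x α
    have h1 : (formProj J 1 0 φ).1 x = ExteriorAlgebra.ι ℂ (covecProj10 (J.toEnd x) α) := by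
      rw [← bidegProj_one_zero_ι, ← hφ]
      rfl
    rw [LinearMap.comp_apply, ← hC x _ _ h1]
    exact h10 _ (formProj_mem _ _ _) x
  have hC01 (x : M) (α) : (C x ∘ₗ covecProj01 (J.toEnd x)) α ∈
      bidegPart (J.toEnd x) p (q + 1) := by
    obtain ⟨φ, hφ⟩ := exists_form_eq x α
    have h1 : (formProj J 0 1 φ).1 x = ExteriorAlgebra.ι ℂ (covecProj01 (J.toEnd x) α) := by
      rw [← bidegProj_zero_one_ι, ← hφ]
      rfl
    rw [LinearMap.comp_apply, ← hC x _ _ h1]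
    exact h01 _ (formProj_mem _ _ _) x
  -- The projection appears twice for two reasons. The inner one restricts `C` to covectors of one
  -- type, where its values have the right type; the outer one puts the vector part into the right
  -- eigenspace.
  set L' : RawVecForm E M :=
    fun x => tensorOf ((C x ∘ₗ covecProj10 (J.toEnd x)) ∘ₗ covecProj10 (J.toEnd x)) with hL
  set L'' : RawVecForm E M :=
    fun x => tensorOf ((C x ∘ₗ covecProj01 (J.toEnd x)) ∘ₗ covecProj01 (J.toEnd x)) with hL2
  have hL' : L' ∈ J.vecForm10 (p + 1) q :=
    ⟨tensorOf_smooth ((hCs.comp_covecProj10 J).comp_covecProj10 J),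
      fun x => tensorOf_mem10 (J.sq_eq x) (hC10 x)⟩
  have hL'' : L'' ∈ J.vecForm01 p (q + 1) :=
    ⟨tensorOf_smooth ((hCs.comp_covecProj01 J).comp_covecProj01 J),
      fun x => tensorOf_mem01 (J.sq_eq x) (hC01 x)⟩
  refine ⟨L', hL', L'', hL'', fun φ => ?_⟩
  have hd' : IsDerivationOfDegree E M (p + q) (formInterior L' hL'.1) := by
    have h := isDerivationOfDegree_interior hL'.1 hL'.2
    rwa [show p + 1 + q - 1 = p + q by ring] at h
  have hd'' : IsDerivationOfDegree E M (p + q) (formInterior L'' hL''.1) := by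
    have h := isDerivationOfDegree_interior hL''.1 hL''.2
    rwa [show p + (q + 1) - 1 = p + q by ring] at h
  -- Both interior derivatives have degree `p + q`, the form degree `p + q + 1` less one, so the
  -- difference is a single derivation.
  have h := ((hT.sub hd').sub hd'').eq_zero (fun f hf => ?_) (fun φ x α hφ => ?_) φ
  · rw [LinearMap.sub_apply, LinearMap.sub_apply, sub_sub] at h
    exact sub_eq_zero.mp h
  · rw [LinearMap.sub_apply, LinearMap.sub_apply, h0 f hf, formInterior_function _ hf,
      formInterior_function _ hf, sub_zero, sub_zero]
  · rw [LinearMap.sub_apply, LinearMap.sub_apply]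
    change (T φ).1 x - interiorMap (L' x) (φ.1 x) - interiorMap (L'' x) (φ.1 x) = 0
    rw [hC x φ α hφ, hφ, hL, hL2, interiorMap_tensorOf, interiorMap_tensorOf]
    simp only [LinearMap.comp_apply]
    rw [covecProj10_covecProj10 (J.sq_eq x), covecProj01_covecProj01 (J.sq_eq x), sub_sub,
      ← map_add, covecProj10_add_covecProj01, sub_self]

end Decomposition

end AlmostComplex

end

/-! ### The decomposition theorem. -/

theorem proposition3p3 {E : Type*} [NormedAddCommGroup E] [NormedSpace ℝ E] [FiniteDimensional ℝ E]
    {M : Type*} [TopologicalSpace M] [ChartedSpace E M] [IsManifold 𝓘(ℝ, E) ∞ M]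
    [T2Space M] [SecondCountableTopology M]
    (J : AlmostComplex.AlmostComplexStructure E M) (p q : ℤ)
    (D : AlmostComplex.Form E M →ₗ[ℂ] AlmostComplex.Form E M)
    (hD : J.IsBigradedDerivation p q D) :
    ∃ K' ∈ J.vecForm10 p q, ∃ K'' ∈ J.vecForm01 p q,
      ∃ L' ∈ J.vecForm10 (p + 1) q, ∃ L'' ∈ J.vecForm01 p (q + 1),
        ∀ φ : AlmostComplex.Form E M,
          (D φ : AlmostComplex.RawForm E M) =
            J.lie10 (p + q) K' φ + J.lie01 (p + q) K'' φ +
              AlmostComplex.interiorDer L' φ + AlmostComplex.interiorDer L'' φ := by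
  have hT : AlmostComplex.IsDerivationOfDegree E M (p + q) D := hD.leibniz
  obtain ⟨K', hK', K'', hK'', h0⟩ := hT.exists_lie (J := J) fun f hf => by
    have h := hD.map_bidegForm 0 0 f (AlmostComplex.mem_bidegForm_zero hf)
    rwa [zero_add, zero_add] at h
  -- The Lie derivatives have bidegree `(p,q)` too, so subtracting them keeps the type; the second
  -- stage needs this on forms of type `(1,0)` and `(0,1)`.
  have hmem {a b : ℤ} {φ : AlmostComplex.Form E M} (hφ : φ ∈ J.bidegForm a b) :
      (D - AlmostComplex.formLie J 1 0 (p + q) K' hK'.1 -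
        AlmostComplex.formLie J 0 1 (p + q) K'' hK''.1) φ ∈ J.bidegForm (p + a) (q + b) := by
    have h := hD.map_bidegForm a b φ hφ
    rw [add_comm a, add_comm b] at h
    exact Submodule.sub_mem _ (Submodule.sub_mem _ h
      (AlmostComplex.formLie_mem hK'.1 hK'.2 (Or.inl ⟨rfl, rfl, fun _ => rfl⟩) hφ _))
      (AlmostComplex.formLie_mem hK''.1 hK''.2 (Or.inr ⟨rfl, rfl, fun _ => rfl⟩) hφ _)
  obtain ⟨L', hL', L'', hL'', h⟩ :=
    ((hT.sub (AlmostComplex.isDerivationOfDegree_lie 1 0 hK'.1 hK'.2)).sub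
      (AlmostComplex.isDerivationOfDegree_lie 0 1 hK''.1 hK''.2)).exists_interior (J := J) h0
      (fun φ hφ => by simpa only [add_zero] using hmem hφ)
      (fun φ hφ => by simpa only [add_zero] using hmem hφ)
  refine ⟨K', hK', K'', hK'', L', hL', L'', hL'', fun φ => ?_⟩
  have h1 := h φ
  rw [LinearMap.sub_apply, LinearMap.sub_apply, sub_sub, sub_eq_iff_eq_add] at h1
  rw [h1, add_comm, ← add_assoc]
  change (AlmostComplex.formLie J 1 0 (p + q) K' hK'.1 φ).1 +
    (AlmostComplex.formLie J 0 1 (p + q) K'' hK''.1 φ).1 + _ + _ = _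
  rw [AlmostComplex.coe_formLie10, AlmostComplex.coe_formLie01]
  rfl
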